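/- **Conventions.** A quantum circuit $C$ is a finite sequence of $|C|$ gates from $\{H, T, \mathrm{CNOT}, \mathrm{Toffoli}\}$ on a fixed number of qubits, and $U_C$ is its unitary. A quantum polynomial-time algorithm (QPT) is a family of such circuits, acting on an input and on ancillas that start in $|0\rangle$, with measurements and discarding of qubits at the end, whose descriptions are computed by a deterministic polynomial-time machine from the parameters of the family in unary. An oracle QPT may in addition query given unitaries (also their inverses and controlled versions). A function $\epsilon:\mathbb N\to\mathbb R$ is negligible if $n^c\,\epsilon(n)\to 0$ for every $c$. A *circuit-pair family* $\mathcal C$ is a sequence of probability distributions $\mathcal C_n$ on pairs of circuits of size polynomial in $n$; it is *poly-time* if a probabilistic polynomial-time machine, on input $1^n$, outputs a description of a pair drawn from $\mathcal C_n$. A *state-pair family* $\mathcal C'$ is a sequence of probability distributions $\mathcal C'_n$ on pairs of density operators on polynomially (in $n$) many qubits; it need not be efficiently samplable, nor even computable. $\mathcal C'$ is an *obfuscation* of $\mathcal C$ if there are a map $\mathcal O$ from circuits to density operators and a QPT $\mathcal J$ such that $\mathcal C'_n$ is the distribution of $(\mathcal O(C_1),\mathcal O(C_2))$ for $(C_1,C_2)\leftarrow\mathcal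 C_n$, for every $n$, and: 1. (polynomial expansion) there is a polynomial $p$ such that, for every circuit $C$ of the family on $k$ qubits, $\mathcal O(C)$ has at most $p(k+|C|)$ qubits; 2. (functional equivalence) there is a negligible $\epsilon$ such that, for every circuit $C$ of the family on $k$ qubits and every density operator $\rho$ on $k$ qubits, $\|\mathcal J(\mathcal O(C)\otimes\rho)-U_C\,\rho\,U_C^\dagger\|_{\mathrm{tr}}\le\epsilon(k)$, where $\mathcal J$ may destroy $\mathcal O(C)$ (the states are single-use); 3. (two-circuit virtual black-box) for every QPT $\mathcal A$ there are an oracle QPT $\mathcal S$ and a negligible $\epsilon$ such that, for every $n$ and every pair $(C_1,C_2)$ in the support of $\mathcal C_n$, $$\Bigl|\Pr\bigl[\mathcal A(\mathcal O(C_1)\otimes\mathcal O(C_2))=1\bigr]-\Pr\bigl[\mathcal S^{U_{C_1},U_{C_2}}(|0\cdots0\rangle)=1\bigr]\Bigr|\le\epsilon\bigl(\min\{n,|C_1|,|C_2|\}\bigr).$$ Here $\mathcal A$ is also given $1^n$ and the numbers of qubits of the two states, and $\mathcal S$ is given $1^n$ and the numbers of qubits and of gates of $C_1$ and $C_2$,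 all in unary. **Theorem.** There exists a poly-time quantum circuit-pair family $\mathcal C$ such that no state-pair family is an obfuscation of $\mathcal C$. -/

import Mathlib

open scoped Matrix ComplexOrder

noncomputable section

namespace QObf

/-! ### Machine model

Programs over finitely many stacks of bits (a multi-stack Turing machine with structured control).
Polynomial time for these programs is polynomial time for multi-tape Turing machines. Each stack operation and each test of the top of a stack costs one step. -/

/-- The contents of the stacks; the first element of a list is the top of the stack. -/
abbrev Store := ℕ → List Bool

inductive Prog : Type
  | nop : Prog
  | push (r : ℕ) (b : Bool) : Prog
  | pop (r : ℕ) : Prog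
  | seq (c d : Prog) : Prog
  /-- run `c` if the top of stack `r` is `true`, and `d` if it is `false` or the stack is empty -/
  | ifTop (r : ℕ) (c d : Prog) : Prog
  /-- run `c` as long as stack `r` is not empty -/
  | loop (r : ℕ) (c : Prog) : Prog

/-- `Exec c s t s'`: the program `c`, started on `s`, halts after exactly `t` steps in `s'`. -/
inductive Exec : Prog → Store → ℕ → Store → Prop
  | nop (s : Store) : Exec Prog.nop s 1 s
  | push (s : Store) (r : ℕ) (b : Bool) :
      Exec (Prog.push r b) s 1 (Function.update s r (b :: s r))
  | pop (s : Store) (r : ℕ) : Exec (Prog.pop r) s 1 (Function.update s r (s r).tail)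
  | seq {c d : Prog} {s s' s'' : Store} {t t' : ℕ} :
      Exec c s t s' → Exec d s' t' s'' → Exec (Prog.seq c d) s (t + t') s''
  | ifTrue {r : ℕ} {c d : Prog} {s s' : Store} {t : ℕ} :
      (s r).head? = some true → Exec c s t s' → Exec (Prog.ifTop r c d) s (t + 1) s'
  | ifFalse {r : ℕ} {c d : Prog} {s s' : Store} {t : ℕ} :
      (s r).head? ≠ some true → Exec d s t s' → Exec (Prog.ifTop r c d) s (t + 1) s'
  | loopDone {r : ℕ} {c : Prog} {s : Store} : s r = [] → Exec (Prog.loop r c) s 1 s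
  | loopStep {r : ℕ} {c : Prog} {s s' s'' : Store} {t t' : ℕ} :
      s r ≠ [] → Exec c s t s' → Exec (Prog.loop r c) s' t' s'' →
      Exec (Prog.loop r c) s (t + t' + 1) s''

/-- Stack `i` holds the `i`-th parameter in unary, for `i < d`; the other stacks are empty. -/
def unaryStore {d : ℕ} (v : Fin d → ℕ) : Store :=
  fun r => if h : r < d then List.replicate (v ⟨r, h⟩) true else []

/-- There is a deterministic machine that, on the parameters `v` in unary, outputs (on stack `0`)
the description of `F v`, in time polynomial in the length of its input. -/
def IsUniform {α : Type} {d : ℕ} (enc : α → List Bool) (F : (Fin d → ℕ) → α) : Prop :=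
  ∃ (c : Prog) (p : Polynomial ℕ), ∀ v : Fin d → ℕ, ∃ (t : ℕ) (s : Store),
    Exec c (unaryStore v) t s ∧ t ≤ p.eval (∑ i, v i) ∧ s 0 = enc (F v)

/-! ### Linear algebra of qubits -/

abbrev Bits (n : ℕ) := Fin n → Bool

/-- Operators on `n` qubits, written in the computational basis. -/
abbrev Op (n : ℕ) := Matrix (Bits n) (Bits n) ℂ

/-- `ρ ⊗ σ`, with the qubits of `ρ` first. -/
def tensor {m n : ℕ} (ρ : Op m) (σ : Op n) : Op (m + n) :=
  Matrix.of fun x y => ρ (fun i => x (Fin.castAdd n i)) (fun i => y (Fin.castAdd n i)) *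
    σ (fun i => x (Fin.natAdd m i)) (fun i => y (Fin.natAdd m i))

/-- The pure state `|0ⁿ⟩⟨0ⁿ|`. -/
def zeroState (n : ℕ) : Op n := Matrix.single (fun _ => false) (fun _ => false) 1

/-- Trace norm: the sum of the singular values. -/
def traceNorm {n : ℕ} (M : Op n) : ℝ :=
  ∑ i, Real.sqrt ((Matrix.isHermitian_conjTranspose_mul_self M).eigenvalues i)

open Classical in
/-- The operator on `N` qubits that applies the `k`-qubit operator `G` to the qubits
`w 0, …, w (k - 1)` and leaves the others alone. If the `w j` are not distinct qubits below `N`,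
the instruction is ignored. -/
def place (N : ℕ) {k : ℕ} (w : Fin k → ℕ) (G : Op k) : Op N :=
  if h : Function.Injective w ∧ ∀ j, w j < N then
    Matrix.of fun x y =>
      if ∀ i : Fin N, (∀ j, w j ≠ i) → x i = y i then
        G (fun j => x ⟨w j, h.2 j⟩) (fun j => y ⟨w j, h.2 j⟩)
      else 0
  else 1

/-- The controlled version of `U`; the first qubit is the control. -/
def controlled {k : ℕ} (U : Op k) : Op (k + 1) :=
  Matrix.of fun x y =>
    if x 0 = y 0 then (if x 0 = true then U else 1) (Fin.tail x) (Fin.tail y) else 0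

/-! ### Quantum circuits over the gate set Hadamard, `T`, CNOT, Toffoli -/

inductive Gate : Type
  | h (i : ℕ) : Gate
  | t (i : ℕ) : Gate
  | cx (i j : ℕ) : Gate
  | ccx (i j k : ℕ) : Gate

def hGate : Op 1 :=
  Matrix.of fun x y =>
    if x 0 = true ∧ y 0 = true then -(1 / (Real.sqrt 2 : ℂ)) else 1 / (Real.sqrt 2 : ℂ)

def tGate : Op 1 :=
  Matrix.diagonal fun x => if x 0 = true then Complex.exp (Complex.I * (Real.pi / 4)) else 1

def cnot : Op 2 :=
  Matrix.of fun x y => if x = ![y 0, xor (y 0) (y 1)] then 1 else 0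

def toffoli : Op 3 :=
  Matrix.of fun x y => if x = ![y 0, y 1, xor (y 0 && y 1) (y 2)] then 1 else 0

/-- The unitary of a gate of a circuit on `N` qubits. -/
def Gate.op (N : ℕ) : Gate → Op N
  | .h i => place N (k := 1) ![i] hGate
  | .t i => place N (k := 1) ![i] tGate
  | .cx i j => place N (k := 2) ![i, j] cnot
  | .ccx i j k => place N (k := 3) ![i, j, k] toffoli

/-- The unitary of a sequence of gates; the head of the list is applied first. -/
def gatesOp (N : ℕ) : List Gate → Op N
  | [] => 1
  | g :: gs => gatesOp N gs * g.op N

/-- A quantum circuit: a sequence of local unitary gates on a fixed number of qubits. -/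
structure Circuit where
  qubits : ℕ
  gates : List Gate

/-- `U_C`. -/
def Circuit.unitary (C : Circuit) : Op C.qubits := gatesOp C.qubits C.gates

/-- `|C|`, the number of gates. -/
def Circuit.size (C : Circuit) : ℕ := C.gates.length

/-! ### Classical descriptions -/

/-- Self-delimiting unary code. -/
def encNat (n : ℕ) : List Bool := List.replicate n true ++ [false]

/-- Self-delimiting code of a list. -/
def encList {α : Type} (enc : α → List Bool) : List α → List Bool
  | [] => [false]
  | a :: l => true :: (enc a ++ encList enc l)

def encGate : Gate → List Bool
  | .h i => false :: false :: encNat i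
  | .t i => false :: true :: encNat i
  | .cx i j => true :: false :: (encNat i ++ encNat j)
  | .ccx i j k => true :: true :: (encNat i ++ encNat j ++ encNat k)

def encCircuit (C : Circuit) : List Bool := encNat C.qubits ++ encList encGate C.gates

def encCircuitPair (P : Circuit × Circuit) : List Bool := encCircuit P.1 ++ encCircuit P.2

/-! ### Quantum polynomial-time algorithms

An algorithm runs, for each value of its parameters, a circuit on its input and on ancillas that
start in `|0⟩`; measurements and the discarding of qubits take place at the end. -/

structure QAlg where
  ancillas : ℕ
  gates : List Gate

def encQAlg (A : QAlg) : List Bool := encNat A.ancillas ++ encList encGate A.gates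

/-- A quantum polynomial-time algorithm with `d` unary parameters. -/
def IsQPT {d : ℕ} (A : (Fin d → ℕ) → QAlg) : Prop := IsUniform encQAlg A

/-- The joint state of all the qubits at the end of the run on the input `ρ`. -/
def QAlg.run (A : QAlg) {k : ℕ} (ρ : Op k) : Op (k + A.ancillas) :=
  gatesOp (k + A.ancillas) A.gates * tensor ρ (zeroState A.ancillas) *
    (gatesOp (k + A.ancillas) A.gates)ᴴ

/-- Probability that a measurement of the output qubit, qubit `0`, gives `1`
(zero if there is no qubit). -/
def prOne {N : ℕ} (ρ : Op N) : ℝ :=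
  ∑ x : Bits N, if ∃ h : 0 < N, x ⟨0, h⟩ = true then (ρ x x).re else 0

/-- An interpreter acts on an advice register of `m` qubits, an input register of `n` qubits and
ancillas. Its output is the final content of the input register; all the rest, in particular what
is left of the advice, is discarded. -/
def QAlg.interpret (J : QAlg) {m n : ℕ} (ρ : Op (m + n)) : Op n :=
  Matrix.of fun x y => ∑ u : Bits m, ∑ z : Bits J.ancillas,
    J.run ρ (Fin.append (Fin.append u x) z) (Fin.append (Fin.append u y) z)

/-! ### Algorithms with black-box access to two unitaries -/

inductive OGate : Type
  | gate (g : Gate) : OGate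
  /-- A query to the first (`second = false`) or second oracle on the listed qubits. Simulators may
  also query the inverse and the controlled unitary (the control is the first listed qubit). -/
  | query (second inverse ctrl : Bool) (w : List ℕ) : OGate

def encOGate : OGate → List Bool
  | .gate g => false :: encGate g
  | .query s i c w => true :: s :: i :: c :: encList encNat w

/-- One query to `U`; ignored if the number of listed qubits is wrong. -/
def queryOp (N : ℕ) {k : ℕ} (U : Op k) (inverse ctrl : Bool) (w : List ℕ) : Op N :=
  let V : Op k := if inverse = true then Uᴴ else U
  if ctrl = true then
    (if w.length = k + 1 then place N (fun j : Fin (k + 1) => w.getD j 0) (controlled V) else 1)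
  else
    (if w.length = k then place N (fun j : Fin k => w.getD j 0) V else 1)

def OGate.op (N : ℕ) {k₁ k₂ : ℕ} (U₁ : Op k₁) (U₂ : Op k₂) : OGate → Op N
  | .gate g => g.op N
  | .query second inverse ctrl w =>
      if second = true then queryOp N U₂ inverse ctrl w else queryOp N U₁ inverse ctrl w

def ogatesOp (N : ℕ) {k₁ k₂ : ℕ} (U₁ : Op k₁) (U₂ : Op k₂) : List OGate → Op N
  | [] => 1
  | g :: gs => ogatesOp N U₁ U₂ gs * g.op N U₁ U₂

/-- An oracle circuit; all its qubits start in `|0⟩`. -/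
structure OAlg where
  qubits : ℕ
  gates : List OGate

def encOAlg (S : OAlg) : List Bool := encNat S.qubits ++ encList encOGate S.gates

/-- A quantum polynomial-time oracle algorithm with `d` unary parameters. -/
def IsOracleQPT {d : ℕ} (S : (Fin d → ℕ) → OAlg) : Prop := IsUniform encOAlg S

/-- `Pr[S^{U₁,U₂}(|0…0⟩) = 1]`. -/
def OAlg.prAccept (S : OAlg) {k₁ k₂ : ℕ} (U₁ : Op k₁) (U₂ : Op k₂) : ℝ :=
  prOne (ogatesOp S.qubits U₁ U₂ S.gates * zeroState S.qubits *
    (ogatesOp S.qubits U₁ U₂ S.gates)ᴴ)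

/-! ### Obfuscation -/

def Negligible (ε : ℕ → ℝ) : Prop :=
  Asymptotics.SuperpolynomialDecay Filter.atTop (fun n : ℕ => (n : ℝ)) ε

/-- A density operator on some number of qubits. -/
structure QState where
  qubits : ℕ
  op : Op qubits
  posSemidef : op.PosSemidef
  trace_eq_one : op.trace = 1

/-- An ensemble of distributions on pairs of polynomial-size circuits. -/
structure CircuitPairFamily where
  dist : ℕ → PMF (Circuit × Circuit)
  poly_size : ∃ p : Polynomial ℕ, ∀ n, ∀ P ∈ (dist n).support,
    P.1.qubits + P.1.size ≤ p.eval n ∧ P.2.qubits + P.2.size ≤ p.eval n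

/-- A polynomial-time machine which is given `n` in unary and a polynomial number of fair coins
outputs a description of a pair of circuits drawn from the `n`-th distribution. -/
def CircuitPairFamily.IsPolyTime (C : CircuitPairFamily) : Prop :=
  ∃ (c : Prog) (p q : Polynomial ℕ) (sample : ∀ n : ℕ, Bits (q.eval n) → Circuit × Circuit),
    (∀ (n : ℕ) (r : Bits (q.eval n)), ∃ (t : ℕ) (s : Store),
      Exec c (fun i => if i = 0 then List.replicate n true else if i = 1 then List.ofFn r else [])
        t s ∧ t ≤ p.eval n ∧ s 0 = encCircuitPair (sample n r)) ∧
    ∀ n : ℕ, C.dist n = (PMF.uniformOfFintype (Bits (q.eval n))).map (sample n)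

/-- An ensemble of distributions on pairs of states on polynomially many qubits. No computability
is demanded of it. -/
structure StatePairFamily where
  dist : ℕ → PMF (QState × QState)
  poly_qubits : ∃ p : Polynomial ℕ, ∀ n, ∀ P ∈ (dist n).support,
    P.1.qubits ≤ p.eval n ∧ P.2.qubits ≤ p.eval n

/-- `D` is one of the circuits of the family. -/
def CircuitPairFamily.Mem (C : CircuitPairFamily) (D : Circuit) : Prop :=
  ∃ n, ∃ P ∈ (C.dist n).support, D = P.1 ∨ D = P.2

/-- The obfuscated states have polynomially many qubits. -/
def PolyExpansion (C : CircuitPairFamily) (O : Circuit → QState) : Prop :=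
  ∃ p : Polynomial ℕ, ∀ D, C.Mem D → (O D).qubits ≤ p.eval (D.qubits + D.size)

/-- Run once on the obfuscation of `D` and on an input `ρ`, the interpreter outputs `U_D ρ U_D†`
up to an error in trace norm that is negligible in the number of qubits of `D`. -/
def FunctionalEquivalence (C : CircuitPairFamily) (O : Circuit → QState)
    (J : (Fin 2 → ℕ) → QAlg) : Prop :=
  ∃ ε : ℕ → ℝ, Negligible ε ∧ ∀ D, C.Mem D → ∀ ρ : Op D.qubits, ρ.PosSemidef → ρ.trace = 1 →
    traceNorm ((J ![(O D).qubits, D.qubits]).interpret (tensor (O D).op ρ) -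
      D.unitary * ρ * D.unitaryᴴ) ≤ ε D.qubits

/-- Every polynomial-time adversary that gets the two obfuscated states, one copy of each, has a
polynomial-time simulator with black-box access to the two unitaries. All parties know the security
parameter `n`; the adversary knows the numbers of qubits of the two states, and the simulator the
numbers of qubits and of gates of the two circuits. The error may be any quantity negligible in `n`
and `min {|C₁|, |C₂|}`. -/
def TwoCircuitVBB (C : CircuitPairFamily) (O : Circuit → QState) : Prop :=
  ∀ A : (Fin 3 → ℕ) → QAlg, IsQPT A →
    ∃ S : (Fin 5 → ℕ) → OAlg, IsOracleQPT S ∧ ∃ ε : ℕ → ℝ, Negligible ε ∧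
      ∀ n, ∀ P ∈ (C.dist n).support,
        |prOne ((A ![n, (O P.1).qubits, (O P.2).qubits]).run (tensor (O P.1).op (O P.2).op)) -
          (S ![n, P.1.qubits, P.2.qubits, P.1.size, P.2.size]).prAccept P.1.unitary P.2.unitary|
        ≤ ε (min n (min P.1.size P.2.size))

/-- `C'` is an obfuscation of `C`: some map `O` from circuits to states carries `C` to `C'` and is,
with some polynomial-time interpreter, a two-circuit obfuscator for the circuits of `C`. -/
def StatePairFamily.IsObfuscationOf (C' : StatePairFamily) (C : CircuitPairFamily) : Prop :=
  ∃ (O : Circuit → QState) (J : (Fin 2 → ℕ) → QAlg),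
    (∀ n, C'.dist n = (C.dist n).map fun P => (O P.1, O P.2)) ∧
    IsQPT J ∧ PolyExpansion C O ∧ FunctionalEquivalence C O J ∧ TwoCircuitVBB C O

end QObf

end

/-!
The family draws two arbitrary circuits from random coins, so that every pair of small circuits is
in the support of one of its distributions. For secrets `a` and `b` let `P` be the point circuit,
which adds `b` to its output register if its input is `a`, and let `T` be the circuit that runs the
interpreter on an advice register and the input `a`, flips a flag qubit if the output is `b'`, and
uncomputes. Running the interpreter on the obfuscation of `T`, with the obfuscation of `P` as input,
reveals whether `b = b'`; this attack uses a single copy of each state.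

A simulator has to distinguish the cases `b' = b` and `b' = ¬b` by polynomially many queries to
the unitaries of `P` and `T`. On any fixed state, both unitaries act almost as the identity for all
but an exponentially small fraction of the secrets: `P` moves only the basis states with input `a`,
and `T` only the part of the state on which the interpreter outputs `b'`. A hybrid argument then
gives a secret for which, in both cases, all queries can be replaced by the identity, so that the
simulator accepts with almost the same probability.
-/

open scoped Matrix ComplexOrder

noncomputable section

namespace QObf

/-! ### Measurement probabilities and the trace norm -/

open Classical in
/-- The probability that a measurement of `ρ` in the computational basis gives a string in `S`. -/
def prob {N : ℕ} (S : Bits N → Prop) (ρ : Op N) : ℝ :=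
  ∑ x, if S x then (ρ x x).re else 0

lemma norm_sum_mul_le_sqrt_mul_sqrt {ι : Type*} [Fintype ι] (f g : ι → ℂ) :
    ‖∑ x, f x * g x‖ ≤ √(∑ x, ‖f x‖ ^ 2) * √(∑ x, ‖g x‖ ^ 2) := by
  refine (norm_sum_le _ _).trans ?_
  simp only [norm_mul]
  exact Real.sum_mul_le_sqrt_mul_sqrt _ _ _

lemma conjTranspose_mul_self_apply_self {m n : Type*} [Fintype m] (B : Matrix m n ℂ) (i : n) :
    (Bᴴ * B) i i = ((∑ x, ‖B x i‖ ^ 2 : ℝ) : ℂ) := by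
  simp only [Matrix.mul_apply, Matrix.conjTranspose_apply, Complex.ofReal_sum, Complex.ofReal_pow]
  exact Finset.sum_congr rfl fun x _ => Complex.conj_mul' _

lemma sum_norm_sq_apply_of_mem_unitaryGroup {n : Type*} [Fintype n] [DecidableEq n]
    {V : Matrix n n ℂ} (hV : V ∈ Matrix.unitaryGroup n ℂ) (i : n) : ∑ x, ‖V x i‖ ^ 2 = 1 := by
  have h := conjTranspose_mul_self_apply_self V i
  rw [← Matrix.star_eq_conjTranspose, Matrix.mem_unitaryGroup_iff'.1 hV, Matrix.one_apply_eq] at h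
  exact_mod_cast h.symm

/-- A unitary whose columns are right singular vectors of `M`, in the order in which `traceNorm`
lists the singular values. -/
def rightSingularUnitary {N : ℕ} (M : Op N) : Op N :=
  (Matrix.isHermitian_conjTranspose_mul_self M).eigenvectorUnitary

lemma rightSingularUnitary_mem_unitaryGroup {N : ℕ} (M : Op N) :
    rightSingularUnitary M ∈ Matrix.unitaryGroup (Bits N) ℂ :=
  (Matrix.isHermitian_conjTranspose_mul_self M).eigenvectorUnitary.2

lemma sum_norm_sq_mul_rightSingularUnitary_apply {N : ℕ} (M : Op N) (i : Bits N) :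
    ∑ x, ‖(M * rightSingularUnitary M) x i‖ ^ 2 =
      (Matrix.isHermitian_conjTranspose_mul_self M).eigenvalues i := by
  have diagonalization : (M * rightSingularUnitary M)ᴴ * (M * rightSingularUnitary M) =
      Matrix.diagonal
        (RCLike.ofReal ∘ (Matrix.isHermitian_conjTranspose_mul_self M).eigenvalues) := by
    rw [← (Matrix.isHermitian_conjTranspose_mul_self M).conjStarAlgAut_star_eigenvectorUnitary]
    simp [rightSingularUnitary, Unitary.conjStarAlgAut_apply, Matrix.conjTranspose_mul,
      Matrix.mul_assoc, Matrix.star_eq_conjTranspose]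
  have h := conjTranspose_mul_self_apply_self (M * rightSingularUnitary M) i
  rw [diagonalization, Matrix.diagonal_apply_eq] at h
  exact Complex.ofReal_injective h.symm

lemma norm_sum_mul_diag_le_traceNorm {N : ℕ} {c : Bits N → ℂ} (hc : ∀ x, ‖c x‖ ≤ 1) (M : Op N) :
    ‖∑ x, c x * M x x‖ ≤ traceNorm M := by
  set V := rightSingularUnitary M
  have hV : V ∈ Matrix.unitaryGroup (Bits N) ℂ := rightSingularUnitary_mem_unitaryGroup M
  have trace_eq : ∑ x, c x * M x x = ∑ i, ∑ x, star (V x i) * c x * (M * V) x i := by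
    calc ∑ x, c x * M x x = (Matrix.diagonal c * M * (V * star V)).trace := by
          simp only [Matrix.mem_unitaryGroup_iff.1 hV, Matrix.mul_one, Matrix.trace,
            Matrix.diag_apply, Matrix.diagonal_mul]
      _ = (star V * Matrix.diagonal c * (M * V)).trace := by
          rw [← Matrix.mul_assoc, Matrix.trace_mul_comm]
          simp only [Matrix.mul_assoc]
      _ = _ := by
          simp only [Matrix.trace, Matrix.diag_apply, Matrix.mul_apply (M := star V * _),
            Matrix.mul_diagonal, Matrix.star_apply]
  rw [trace_eq, traceNorm]
  refine (norm_sum_le _ _).trans (Finset.sum_le_sum fun i _ => ?_)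
  have column_le : ∑ x, ‖star (V x i) * c x‖ ^ 2 ≤ 1 := by
    rw [← sum_norm_sq_apply_of_mem_unitaryGroup hV i]
    refine Finset.sum_le_sum fun x _ => ?_
    rw [norm_mul, norm_star]
    exact pow_le_pow_left₀ (by positivity) (mul_le_of_le_one_right (norm_nonneg _) (hc x)) 2
  refine (norm_sum_mul_le_sqrt_mul_sqrt _ _).trans ?_
  rw [sum_norm_sq_mul_rightSingularUnitary_apply]
  exact mul_le_of_le_one_left (Real.sqrt_nonneg _) (Real.sqrt_le_one.2 column_le)

lemma abs_prob_sub_le_traceNorm {N : ℕ} (S : Bits N → Prop) (X Y : Op N) :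
    |prob S X - prob S Y| ≤ traceNorm (X - Y) := by
  classical
  have prob_sub : prob S X - prob S Y = (∑ x, (if S x then 1 else 0) * (X - Y) x x).re := by
    rw [Complex.re_sum, prob, prob, ← Finset.sum_sub_distrib]
    refine Finset.sum_congr rfl fun x _ => ?_
    split_ifs <;> simp
  rw [prob_sub]
  refine (Complex.abs_re_le_norm _).trans (norm_sum_mul_diag_le_traceNorm (fun x => ?_) _)
  split_ifs <;> simp

lemma prob_congr {N : ℕ} {S T : Bits N → Prop} (h : ∀ x, S x ↔ T x) (ρ : Op N) :
    prob S ρ = prob T ρ := by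
  rw [funext fun x => propext (h x)]

lemma prob_single {N : ℕ} (S : Bits N → Prop) (α : Bits N) [Decidable (S α)] :
    prob S (Matrix.single α α 1) = if S α then 1 else 0 := by
  rw [prob, Finset.sum_eq_single α (fun x _ hx => by simp [hx.symm]) (by simp)]
  by_cases hα : S α <;> simp [hα]

lemma posSemidef_single {N : ℕ} (α : Bits N) : (Matrix.single α α 1 : Op N).PosSemidef := by
  rw [← Matrix.diagonal_single]
  exact Matrix.PosSemidef.diagonal (Pi.single_nonneg.2 zero_le_one)

/-! ### Bit strings indexed by natural numbers -/

/-- The bits of `x`, continued by zeros, so that circuits can be analysed without a bound on the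
number of qubits. -/
def zeroExtend {N : ℕ} (x : Bits N) (i : ℕ) : Bool := if h : i < N then x ⟨i, h⟩ else false

lemma zeroExtend_of_lt {N : ℕ} (x : Bits N) {i : ℕ} (h : i < N) : zeroExtend x i = x ⟨i, h⟩ :=
  dif_pos h

lemma zeroExtend_of_le {N : ℕ} (x : Bits N) {i : ℕ} (h : N ≤ i) : zeroExtend x i = false :=
  dif_neg h.not_gt

@[simp] lemma zeroExtend_val {N : ℕ} (x : Bits N) (i : Fin N) : zeroExtend x i = x i :=
  zeroExtend_of_lt x i.2

/-- The first `N` bits of a sequence. -/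
def truncate (N : ℕ) (σ : ℕ → Bool) : Bits N := fun i => σ i

/-- The bits from position `N` on vanish. -/
def ZeroFrom (N : ℕ) (σ : ℕ → Bool) : Prop := ∀ i, N ≤ i → σ i = false

lemma ZeroFrom.mono {m n : ℕ} (h : m ≤ n) {σ : ℕ → Bool} (hσ : ZeroFrom m σ) : ZeroFrom n σ :=
  fun i hi => hσ i (h.trans hi)

lemma zeroFrom_zeroExtend {N : ℕ} (x : Bits N) : ZeroFrom N (zeroExtend x) :=
  fun _ => zeroExtend_of_le x

lemma zeroFrom_update {N j : ℕ} (hj : j < N) {σ : ℕ → Bool} (h : ZeroFrom N σ) (b : Bool) :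
    ZeroFrom N (Function.update σ j b) := fun i hi => by
  rw [Function.update_of_ne (by omega), h i hi]

lemma zeroExtend_truncate {N : ℕ} {σ : ℕ → Bool} (h : ZeroFrom N σ) :
    zeroExtend (truncate N σ) = σ := by
  funext i
  by_cases hi : i < N
  · rw [zeroExtend_of_lt _ hi, truncate]
  · rw [zeroExtend_of_le _ (not_lt.1 hi), h i (not_lt.1 hi)]

lemma truncate_zeroExtend {N : ℕ} (x : Bits N) : truncate N (zeroExtend x) = x :=
  funext (zeroExtend_val x)

lemma zeroExtend_append_left {m n : ℕ} (u : Bits m) (v : Bits n) {i : ℕ} (h : i < m) :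
    zeroExtend (Fin.append u v) i = zeroExtend u i := by
  rw [zeroExtend_of_lt _ (by omega : i < m + n), zeroExtend_of_lt _ h]
  exact Fin.append_left u v ⟨i, h⟩

lemma zeroExtend_append_right {m n : ℕ} (u : Bits m) (v : Bits n) (i : ℕ) :
    zeroExtend (Fin.append u v) (m + i) = zeroExtend v i := by
  by_cases h : i < n
  · rw [zeroExtend_of_lt _ (by omega : m + i < m + n), zeroExtend_of_lt _ h]
    exact Fin.append_right u v ⟨i, h⟩
  · rw [zeroExtend_of_le _ (by omega), zeroExtend_of_le _ (by omega)]

lemma truncate_zeroExtend_append {m n : ℕ} (u : Bits m) (v : Bits n) :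
    truncate m (zeroExtend (Fin.append u v)) = u := by
  funext i
  rw [truncate, zeroExtend_append_left _ _ i.2, zeroExtend_val]

lemma zeroFrom_zeroExtend_append {m n : ℕ} (u : Bits m) (v : Bits n) :
    ZeroFrom m (zeroExtend (Fin.append u v)) ↔ v = fun _ => false := by
  constructor
  · intro h
    funext i
    rw [← zeroExtend_val v, ← zeroExtend_append_right u v]
    exact h _ (Nat.le_add_right _ _)
  · rintro rfl i hi
    obtain ⟨r, rfl⟩ := Nat.exists_eq_add_of_le hi
    rw [zeroExtend_append_right, zeroExtend]
    exact dite_eq_right_iff.2 fun _ => rfl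

lemma zeroFrom_zeroExtend_append_add {p K q : ℕ} (u : Bits p) (v : Bits K) :
    ZeroFrom (p + q) (zeroExtend (Fin.append u v)) ↔ ZeroFrom q (zeroExtend v) := by
  constructor
  · intro h i hi
    rw [← zeroExtend_append_right u v]
    exact h _ (by omega)
  · intro h i hi
    obtain ⟨r, rfl⟩ := Nat.exists_eq_add_of_le hi
    rw [add_assoc, zeroExtend_append_right]
    exact h _ (Nat.le_add_right _ _)

lemma truncate_add_zeroExtend_append {p K q : ℕ} (u : Bits p) (v : Bits K) :
    truncate (p + q) (zeroExtend (Fin.append u v)) =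
      Fin.append u (truncate q (zeroExtend v)) := by
  funext i
  refine Fin.addCases (fun i => ?_) (fun i => ?_) i
  · rw [Fin.append_left, truncate, Fin.val_castAdd, zeroExtend_append_left _ _ i.2, zeroExtend_val]
  · rw [Fin.append_right, truncate, Fin.val_natAdd, zeroExtend_append_right, truncate]

/-! ### Tensor products -/

lemma sum_bits_append {α : Type*} [AddCommMonoid α] {m n : ℕ} (f : Bits (m + n) → α) :
    ∑ x, f x = ∑ u : Bits m, ∑ v : Bits n, f (Fin.append u v) := by
  rw [← Fintype.sum_prod_type' (f := fun u v => f (Fin.append u v))]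
  exact ((Fin.appendEquiv m n).sum_comp f).symm

lemma append_inj_iff {m n : ℕ} (u u' : Bits m) (v v' : Bits n) :
    Fin.append u v = Fin.append u' v' ↔ u = u' ∧ v = v' :=
  ((Fin.appendEquiv m n).injective.eq_iff (a := (u, v)) (b := (u', v'))).trans Prod.mk_inj

lemma tensor_append {m n : ℕ} (ρ : Op m) (σ : Op n) (u u' : Bits m) (v v' : Bits n) :
    tensor ρ σ (Fin.append u v) (Fin.append u' v') = ρ u u' * σ v v' := by
  simp [tensor]

lemma exists_eq_append {m n : ℕ} (x : Bits (m + n)) :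
    ∃ (u : Bits m) (v : Bits n), x = Fin.append u v :=
  ⟨_, _, (Fin.append_castAdd_natAdd (f := x)).symm⟩

lemma op_ext_append {m n : ℕ} {A B : Op (m + n)}
    (h : ∀ u v u' v', A (Fin.append u v) (Fin.append u' v') =
      B (Fin.append u v) (Fin.append u' v')) : A = B := by
  ext x y
  obtain ⟨u, v, rfl⟩ := exists_eq_append x
  obtain ⟨u', v', rfl⟩ := exists_eq_append y
  exact h _ _ _ _

lemma tensor_mul_tensor {m n : ℕ} (A C : Op m) (B D : Op n) :
    tensor A B * tensor C D = tensor (A * C) (B * D) := by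
  refine op_ext_append fun u v u' v' => ?_
  rw [Matrix.mul_apply, sum_bits_append, tensor_append, Matrix.mul_apply, Matrix.mul_apply,
    Finset.sum_mul_sum]
  refine Finset.sum_congr rfl fun _ _ => Finset.sum_congr rfl fun _ _ => ?_
  rw [tensor_append, tensor_append]
  exact mul_mul_mul_comm _ _ _ _

lemma conjTranspose_tensor {m n : ℕ} (A : Op m) (B : Op n) : (tensor A B)ᴴ = tensor Aᴴ Bᴴ := by
  ext x y
  simp [tensor]

lemma tensor_one_one (m n : ℕ) : tensor (1 : Op m) (1 : Op n) = 1 := by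
  refine op_ext_append fun u v u' v' => ?_
  simp only [tensor_append, Matrix.one_apply, append_inj_iff, ite_and, ite_mul, one_mul, zero_mul]

lemma trace_tensor {m n : ℕ} (A : Op m) (B : Op n) :
    (tensor A B).trace = A.trace * B.trace := by
  simp only [Matrix.trace, sum_bits_append, Matrix.diag_apply, tensor_append, Finset.sum_mul_sum]

lemma posSemidef_tensor {m n : ℕ} {A : Op m} {B : Op n} (hA : A.PosSemidef) (hB : B.PosSemidef) :
    (tensor A B).PosSemidef :=
  (hA.kronecker hB).submatrix (Fin.appendEquiv m n).symm

/-! ### Permutation matrices -/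

/-- The operator that maps the basis state `y` to the basis state `f y`. Since `f` is any map, it
also covers the action of a circuit that is not yet known to be reversible. -/
def permMat {N : ℕ} (f : Bits N → Bits N) : Op N := Matrix.of fun x y => if x = f y then 1 else 0

lemma permMat_id (N : ℕ) : permMat (id : Bits N → Bits N) = 1 := by
  ext x y
  simp [permMat, Matrix.one_apply]

lemma permMat_mul {N : ℕ} (f g : Bits N → Bits N) : permMat f * permMat g = permMat (f ∘ g) := by
  ext x y
  simp [permMat, Matrix.mul_apply]

lemma permMat_mul_self {N : ℕ} {f : Bits N → Bits N} (h : Function.Involutive f) :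
    permMat f * permMat f = 1 := by
  rw [permMat_mul, h.comp_self, permMat_id]

lemma conjTranspose_permMat {N : ℕ} {f : Bits N → Bits N} (h : Function.Involutive f) :
    (permMat f)ᴴ = permMat f := by
  ext x y
  simp only [permMat, Matrix.conjTranspose_apply, Matrix.of_apply, apply_ite star, star_one,
    star_zero, ← h.eq_iff (x := x), eq_comm (a := y)]

lemma permMat_mem_unitaryGroup {N : ℕ} {f : Bits N → Bits N} (h : Function.Involutive f) :
    permMat f ∈ Matrix.unitaryGroup (Bits N) ℂ := by
  rw [Matrix.mem_unitaryGroup_iff, Matrix.star_eq_conjTranspose, conjTranspose_permMat h,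
    permMat_mul_self h]

lemma injective_of_permMat_mem_unitaryGroup {N : ℕ} {f : Bits N → Bits N}
    (h : permMat f ∈ Matrix.unitaryGroup (Bits N) ℂ) : Function.Injective f := fun x y hxy => by
  by_contra hne
  have hentry : ((permMat f)ᴴ * permMat f) x y = 0 := by
    rw [← Matrix.star_eq_conjTranspose, Matrix.mem_unitaryGroup_iff'.1 h, Matrix.one_apply_ne hne]
  simp [permMat, Matrix.mul_apply, hxy] at hentry

lemma permMat_mulVec {N : ℕ} {f : Bits N → Bits N} (h : Function.Involutive f) (ψ : Bits N → ℂ)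
    (x : Bits N) : (permMat f *ᵥ ψ) x = ψ (f x) := by
  simp [permMat, Matrix.mulVec, dotProduct, ← h.eq_iff]

lemma permMat_conj_apply {N : ℕ} {f : Bits N → Bits N} (h : Function.Involutive f) (ρ : Op N)
    (x y : Bits N) : (permMat f * ρ * (permMat f)ᴴ) x y = ρ (f x) (f y) := by
  rw [conjTranspose_permMat h]
  simp only [permMat, Matrix.mul_apply, Matrix.of_apply, ← h.eq_iff (x := x), ite_mul, one_mul,
    zero_mul, Finset.sum_ite_eq, Finset.mem_univ, if_true, mul_ite, mul_one, mul_zero,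
    Finset.sum_ite_eq']

lemma prob_permMat_conj {N : ℕ} {f : Bits N → Bits N} (hf : Function.Injective f)
    (S : Bits N → Prop) (ρ : Op N) :
    prob S (permMat f * ρ * (permMat f)ᴴ) = prob (fun x => S (f x)) ρ := by
  have diagonal_entry (y : Bits N) : (permMat f * ρ * (permMat f)ᴴ) (f y) (f y) = ρ y y := by
    simp [permMat, Matrix.mul_apply, hf.eq_iff, apply_ite]
  rw [prob, prob, ← (Equiv.ofBijective f (Finite.injective_iff_bijective.1 hf)).sum_comp]
  exact Finset.sum_congr rfl fun y _ => by rw [Equiv.ofBijective_apply, diagonal_entry]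

/-! ### Placing an operator on selected qubits -/

/-- The wires `w` are distinct qubits below `N`. -/
def Valid (N : ℕ) {k : ℕ} (w : Fin k → ℕ) : Prop := Function.Injective w ∧ ∀ j, w j < N

/-- The wires, as elements of `Fin N`. -/
def Valid.fin {N k : ℕ} {w : Fin k → ℕ} (h : Valid N w) : Fin k → Fin N := fun j => ⟨w j, h.2 j⟩

lemma Valid.fin_injective {N k : ℕ} {w : Fin k → ℕ} (h : Valid N w) :
    Function.Injective h.fin := fun _ _ heq => h.1 (congrArg Fin.val heq)

lemma valid_singleton {N i : ℕ} (hi : i < N) : Valid N ![i] :=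
  ⟨Function.injective_of_subsingleton _, fun j => by fin_cases j; exact hi⟩

lemma valid_pair {N i j : ℕ} (hi : i < N) (hj : j < N) (hij : i ≠ j) : Valid N ![i, j] := by
  refine ⟨fun a b => ?_, fun a => ?_⟩
  · fin_cases a <;> fin_cases b <;> simp [hij, hij.symm]
  · fin_cases a <;> simp [hi, hj]

lemma valid_triple {N i j k : ℕ} (hi : i < N) (hj : j < N) (hk : k < N) (hij : i ≠ j)
    (hik : i ≠ k) (hjk : j ≠ k) : Valid N ![i, j, k] := by
  refine ⟨fun a b => ?_, fun a => ?_⟩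
  · fin_cases a <;> fin_cases b <;> simp [hij, hij.symm, hik, hik.symm, hjk, hjk.symm]
  · fin_cases a <;> simp [hi, hj, hk]

lemma place_of_not_valid {N k : ℕ} {w : Fin k → ℕ} (h : ¬ Valid N w) (G : Op k) :
    place N w G = 1 := dif_neg h

open Classical in
lemma place_of_valid {N k : ℕ} {w : Fin k → ℕ} (h : Valid N w) (G : Op k) (x y : Bits N) :
    place N w G x y =
      if ∀ i : Fin N, (∀ j, w j ≠ i) → x i = y i then G (x ∘ h.fin) (y ∘ h.fin) else 0 := by
  rw [place, dif_pos (show Function.Injective w ∧ ∀ j, w j < N from h)]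
  rfl

/-- The splitting of a bit string into the bits at the positions `w` and the others. -/
def splitEquiv {N k : ℕ} {w : Fin k → Fin N} (hw : Function.Injective w) :
    Bits N ≃ Bits k × ({i : Fin N // ¬ i ∈ Set.range w} → Bool) :=
  (Equiv.piEquivPiSubtypeProd (fun i => i ∈ Set.range w) fun _ => Bool).trans
    (Equiv.prodCongr ((Equiv.ofInjective w hw).arrowCongr (Equiv.refl Bool)).symm (Equiv.refl _))

lemma splitEquiv_fst {N k : ℕ} {w : Fin k → Fin N} (hw : Function.Injective w) (x : Bits N) :
    (splitEquiv hw x).1 = x ∘ w := by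
  funext j
  simp [splitEquiv, Equiv.arrowCongr]

lemma splitEquiv_snd_eq_iff {N k : ℕ} {w : Fin k → ℕ} (h : Valid N w) (x y : Bits N) :
    (splitEquiv h.fin_injective x).2 = (splitEquiv h.fin_injective y).2 ↔
      ∀ i : Fin N, (∀ j, w j ≠ i) → x i = y i := by
  constructor
  · intro hxy i hi
    exact congrFun hxy ⟨i, by rintro ⟨j, rfl⟩; exact hi j rfl⟩
  · intro hxy
    exact funext fun i => hxy i fun j hj => i.2 ⟨j, Fin.ext hj⟩

open scoped Kronecker in
lemma place_eq_kronecker {N k : ℕ} {w : Fin k → ℕ} (h : Valid N w) (G : Op k) :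
    place N w G = (G ⊗ₖ (1 : Matrix _ _ ℂ)).submatrix (splitEquiv h.fin_injective)
      (splitEquiv h.fin_injective) := by
  ext x y
  simp only [place_of_valid h, ← splitEquiv_snd_eq_iff h, Matrix.submatrix_apply,
    Matrix.kroneckerMap_apply, splitEquiv_fst, Matrix.one_apply, mul_ite, mul_one, mul_zero]

lemma place_mul (N : ℕ) {k : ℕ} (w : Fin k → ℕ) (G G' : Op k) :
    place N w (G * G') = place N w G * place N w G' := by
  by_cases h : Valid N w
  · rw [place_eq_kronecker h, place_eq_kronecker h, place_eq_kronecker h,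
      Matrix.submatrix_mul_equiv, ← Matrix.mul_kronecker_mul, one_mul]
  · simp [place_of_not_valid h]

lemma place_one (N : ℕ) {k : ℕ} (w : Fin k → ℕ) : place N w (1 : Op k) = 1 := by
  by_cases h : Valid N w
  · rw [place_eq_kronecker h, Matrix.one_kronecker_one, Matrix.submatrix_one_equiv]
  · exact place_of_not_valid h _

lemma conjTranspose_place (N : ℕ) {k : ℕ} (w : Fin k → ℕ) (G : Op k) :
    (place N w G)ᴴ = place N w Gᴴ := by
  by_cases h : Valid N w
  · rw [place_eq_kronecker h, place_eq_kronecker h, Matrix.conjTranspose_submatrix,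
      Matrix.conjTranspose_kronecker, Matrix.conjTranspose_one]
  · simp [place_of_not_valid h]

lemma place_mem_unitaryGroup (N : ℕ) {k : ℕ} (w : Fin k → ℕ) {G : Op k}
    (h : G ∈ Matrix.unitaryGroup (Bits k) ℂ) : place N w G ∈ Matrix.unitaryGroup (Bits N) ℂ := by
  rw [Matrix.mem_unitaryGroup_iff, Matrix.star_eq_conjTranspose, conjTranspose_place, ← place_mul,
    ← Matrix.star_eq_conjTranspose, Matrix.mem_unitaryGroup_iff.1 h, place_one]

lemma append_agree_off_iff {N M k : ℕ} {w : Fin k → ℕ} (h : ∀ j, w j < N) (u u' : Bits N)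
    (v v' : Bits M) :
    (∀ i : Fin (N + M), (∀ j, w j ≠ i) → Fin.append u v i = Fin.append u' v' i) ↔
      (∀ i : Fin N, (∀ j, w j ≠ i) → u i = u' i) ∧ v = v' := by
  have natAdd_ne (i : Fin M) (j : Fin k) : w j ≠ Fin.natAdd N i :=
    ((h j).trans_le (Nat.le_add_right _ _)).ne
  simp only [Fin.forall_fin_add, Fin.append_left, Fin.append_right, Fin.val_castAdd, natAdd_ne,
    ne_eq, not_false_eq_true, implies_true, true_imp_iff, funext_iff]

lemma place_tensor_one {N M k : ℕ} {w : Fin k → ℕ} (h : ∀ j, w j < N) (G : Op k) :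
    place (N + M) w G = tensor (place N w G) 1 := by
  by_cases hw : Function.Injective w
  · have hN : Valid N w := ⟨hw, h⟩
    have hNM : Valid (N + M) w := ⟨hw, fun j => (h j).trans_le (Nat.le_add_right _ _)⟩
    have append_comp (u : Bits N) (v : Bits M) : Fin.append u v ∘ hNM.fin = u ∘ hN.fin :=
      funext fun j => Fin.append_left u v (hN.fin j)
    refine op_ext_append fun u v u' v' => ?_
    simp only [tensor_append, place_of_valid hN, place_of_valid hNM, Matrix.one_apply,
      append_agree_off_iff h, append_comp, ite_and, mul_ite, mul_one, mul_zero]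
    split_ifs <;> rfl
  · rw [place_of_not_valid fun hv => hw hv.1, place_of_not_valid fun hv => hw hv.1, tensor_one_one]

lemma place_permMat {N k : ℕ} {w : Fin k → ℕ} (h : Valid N w) {f : Bits k → Bits k}
    {g : Bits N → Bits N} (g_fin : ∀ y, g y ∘ h.fin = f (y ∘ h.fin))
    (g_off : ∀ y (i : Fin N), (∀ j, w j ≠ i) → g y i = y i) :
    place N w (permMat f) = permMat g := by
  ext x y
  have eq_g_iff : x = g y ↔
      (∀ i : Fin N, (∀ j, w j ≠ i) → x i = y i) ∧ x ∘ h.fin = f (y ∘ h.fin) := by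
    constructor
    · rintro rfl
      exact ⟨g_off y, g_fin y⟩
    · rintro ⟨h_off, h_fin⟩
      funext i
      by_cases hi : ∀ j, w j ≠ i
      · rw [h_off i hi, g_off y i hi]
      · push Not at hi
        obtain ⟨j, hj⟩ := hi
        obtain rfl : h.fin j = i := Fin.ext hj
        exact congrFun (h_fin.trans (g_fin y).symm) j
  simp only [place_of_valid h, permMat, Matrix.of_apply, eq_g_iff, ite_and]

/-! ### Unitarity and inverses of circuits -/

lemma sum_bits_one {α : Type*} [AddCommMonoid α] (f : Bits 1 → α) :
    ∑ x, f x = f (fun _ => true) + f (fun _ => false) := by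
  rw [← (Equiv.funUnique (Fin 1) Bool).symm.sum_comp, Fintype.sum_bool]
  rfl

lemma op_one_ext {A B : Op 1}
    (h : ∀ a b, A (fun _ => a) (fun _ => b) = B (fun _ => a) (fun _ => b)) : A = B := by
  have eq_const (x : Bits 1) : x = fun _ => x 0 :=
    funext fun i => congrArg x (Subsingleton.elim i 0)
  ext x y
  rw [eq_const x, eq_const y]
  exact h _ _

lemma const_bool_eq_iff (a b : Bool) : ((fun _ => a : Bits 1) = fun _ => b) ↔ a = b :=
  Function.const_inj

lemma inv_sqrt_two_mul_self :
    (1 / (Real.sqrt 2 : ℂ)) * (1 / (Real.sqrt 2 : ℂ)) = 1 / 2 := by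
  rw [div_mul_div_comm, ← Complex.ofReal_mul, Real.mul_self_sqrt (by norm_num)]
  norm_num

lemma hGate_apply (a b : Bool) : hGate (fun _ => a) (fun _ => b) =
    if a = true ∧ b = true then -(1 / (Real.sqrt 2 : ℂ)) else 1 / (Real.sqrt 2 : ℂ) := rfl

lemma hGate_mul_self : hGate * hGate = 1 := by
  refine op_one_ext fun a b => ?_
  rw [Matrix.mul_apply, sum_bits_one, Matrix.one_apply]
  simp only [hGate_apply, const_bool_eq_iff]
  cases a <;> cases b <;> simp only [inv_sqrt_two_mul_self, neg_mul, mul_neg, reduceCtorEq,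
    and_self, and_true, and_false, if_true, if_false] <;> norm_num

lemma conjTranspose_hGate : hGateᴴ = hGate := by
  refine op_one_ext fun a b => ?_
  rw [Matrix.conjTranspose_apply, hGate_apply, hGate_apply]
  cases a <;> cases b <;> simp

lemma exp_pi_div_four_pow_four : Complex.exp (Complex.I * (Real.pi / 4)) ^ 4 = -1 := by
  rw [← Complex.exp_nat_mul, ← Complex.exp_pi_mul_I]
  congr 1
  push_cast
  ring

lemma tGate_pow_four : tGate ^ 4 = Matrix.diagonal fun x => if x 0 = true then -1 else 1 := by
  rw [tGate, Matrix.diagonal_pow]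
  congr 1
  funext x
  rw [Pi.pow_apply, ite_pow, exp_pi_div_four_pow_four, one_pow]

lemma tGate_pow_eight : tGate ^ 8 = 1 := by
  rw [show 8 = 4 * 2 from rfl, pow_mul, tGate_pow_four, Matrix.diagonal_pow, ← Matrix.diagonal_one]
  congr 1
  funext x
  simp [ite_pow]

lemma conjTranspose_tGate_mul_self : tGateᴴ * tGate = 1 := by
  have conj_exp_mul_exp : star (Complex.exp (Complex.I * (Real.pi / 4))) *
      Complex.exp (Complex.I * (Real.pi / 4)) = 1 := by
    rw [← starRingEnd_apply, ← Complex.exp_conj, ← Complex.exp_add, map_mul, map_div₀,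
      Complex.conj_I, Complex.conj_ofReal, Complex.conj_ofNat, neg_mul, neg_add_cancel,
      Complex.exp_zero]
  rw [tGate, Matrix.diagonal_conjTranspose, Matrix.diagonal_mul_diagonal, ← Matrix.diagonal_one]
  congr 1
  funext x
  rw [Pi.star_apply]
  split_ifs
  · exact conj_exp_mul_exp
  · rw [star_one, one_mul]

/-- The action of CNOT on basis states. -/
def cnotFun (y : Bits 2) : Bits 2 := ![y 0, xor (y 0) (y 1)]

/-- The action of the Toffoli gate on basis states. -/
def toffoliFun (y : Bits 3) : Bits 3 := ![y 0, y 1, xor (y 0 && y 1) (y 2)]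

lemma cnot_eq : cnot = permMat cnotFun := rfl

lemma toffoli_eq : toffoli = permMat toffoliFun := rfl

lemma cnotFun_involutive : Function.Involutive cnotFun := fun y => by
  funext i
  fin_cases i <;> simp [cnotFun]

lemma toffoliFun_involutive : Function.Involutive toffoliFun := fun y => by
  funext i
  fin_cases i <;> simp [toffoliFun]

lemma gatesOp_singleton (N : ℕ) (g : Gate) : gatesOp N [g] = g.op N := one_mul _

lemma gatesOp_append (N : ℕ) (l l' : List Gate) :
    gatesOp N (l ++ l') = gatesOp N l' * gatesOp N l := by
  induction l with
  | nil => rw [List.nil_append, gatesOp, mul_one]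
  | cons g l ih => rw [List.cons_append, gatesOp, ih, gatesOp, mul_assoc]

lemma Gate.op_mem_unitaryGroup (N : ℕ) (g : Gate) :
    g.op N ∈ Matrix.unitaryGroup (Bits N) ℂ := by
  cases g <;> refine place_mem_unitaryGroup _ _ ?_
  · rw [Matrix.mem_unitaryGroup_iff, Matrix.star_eq_conjTranspose, conjTranspose_hGate,
      hGate_mul_self]
  · exact Matrix.mem_unitaryGroup_iff'.2 conjTranspose_tGate_mul_self
  · exact permMat_mem_unitaryGroup cnotFun_involutive
  · exact permMat_mem_unitaryGroup toffoliFun_involutive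

lemma gatesOp_mem_unitaryGroup (N : ℕ) (l : List Gate) :
    gatesOp N l ∈ Matrix.unitaryGroup (Bits N) ℂ := by
  induction l with
  | nil => exact one_mem _
  | cons g l ih => exact mul_mem ih (g.op_mem_unitaryGroup N)

/-- Gates that undo a gate. -/
def Gate.inv : Gate → List Gate
  | .t i => List.replicate 7 (.t i)
  | g => [g]

/-- Gates that undo a circuit. -/
def invGates : List Gate → List Gate
  | [] => []
  | g :: l => invGates l ++ g.inv

lemma gatesOp_replicate_t (N n i : ℕ) :
    gatesOp N (List.replicate n (.t i)) = place N ![i] (tGate ^ n) := by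
  induction n with
  | zero => rw [List.replicate_zero, gatesOp, pow_zero, place_one]
  | succ n ih => rw [List.replicate_succ, gatesOp, ih, Gate.op, ← place_mul, ← pow_succ]

lemma gatesOp_inv_mul_op (N : ℕ) (g : Gate) : gatesOp N g.inv * g.op N = 1 := by
  cases g with
  | h i =>
    change gatesOp N [.h i] * _ = 1
    rw [gatesOp_singleton, Gate.op, ← place_mul, hGate_mul_self, place_one]
  | t i =>
    rw [Gate.inv, gatesOp_replicate_t, Gate.op, ← place_mul, ← pow_succ, tGate_pow_eight, place_one]
  | cx i j =>
    change gatesOp N [.cx i j] * _ = 1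
    rw [gatesOp_singleton, Gate.op, ← place_mul, cnot_eq,
      permMat_mul_self cnotFun_involutive, place_one]
  | ccx i j k =>
    change gatesOp N [.ccx i j k] * _ = 1
    rw [gatesOp_singleton, Gate.op, ← place_mul, toffoli_eq,
      permMat_mul_self toffoliFun_involutive, place_one]

lemma gatesOp_invGates_mul (N : ℕ) (l : List Gate) : gatesOp N (invGates l) * gatesOp N l = 1 := by
  induction l with
  | nil => rw [invGates, gatesOp, one_mul]
  | cons g l ih =>
    rw [invGates, gatesOp_append, gatesOp, mul_assoc, ← mul_assoc _ _ (g.op N), ih, one_mul,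
      gatesOp_inv_mul_op]

lemma gatesOp_invGates (N : ℕ) (l : List Gate) : gatesOp N (invGates l) = (gatesOp N l)ᴴ :=
  left_inv_eq_right_inv (gatesOp_invGates_mul N l)
    (Matrix.mem_unitaryGroup_iff.1 (gatesOp_mem_unitaryGroup N l))

lemma length_invGates_le (l : List Gate) : (invGates l).length ≤ 7 * l.length := by
  induction l with
  | nil => exact le_rfl
  | cons g l ih =>
    have length_inv_le : g.inv.length ≤ 7 := by cases g <;> simp [Gate.inv]
    rw [invGates, List.length_append, List.length_cons]
    omega

/-- All the wires of the gate are smaller than `N`. -/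
def Gate.Below (N : ℕ) : Gate → Prop
  | .h i => i < N
  | .t i => i < N
  | .cx i j => i < N ∧ j < N
  | .ccx i j k => i < N ∧ j < N ∧ k < N

lemma Gate.Below.mono {N N' : ℕ} (h : N ≤ N') {g : Gate} (hg : g.Below N) : g.Below N' := by
  cases g <;> simp only [Gate.Below] at * <;> omega

lemma Gate.eq_of_mem_inv {g g' : Gate} (h : g' ∈ g.inv) : g' = g := by
  cases g with
  | t i => exact List.eq_of_mem_replicate h
  | _ => exact List.mem_singleton.1 h

lemma below_invGates {N : ℕ} {l : List Gate} (h : ∀ g ∈ l, g.Below N) :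
    ∀ g ∈ invGates l, g.Below N := by
  induction l with
  | nil => simp [invGates]
  | cons g l ih =>
    rw [List.forall_mem_cons] at h
    intro g' hg'
    rcases List.mem_append.1 hg' with hg' | hg'
    · exact ih h.2 g' hg'
    · exact Gate.eq_of_mem_inv hg' ▸ h.1

lemma Gate.op_add {N : ℕ} (M : ℕ) {g : Gate} (h : g.Below N) :
    g.op (N + M) = tensor (g.op N) 1 := by
  cases g <;> refine place_tensor_one (fun j => ?_) _ <;> simp only [Gate.Below] at h <;>
    fin_cases j <;> simp [h]

lemma gatesOp_add {N : ℕ} (M : ℕ) {l : List Gate} (h : ∀ g ∈ l, g.Below N) :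
    gatesOp (N + M) l = tensor (gatesOp N l) 1 := by
  induction l with
  | nil => rw [gatesOp, gatesOp, tensor_one_one]
  | cons g l ih =>
    rw [List.forall_mem_cons] at h
    rw [gatesOp, gatesOp, ih h.2, g.op_add M h.1, tensor_mul_tensor, one_mul]

lemma Gate.op_of_not_below {N : ℕ} {g : Gate} (h : ¬ g.Below N) : g.op N = 1 := by
  cases g <;> refine place_of_not_valid (fun hv => h ?_) _
  · exact hv.2 0
  · exact hv.2 0
  · exact ⟨hv.2 0, hv.2 1⟩
  · exact ⟨hv.2 0, hv.2 1, hv.2 2⟩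

open Classical in
/-- The gates all of whose wires are smaller than `N`; the others have no effect on `N` qubits,
but would act on the additional qubits of a larger circuit. -/
def filterBelow (N : ℕ) (l : List Gate) : List Gate := l.filter fun g => g.Below N

lemma below_filterBelow {N : ℕ} {l : List Gate} : ∀ g ∈ filterBelow N l, g.Below N :=
  fun _ hg => by simpa using (List.mem_filter.1 hg).2

lemma gatesOp_filterBelow (N : ℕ) (l : List Gate) : gatesOp N (filterBelow N l) = gatesOp N l := by
  induction l with
  | nil => rfl
  | cons g l ih =>
    rw [filterBelow] at ih ⊢
    by_cases h : g.Below N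
    · rw [List.filter_cons_of_pos (by simpa using h), gatesOp, ih, gatesOp]
    · rw [List.filter_cons_of_neg (by simpa using h), ih, gatesOp, g.op_of_not_below h, mul_one]

/-! ### Classical reversible circuits -/

/-- On basis states the circuit acts as the map `F` (written on sequences of bits). -/
structure Computes (N : ℕ) (l : List Gate) (F : (ℕ → Bool) → ℕ → Bool) : Prop where
  zeroFrom : ∀ σ, ZeroFrom N σ → ZeroFrom N (F σ)
  gatesOp_eq : gatesOp N l = permMat fun y => truncate N (F (zeroExtend y))

lemma computes_id {N : ℕ} {l : List Gate} (h : gatesOp N l = 1) : Computes N l id :=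
  ⟨fun _ hσ => hσ, by simp only [h, id, truncate_zeroExtend, ← permMat_id]; rfl⟩

lemma Computes.append {N : ℕ} {l l' : List Gate} {F F' : (ℕ → Bool) → ℕ → Bool}
    (h : Computes N l F) (h' : Computes N l' F') : Computes N (l ++ l') (F' ∘ F) := by
  refine ⟨fun σ hσ => h'.1 _ (h.1 _ hσ), ?_⟩
  rw [gatesOp_append, h.2, h'.2, permMat_mul]
  congr 1
  funext y
  simp only [Function.comp, zeroExtend_truncate (h.1 _ (zeroFrom_zeroExtend y))]

lemma Computes.congr {N : ℕ} {l : List Gate} {F F' : (ℕ → Bool) → ℕ → Bool}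
    (h : Computes N l F) (hF : ∀ σ, F σ = F' σ) : Computes N l F' :=
  (funext hF : F = F') ▸ h

lemma computes_update_of_gatesOp_eq_place {N k : ℕ} {w : Fin k → ℕ} (hw : Valid N w)
    {f : Bits k → Bits k} {t : Fin k} (hf : ∀ y j, j ≠ t → f y j = y j) {l : List Gate}
    (hl : gatesOp N l = place N w (permMat f)) :
    Computes N l fun σ => Function.update σ (w t) (f (fun j => σ (w j)) t) := by
  refine ⟨fun σ h => zeroFrom_update (hw.2 t) h _, hl.trans (place_permMat hw ?_ ?_)⟩
  · have read_wires (y : Bits N) : (fun j => zeroExtend y (w j)) = y ∘ hw.fin :=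
      funext fun j => zeroExtend_of_lt y (hw.2 j)
    intro y
    funext j
    rw [read_wires]
    by_cases hj : j = t
    · subst hj
      exact Function.update_self _ _ _
    · rw [hf _ j hj]
      exact (Function.update_of_ne (hw.1.ne hj) _ _).trans (zeroExtend_val y (hw.fin j))
  · intro y i hi
    exact (Function.update_of_ne (hi t).symm _ _).trans (zeroExtend_val y i)

lemma Computes.cx {N i j : ℕ} (hi : i < N) (hj : j < N) (hij : i ≠ j) :
    Computes N [.cx i j] fun σ => Function.update σ j (xor (σ i) (σ j)) :=
  computes_update_of_gatesOp_eq_place (f := cnotFun) (t := 1) (valid_pair hi hj hij)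
    (by intro y a ha; fin_cases a <;> simp_all [cnotFun]) (one_mul _)

lemma Computes.ccx {N i j k : ℕ} (hi : i < N) (hj : j < N) (hk : k < N) (hij : i ≠ j) (hik : i ≠ k)
    (hjk : j ≠ k) :
    Computes N [.ccx i j k] fun σ => Function.update σ k (xor (σ i && σ j) (σ k)) :=
  computes_update_of_gatesOp_eq_place (f := toffoliFun) (t := 2)
    (valid_triple hi hj hk hij hik hjk)
    (by intro y a ha; fin_cases a <;> simp_all [toffoliFun]) (one_mul _)

/-- Instructions that are ignored. -/
def nops (n : ℕ) : List Gate := List.replicate n (.cx 0 0)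

lemma Computes.nops (N n : ℕ) : Computes N (nops n) id := by
  refine computes_id ?_
  induction n with
  | zero => rfl
  | succ n ih =>
    rw [QObf.nops, List.replicate_succ, gatesOp, ← QObf.nops, ih, one_mul]
    exact place_of_not_valid (fun hv => zero_ne_one (@hv.1 0 1 rfl)) _

/-- The NOT gate, as a sequence of gates of the gate set. -/
def notGate (i : ℕ) : List Gate := .h i :: (List.replicate 4 (.t i) ++ [.h i])

lemma hGate_mul_tGate_pow_four_mul_hGate :
    hGate * (tGate ^ 4 * hGate) = permMat fun y _ => !(y 0) := by
  refine op_one_ext fun a b => ?_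
  rw [tGate_pow_four, Matrix.mul_apply, sum_bits_one]
  simp only [Matrix.diagonal_mul, hGate_apply, permMat, Matrix.of_apply, const_bool_eq_iff]
  cases a <;> cases b <;> simp only [inv_sqrt_two_mul_self, neg_mul, mul_neg, one_mul, reduceCtorEq,
    and_self, and_true, and_false, if_true, if_false, neg_neg, Bool.not_true, Bool.not_false] <;>
    norm_num

lemma Computes.notGate {N i : ℕ} (hi : i < N) :
    Computes N (notGate i) fun σ => Function.update σ i (!(σ i)) := by
  refine computes_update_of_gatesOp_eq_place (f := fun y _ => !(y 0)) (t := 0) (valid_singleton hi)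
    (fun _ j hj => absurd (Subsingleton.elim j 0) hj) ?_
  rw [QObf.notGate, gatesOp, gatesOp_append, gatesOp_replicate_t, gatesOp, gatesOp, one_mul,
    Gate.op, ← place_mul, ← place_mul, mul_assoc, hGate_mul_tGate_pow_four_mul_hGate]

/-- The sequence obtained from `σ` by adding, modulo two, the bit `c i` to the bit at position
`y + i`, for every `i < m`. -/
def xorRange (y m : ℕ) (c : ℕ → Bool) (σ : ℕ → Bool) (w : ℕ) : Bool :=
  if y ≤ w ∧ w < y + m then xor (c (w - y)) (σ w) else σ w

lemma xorRange_of_mem {y m : ℕ} {c σ : ℕ → Bool} {i : ℕ} (hi : i < m) :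
    xorRange y m c σ (y + i) = xor (c i) (σ (y + i)) := by
  rw [xorRange, if_pos (by omega), Nat.add_sub_cancel_left]

lemma xorRange_of_notMem {y m : ℕ} {c σ : ℕ → Bool} {w : ℕ} (hw : ¬ (y ≤ w ∧ w < y + m)) :
    xorRange y m c σ w = σ w := if_neg hw

lemma xorRange_zero (y : ℕ) (c σ : ℕ → Bool) : xorRange y 0 c σ = σ :=
  funext fun _ => xorRange_of_notMem (by omega)

lemma xorRange_succ (y m : ℕ) (c σ : ℕ → Bool) : xorRange y (m + 1) c σ =
    Function.update (xorRange y m c σ) (y + m) (xor (c m) (σ (y + m))) := by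
  funext w
  by_cases hw : w = y + m
  · subst hw
    rw [Function.update_self, xorRange_of_mem m.lt_succ_self]
  · rw [Function.update_of_ne hw, xorRange, xorRange]
    exact if_congr (by omega) rfl rfl

lemma xorRange_congr {y m : ℕ} {c c' : ℕ → Bool} (h : ∀ i < m, c i = c' i) (σ : ℕ → Bool) :
    xorRange y m c σ = xorRange y m c' σ := by
  funext w
  rw [xorRange, xorRange]
  split_ifs with hw
  · rw [h _ (by omega)]
  · rfl

lemma xorRange_update {y m t : ℕ} (ht : t < y ∨ y + m ≤ t) (c σ : ℕ → Bool) (v : Bool) :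
    xorRange y m c (Function.update σ t v) = Function.update (xorRange y m c σ) t v := by
  funext w
  rcases eq_or_ne w t with rfl | hw
  · rw [Function.update_self, xorRange_of_notMem (by omega), Function.update_self]
  · rw [Function.update_of_ne hw, xorRange, Function.update_of_ne hw, xorRange]

lemma xorRange_xorRange (y m : ℕ) (c c' σ : ℕ → Bool) :
    xorRange y m c (xorRange y m c' σ) = xorRange y m (fun i => xor (c i) (c' i)) σ := by
  funext w
  simp only [xorRange]
  split_ifs
  · rw [Bool.xor_assoc]
  · rfl

lemma xorRange_xorRange_self (y m : ℕ) (c σ : ℕ → Bool) :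
    xorRange y m c (xorRange y m c σ) = σ := by
  rw [xorRange_xorRange]
  funext w
  simp [xorRange]

lemma Computes.flatMap_range {N y : ℕ} {g : ℕ → List Gate} {c : (ℕ → Bool) → ℕ → Bool}
    (hc : ∀ i σ τ, (∀ w < y, σ w = τ w) → c σ i = c τ i) {m : ℕ}
    (hg : ∀ i < m, Computes N (g i) fun σ =>
      Function.update σ (y + i) (xor (c σ i) (σ (y + i)))) :
    Computes N ((List.range m).flatMap g) fun σ => xorRange y m (c σ) σ := by
  induction m with
  | zero => exact (computes_id rfl).congr fun σ => (xorRange_zero _ _ _).symm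
  | succ m ih =>
    rw [List.range_succ, List.flatMap_append, List.flatMap_singleton]
    refine ((ih fun i hi => hg i (by omega)).append (hg m m.lt_succ_self)).congr fun σ => ?_
    rw [Function.comp, xorRange_succ, xorRange_of_notMem (by omega),
      hc m _ σ fun w hw => xorRange_of_notMem (by omega)]

/-! ### Multiply controlled gates with borrowed qubits -/

/-- The conjunction of the bits `x, …, x + j`. -/
def allTrue (x : ℕ) (σ : ℕ → Bool) : ℕ → Bool
  | 0 => σ x
  | j + 1 => σ (x + (j + 1)) && allTrue x σ j

lemma allTrue_eq_true_iff {x : ℕ} {σ : ℕ → Bool} {j : ℕ} :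
    allTrue x σ j = true ↔ ∀ i < j + 1, σ (x + i) = true := by
  induction j with
  | zero => simp [allTrue]
  | succ j ih => rw [allTrue, Bool.and_eq_true, ih, Nat.forall_lt_succ_right (n := j + 1), and_comm]

lemma allTrue_congr {x : ℕ} {σ τ : ℕ → Bool} {j : ℕ} (h : ∀ i ≤ j, σ (x + i) = τ (x + i)) :
    allTrue x σ j = allTrue x τ j := by
  rw [Bool.eq_iff_iff, allTrue_eq_true_iff, allTrue_eq_true_iff]
  exact forall₂_congr fun i hi => by rw [h i (by omega)]

/-- Adds to each bit `d + i` with `i ≤ j` the conjunction of the bits `x, …, x + i`. -/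
def ladder (x d : ℕ) : ℕ → List Gate
  | 0 => [.cx x d]
  | j + 1 => [.ccx (x + (j + 1)) (d + j) (d + (j + 1))] ++ ladder x d j ++
      [.ccx (x + (j + 1)) (d + j) (d + (j + 1))]

lemma Computes.ladder {N x d j : ℕ} (hx : x + j < d) (hd : d + j < N) :
    Computes N (ladder x d j) fun σ => xorRange d (j + 1) (allTrue x σ) σ := by
  induction j with
  | zero =>
    refine (Computes.cx (by omega) (by omega) (by omega)).congr fun σ => ?_
    rw [xorRange_succ, xorRange_zero]
    rfl
  | succ j ih =>
    have top := Computes.ccx (N := N) (i := x + (j + 1)) (j := d + j) (k := d + (j + 1))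
      (by omega) (by omega) (by omega) (by omega) (by omega) (by omega)
    refine ((top.append (ih (by omega) (by omega))).append top).congr fun σ => ?_
    have allTrue_update (v : Bool) (i : ℕ) (hi : i < j + 1) :
        allTrue x (Function.update σ (d + (j + 1)) v) i = allTrue x σ i :=
      allTrue_congr fun l hl => Function.update_of_ne (by omega) _ _
    simp only [Function.comp]
    rw [xorRange_congr (allTrue_update _), xorRange_update (by omega), xorRange_succ d (j + 1),
      Function.update_idem, Function.update_self, Function.update_of_ne (by omega),
      Function.update_of_ne (by omega), xorRange_of_mem j.lt_succ_self,
      xorRange_of_notMem (by omega), allTrue]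
    cases σ (x + (j + 1)) <;> cases σ (d + j) <;> cases σ (d + (j + 1)) <;>
      cases allTrue x σ j <;> rfl

/-- Flips the bit `d + j + 1` if all the bits `x, …, x + j + 1` are set; the bits `d, …, d + j` are
borrowed. -/
def multiControl (x d j : ℕ) : List Gate := ladder x d (j + 1) ++ ladder x d j

lemma Computes.multiControl {N x d j : ℕ} (hx : x + (j + 1) < d) (hd : d + (j + 1) < N) :
    Computes N (multiControl x d j) fun σ =>
      Function.update σ (d + (j + 1)) (xor (allTrue x σ (j + 1)) (σ (d + (j + 1)))) := by
  refine ((Computes.ladder hx hd).append (Computes.ladder (by omega) (by omega))).congr fun σ => ?_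
  have allTrue_xorRange (i : ℕ) (hi : i < j + 1) :
      allTrue x (xorRange d (j + 1 + 1) (allTrue x σ) σ) i = allTrue x σ i :=
    allTrue_congr fun l hl => xorRange_of_notMem (by omega)
  rw [Function.comp, xorRange_congr allTrue_xorRange, xorRange_succ d (j + 1),
    xorRange_update (by omega), xorRange_xorRange_self]

lemma length_ladder (x d j : ℕ) : (ladder x d j).length = 2 * j + 1 := by
  induction j with
  | zero => rfl
  | succ j ih =>
    simp only [ladder, List.length_append, List.length_singleton, ih]
    omega

lemma length_multiControl (x d j : ℕ) : (multiControl x d j).length = 4 * j + 4 := by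
  rw [multiControl, List.length_append, length_ladder, length_ladder]
  omega

lemma below_ladder {N x d j : ℕ} (hx : x + j < N) (hd : d + j < N) :
    ∀ g ∈ ladder x d j, g.Below N := by
  induction j with
  | zero =>
    simp only [ladder, List.forall_mem_singleton, Gate.Below]
    omega
  | succ j ih =>
    simp only [ladder, List.forall_mem_append, List.forall_mem_singleton, Gate.Below]
    exact ⟨⟨by omega, ih (by omega) (by omega)⟩, by omega⟩

lemma below_multiControl {N x d j : ℕ} (hx : x + (j + 1) < N) (hd : d + (j + 1) < N) :
    ∀ g ∈ multiControl x d j, g.Below N :=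
  List.forall_mem_append.2 ⟨below_ladder hx hd, below_ladder (by omega) (by omega)⟩

/-- Flips the bits `x + i`, `i < m`, for which `a i` is set. The number of gates does not depend
on `a`. -/
def flips (x : ℕ) (a : ℕ → Bool) (m : ℕ) : List Gate :=
  (List.range m).flatMap fun i => if a i then notGate (x + i) else nops 6

lemma Computes.flips {N x : ℕ} (a : ℕ → Bool) {m : ℕ} (hx : x + m ≤ N) :
    Computes N (flips x a m) (xorRange x m a) := by
  refine Computes.flatMap_range (c := fun _ => a) (fun _ _ _ _ => rfl) fun i hi => ?_
  cases a i
  · refine (Computes.nops N 6).congr fun σ => ?_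
    rw [Bool.false_xor, Function.update_eq_self, id]
  · refine (Computes.notGate (by omega)).congr fun σ => ?_
    rw [Bool.true_xor]

/-- Adds the bit `z` to the bits `y + i`, `i < m`, for which `b i` is set. The number of gates does
not depend on `b`. -/
def fanout (z y : ℕ) (b : ℕ → Bool) (m : ℕ) : List Gate :=
  (List.range m).flatMap fun i => if b i then [.cx z (y + i)] else nops 1

lemma Computes.fanout {N z y : ℕ} (b : ℕ → Bool) {m : ℕ} (hz : z < y) (hy : y + m ≤ N) :
    Computes N (fanout z y b m) fun σ => xorRange y m (fun i => b i && σ z) σ := by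
  refine Computes.flatMap_range (c := fun σ i => b i && σ z)
    (fun i σ τ h => by rw [h z hz]) fun i hi => ?_
  cases b i
  · refine (Computes.nops N 1).congr fun σ => ?_
    rw [Bool.false_and, Bool.false_xor, Function.update_eq_self, id]
  · refine (Computes.cx (by omega) (by omega) (by omega)).congr fun σ => ?_
    rw [Bool.true_and]

lemma length_flips (x : ℕ) (a : ℕ → Bool) (m : ℕ) : (flips x a m).length = 6 * m := by
  have length_layer (i : ℕ) : (if a i then notGate (x + i) else nops 6).length = 6 := by
    split_ifs <;> rfl
  simp only [flips, List.length_flatMap, length_layer, List.map_const', List.sum_replicate,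
    List.length_range, smul_eq_mul, mul_comm]

lemma length_fanout (z y : ℕ) (b : ℕ → Bool) (m : ℕ) : (fanout z y b m).length = m := by
  have length_layer (i : ℕ) : (if b i then [Gate.cx z (y + i)] else nops 1).length = 1 := by
    split_ifs <;> rfl
  simp only [fanout, List.length_flatMap, length_layer, List.map_const', List.sum_replicate,
    List.length_range, smul_eq_mul, mul_one]

lemma below_nops {N : ℕ} (hN : 0 < N) (n : ℕ) : ∀ g ∈ nops n, g.Below N := fun g hg => by
  rw [List.eq_of_mem_replicate hg]
  exact ⟨hN, hN⟩

lemma below_notGate {N i : ℕ} (hi : i < N) : ∀ g ∈ notGate i, g.Below N := by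
  simp [notGate, Gate.Below, hi]

lemma below_flips {N x : ℕ} (a : ℕ → Bool) {m : ℕ} (hx : x + m ≤ N) :
    ∀ g ∈ flips x a m, g.Below N := by
  rw [flips, List.forall_mem_flatMap]
  intro i hi
  rw [List.mem_range] at hi
  split_ifs
  · exact below_notGate (by omega)
  · exact below_nops (by omega) 6

lemma below_fanout {N z y : ℕ} (b : ℕ → Bool) {m : ℕ} (hz : z < N) (hy : y + m ≤ N) :
    ∀ g ∈ fanout z y b m, g.Below N := by
  rw [fanout, List.forall_mem_flatMap]
  intro i hi
  rw [List.mem_range] at hi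
  split_ifs
  · exact List.forall_mem_singleton.2 ⟨hz, by omega⟩
  · exact below_nops (by omega) 1

/-! ### Comparison with a fixed string -/

/-- The `m` bits from position `x` on are those of `a`. -/
def Matches (x : ℕ) (a : ℕ → Bool) (m : ℕ) (σ : ℕ → Bool) : Prop := ∀ i < m, σ (x + i) = a i

lemma matches_congr {x m : ℕ} {a σ τ : ℕ → Bool} (h : ∀ i < m, σ (x + i) = τ (x + i)) :
    Matches x a m σ ↔ Matches x a m τ :=
  forall₂_congr fun i hi => by rw [h i hi]

lemma matches_update {x m t : ℕ} (ht : x + m ≤ t) (a σ : ℕ → Bool) (v : Bool) :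
    Matches x a m (Function.update σ t v) ↔ Matches x a m σ :=
  matches_congr fun _ _ => Function.update_of_ne (by omega) _ _

lemma matches_xorRange {x m y : ℕ} (hy : x + m ≤ y) (a : ℕ → Bool) (m' : ℕ) (c σ : ℕ → Bool) :
    Matches x a m (xorRange y m' c σ) ↔ Matches x a m σ :=
  matches_congr fun _ _ => xorRange_of_notMem (by omega)

lemma allTrue_xorRange_not_iff {x : ℕ} {a : ℕ → Bool} {j : ℕ} {σ : ℕ → Bool} :
    allTrue x (xorRange x (j + 1) (fun i => !(a i)) σ) j = true ↔ Matches x a (j + 1) σ := by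
  rw [allTrue_eq_true_iff]
  refine forall₂_congr fun i hi => ?_
  rw [xorRange_of_mem hi]
  cases a i <;> cases σ (x + i) <;> decide

/-- Flips the bit `d + j + 1` if the bits from position `x` on are those of `a`. -/
def matchFlip (x d : ℕ) (a : ℕ → Bool) (j : ℕ) : List Gate :=
  flips x (fun i => !(a i)) (j + 2) ++ multiControl x d j ++ flips x (fun i => !(a i)) (j + 2)

open Classical in
/-- The action of `matchFlip` on basis states. -/
def matchFlipFun (x d : ℕ) (a : ℕ → Bool) (j : ℕ) (σ : ℕ → Bool) : ℕ → Bool :=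
  Function.update σ (d + (j + 1)) (xor (decide (Matches x a (j + 2) σ)) (σ (d + (j + 1))))

lemma Computes.matchFlip {N x d j : ℕ} (a : ℕ → Bool) (hx : x + (j + 1) < d)
    (hd : d + (j + 1) < N) : Computes N (matchFlip x d a j) (matchFlipFun x d a j) := by
  classical
  have flip := Computes.flips (N := N) (x := x) (fun i => !(a i)) (m := j + 2) (by omega)
  refine ((flip.append (Computes.multiControl hx hd)).append flip).congr fun σ => ?_
  simp only [Function.comp]
  rw [xorRange_update (by omega), xorRange_xorRange_self, xorRange_of_notMem (by omega),
    matchFlipFun, Bool.eq_iff_iff.2 (allTrue_xorRange_not_iff.trans (decide_eq_true_iff).symm)]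

lemma length_matchFlip (x d : ℕ) (a : ℕ → Bool) (j : ℕ) :
    (matchFlip x d a j).length = 16 * j + 28 := by
  simp only [matchFlip, List.length_append, length_flips, length_multiControl]
  omega

lemma below_matchFlip {N x d j : ℕ} (a : ℕ → Bool) (hx : x + (j + 1) < N)
    (hd : d + (j + 1) < N) : ∀ g ∈ matchFlip x d a j, g.Below N := by
  simp only [matchFlip, List.forall_mem_append]
  exact ⟨⟨below_flips _ (by omega), below_multiControl hx hd⟩, below_flips _ (by omega)⟩

/-! ### The point function -/

/-- The gates of the circuit that adds the string `b` to the last of three registers of `j + 2`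
qubits if the content of the first is `a`; the second register is borrowed. -/
def pointGates (j : ℕ) (a b : ℕ → Bool) : List Gate :=
  fanout (j + 2 + (j + 1)) (2 * j + 4) b (j + 2) ++ matchFlip 0 (j + 2) a j ++
    (fanout (j + 2 + (j + 1)) (2 * j + 4) b (j + 2) ++ matchFlip 0 (j + 2) a j)

open Classical in
/-- The action of `pointGates` on basis states. -/
def pointFun (j : ℕ) (a b : ℕ → Bool) (σ : ℕ → Bool) : ℕ → Bool :=
  xorRange (2 * j + 4) (j + 2) (fun i => b i && decide (Matches 0 a (j + 2) σ)) σ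

lemma Computes.point (j : ℕ) (a b : ℕ → Bool) :
    Computes (3 * (j + 2)) (pointGates j a b) (pointFun j a b) := by
  classical
  have fan := Computes.fanout (N := 3 * (j + 2)) (z := j + 2 + (j + 1)) (y := 2 * j + 4) b
    (m := j + 2) (by omega) (by omega)
  have fan_flip := fan.append
    (Computes.matchFlip (x := 0) (d := j + 2) (j := j) a (by omega) (by omega))
  refine (fan_flip.append fan_flip).congr fun σ => ?_
  have telescope (c z : Bool) (i : ℕ) : xor (b i && xor c z) (b i && z) = (b i && c) := by
    cases b i <;> cases c <;> cases z <;> rfl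
  simp only [Function.comp, matchFlipFun]
  simp only [matches_update (by omega : 0 + (j + 2) ≤ j + 2 + (j + 1)),
    matches_xorRange (by omega : 0 + (j + 2) ≤ 2 * j + 4),
    xorRange_update
      (by omega : j + 2 + (j + 1) < 2 * j + 4 ∨ 2 * j + 4 + (j + 2) ≤ j + 2 + (j + 1)),
    Function.update_self, Function.update_idem, xorRange_xorRange, telescope,
    xorRange_of_notMem
      (by omega : ¬ (2 * j + 4 ≤ j + 2 + (j + 1) ∧ j + 2 + (j + 1) < 2 * j + 4 + (j + 2)))]
  rw [← Bool.xor_assoc, Bool.xor_self, Bool.false_xor]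
  exact Function.update_eq_iff.2 ⟨(xorRange_of_notMem (by omega)).symm, fun _ _ => rfl⟩

lemma length_pointGates (j : ℕ) (a b : ℕ → Bool) : (pointGates j a b).length = 34 * j + 60 := by
  simp only [pointGates, List.length_append, length_fanout, length_matchFlip]
  omega

lemma below_pointGates (j : ℕ) (a b : ℕ → Bool) :
    ∀ g ∈ pointGates j a b, g.Below (3 * (j + 2)) := by
  have fan : ∀ g ∈ fanout (j + 2 + (j + 1)) (2 * j + 4) b (j + 2), g.Below (3 * (j + 2)) :=
    below_fanout b (by omega) (by omega)
  have flip : ∀ g ∈ matchFlip 0 (j + 2) a j, g.Below (3 * (j + 2)) :=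
    below_matchFlip a (by omega) (by omega)
  simp only [pointGates, List.forall_mem_append]
  exact ⟨⟨fan, flip⟩, fan, flip⟩

/-! ### Operators close to the identity -/

section Nsq

variable {ι κ ρ : Type*} [Fintype ι] [Fintype κ] [Fintype ρ]

/-- The square of the Euclidean norm of a vector of amplitudes. -/
def nsq (ψ : ι → ℂ) : ℝ := ∑ x, ‖ψ x‖ ^ 2

lemma nsq_nonneg (ψ : ι → ℂ) : 0 ≤ nsq ψ :=
  Finset.sum_nonneg fun _ _ => sq_nonneg _

lemma nsq_zero : nsq (0 : ι → ℂ) = 0 := by simp [nsq]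

lemma nsq_sub_comm (φ ψ : ι → ℂ) : nsq (φ - ψ) = nsq (ψ - φ) := by
  simp only [nsq, Pi.sub_apply, norm_sub_rev]

lemma nsq_single [DecidableEq ι] (i : ι) : nsq (Pi.single i (1 : ℂ)) = 1 := by
  rw [nsq, Finset.sum_eq_single i (fun j _ hj => by simp [hj]) (by simp)]
  simp

lemma ofReal_nsq (ψ : ι → ℂ) : (nsq ψ : ℂ) = star ψ ⬝ᵥ ψ := by
  rw [nsq, dotProduct]
  push_cast
  exact Finset.sum_congr rfl fun x _ => (Complex.conj_mul' (ψ x)).symm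

lemma nsq_mulVec_of_mem_unitaryGroup [DecidableEq ι] {U : Matrix ι ι ℂ}
    (hU : U ∈ Matrix.unitaryGroup ι ℂ) (ψ : ι → ℂ) : nsq (U *ᵥ ψ) = nsq ψ := by
  have hU' : Uᴴ * U = 1 := Matrix.mem_unitaryGroup_iff'.1 hU
  rw [← Complex.ofReal_inj, ofReal_nsq, ofReal_nsq, Matrix.star_mulVec,
    ← Matrix.dotProduct_mulVec, Matrix.mulVec_mulVec, hU', Matrix.one_mulVec]

lemma nsq_eq_sum_slices (e : ι ≃ κ × ρ) (ψ : ι → ℂ) :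
    nsq ψ = ∑ r, nsq fun u => ψ (e.symm (u, r)) := by
  rw [nsq, ← e.symm.sum_comp, Fintype.sum_prod_type_right]
  rfl

lemma sqrt_sum_nsq_add_le (φ ψ : κ → ι → ℂ) :
    √(∑ s, nsq (φ s + ψ s)) ≤ √(∑ s, nsq (φ s)) + √(∑ s, nsq (ψ s)) := by
  have sqrt_eq_norm (χ : κ → ι → ℂ) :
      √(∑ s, nsq (χ s)) = ‖(WithLp.toLp 2 fun p => χ p.1 p.2 : EuclideanSpace ℂ (κ × ι))‖ := by
    rw [EuclideanSpace.norm_eq, Fintype.sum_prod_type]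
    rfl
  rw [sqrt_eq_norm, sqrt_eq_norm, sqrt_eq_norm]
  exact norm_add_le (WithLp.toLp 2 _ : EuclideanSpace ℂ (κ × ι)) (WithLp.toLp 2 _)

lemma nsq_blockDiagonal_mulVec_sub [DecidableEq ρ] (e : ι ≃ κ × ρ) (B : ρ → Matrix κ κ ℂ)
    (ψ : ι → ℂ) : nsq ((Matrix.blockDiagonal B).submatrix e e *ᵥ ψ - ψ) =
      ∑ r, nsq ((B r *ᵥ fun u => ψ (e.symm (u, r))) - fun u => ψ (e.symm (u, r))) := by
  rw [nsq_eq_sum_slices e]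
  refine Finset.sum_congr rfl fun r _ => congrArg nsq (funext fun u => ?_)
  rw [Matrix.submatrix_mulVec_equiv]
  simp [Matrix.mulVec, dotProduct, Fintype.sum_prod_type, Matrix.blockDiagonal_apply]

end Nsq

section Spread

variable {ι : Type*} [Fintype ι] {k : ℕ} {U : ι → Op k} {c : ℝ}

/-- On average over `s`, the operator `U s` moves no vector by much. -/
def Spread (U : ι → Op k) (c : ℝ) : Prop :=
  ∀ ψ, ∑ s, nsq (U s *ᵥ ψ - ψ) ≤ c * nsq ψ

lemma Spread.mono {c' : ℝ} (h : Spread U c) (hc : c ≤ c') : Spread U c' := fun ψ =>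
  (h ψ).trans (mul_le_mul_of_nonneg_right hc (nsq_nonneg ψ))

lemma Spread.one (k : ℕ) (hc : 0 ≤ c) : Spread (fun _ : ι => (1 : Op k)) c := fun ψ => by
  simp only [Matrix.one_mulVec, sub_self, nsq_zero, Finset.sum_const_zero]
  exact mul_nonneg hc (nsq_nonneg ψ)

lemma Spread.conjTranspose (h : Spread U c) (hU : ∀ s, U s ∈ Matrix.unitaryGroup (Bits k) ℂ) :
    Spread (fun s => (U s)ᴴ) c := fun ψ => by
  refine le_trans (le_of_eq (Finset.sum_congr rfl fun s _ => ?_)) (h ψ)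
  have hU' : U s * (U s)ᴴ = 1 := Matrix.mem_unitaryGroup_iff.1 (hU s)
  rw [← nsq_mulVec_of_mem_unitaryGroup (hU s), Matrix.mulVec_sub, Matrix.mulVec_mulVec, hU',
    Matrix.one_mulVec, nsq_sub_comm]

lemma Spread.place (h : Spread U c) (hc : 0 ≤ c) (N : ℕ) (w : Fin k → ℕ) :
    Spread (fun s => place N w (U s)) c := by
  by_cases hw : Valid N w
  · intro ψ
    simp only [place_eq_kronecker hw, Matrix.kronecker_one, nsq_blockDiagonal_mulVec_sub]
    rw [Finset.sum_comm, nsq_eq_sum_slices (splitEquiv hw.fin_injective) ψ, Finset.mul_sum]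
    exact Finset.sum_le_sum fun r _ => h _
  · simp only [place_of_not_valid hw]
    exact Spread.one N hc

/-- The splitting of a bit string into its tail and its first bit. -/
def tailHeadEquiv (k : ℕ) : Bits (k + 1) ≃ Bits k × Bool :=
  (Fin.consEquiv fun _ => Bool).symm.trans (Equiv.prodComm _ _)

lemma controlled_eq_blockDiagonal (U : Op k) : controlled U =
    (Matrix.blockDiagonal fun b => if b = true then U else 1).submatrix (tailHeadEquiv k)
      (tailHeadEquiv k) := by
  ext x y
  simp only [Matrix.submatrix_apply, Matrix.blockDiagonal_apply]
  rfl

lemma controlled_one (k : ℕ) : controlled (1 : Op k) = 1 := by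
  simp only [controlled_eq_blockDiagonal, ite_self]
  rw [← Pi.one_def, Matrix.blockDiagonal_one, Matrix.submatrix_one_equiv]

lemma controlled_mem_unitaryGroup {U : Op k} (hU : U ∈ Matrix.unitaryGroup (Bits k) ℂ) :
    controlled U ∈ Matrix.unitaryGroup (Bits (k + 1)) ℂ := by
  have hU' : U * Uᴴ = 1 := Matrix.mem_unitaryGroup_iff.1 hU
  rw [Matrix.mem_unitaryGroup_iff, Matrix.star_eq_conjTranspose, ← controlled_one,
    controlled_eq_blockDiagonal, controlled_eq_blockDiagonal, Matrix.conjTranspose_submatrix,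
    Matrix.submatrix_mul_equiv, Matrix.blockDiagonal_conjTranspose, ← Matrix.blockDiagonal_mul]
  congr 2
  funext b
  cases b <;> simp [hU']

lemma Spread.controlled (h : Spread U c) (hc : 0 ≤ c) :
    Spread (fun s => controlled (U s)) c := fun ψ => by
  simp only [controlled_eq_blockDiagonal, nsq_blockDiagonal_mulVec_sub, Fintype.sum_bool,
    reduceCtorEq, if_true, if_false, Matrix.one_mulVec, sub_self, nsq_zero, add_zero]
  refine (h _).trans (mul_le_mul_of_nonneg_left ?_ hc)
  rw [nsq_eq_sum_slices (tailHeadEquiv k) ψ, Fintype.sum_bool]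
  exact le_add_of_nonneg_right (nsq_nonneg _)

/-! ### Queries to oracles close to the identity -/

lemma queryOp_mem_unitaryGroup {U : Op k} (hU : U ∈ Matrix.unitaryGroup (Bits k) ℂ) (N : ℕ)
    (inverse ctrl : Bool) (w : List ℕ) :
    queryOp N U inverse ctrl w ∈ Matrix.unitaryGroup (Bits N) ℂ := by
  have forward {V : Op k} (hV : V ∈ Matrix.unitaryGroup (Bits k) ℂ) :
      queryOp N V false ctrl w ∈ Matrix.unitaryGroup (Bits N) ℂ := by
    simp only [queryOp, reduceCtorEq, if_false]
    split_ifs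
    · exact place_mem_unitaryGroup _ _ (controlled_mem_unitaryGroup hV)
    · exact one_mem _
    · exact place_mem_unitaryGroup _ _ hV
    · exact one_mem _
  cases inverse
  · exact forward hU
  · exact forward (Unitary.star_mem hU)

lemma queryOp_one (N k : ℕ) (inverse ctrl : Bool) (w : List ℕ) :
    queryOp N (1 : Op k) inverse ctrl w = 1 := by
  simp [queryOp, controlled_one, place_one]

lemma Spread.queryOp (h : Spread U c) (hc : 0 ≤ c)
    (hU : ∀ s, U s ∈ Matrix.unitaryGroup (Bits k) ℂ) (N : ℕ) (inverse ctrl : Bool)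
    (w : List ℕ) : Spread (fun s => queryOp N (U s) inverse ctrl w) c := by
  have forward {V : ι → Op k} (hV : Spread V c) :
      Spread (fun s => QObf.queryOp N (V s) false ctrl w) c := by
    simp only [QObf.queryOp, reduceCtorEq, if_false]
    split_ifs
    · exact (hV.controlled hc).place hc _ _
    · exact Spread.one N hc
    · exact hV.place hc _ _
    · exact Spread.one N hc
  cases inverse
  · exact forward h
  · exact forward (h.conjTranspose hU)

end Spread

lemma OGate.op_mem_unitaryGroup {k₁ k₂ : ℕ} {U₁ : Op k₁} {U₂ : Op k₂}
    (hU₁ : U₁ ∈ Matrix.unitaryGroup (Bits k₁) ℂ) (hU₂ : U₂ ∈ Matrix.unitaryGroup (Bits k₂) ℂ)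
    (N : ℕ) (g : OGate) : g.op N U₁ U₂ ∈ Matrix.unitaryGroup (Bits N) ℂ := by
  cases g with
  | gate g => exact g.op_mem_unitaryGroup N
  | query second inverse ctrl w =>
    rw [OGate.op]
    split_ifs
    · exact queryOp_mem_unitaryGroup hU₂ _ _ _ _
    · exact queryOp_mem_unitaryGroup hU₁ _ _ _ _

lemma ogatesOp_mem_unitaryGroup {k₁ k₂ : ℕ} {U₁ : Op k₁} {U₂ : Op k₂}
    (hU₁ : U₁ ∈ Matrix.unitaryGroup (Bits k₁) ℂ) (hU₂ : U₂ ∈ Matrix.unitaryGroup (Bits k₂) ℂ)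
    (N : ℕ) (l : List OGate) : ogatesOp N U₁ U₂ l ∈ Matrix.unitaryGroup (Bits N) ℂ := by
  induction l with
  | nil => exact one_mem _
  | cons g l ih => exact mul_mem ih (g.op_mem_unitaryGroup hU₁ hU₂ N)

section Hybrid

variable {ι : Type*} [Fintype ι] {k₁ k₂ : ℕ} {U₁ : ι → Op k₁} {U₂ : ι → Op k₂} {c : ℝ}

lemma sum_nsq_ogateOp_sub_le (hc : 0 ≤ c) (h₁ : Spread U₁ c) (h₂ : Spread U₂ c)
    (hU₁ : ∀ s, U₁ s ∈ Matrix.unitaryGroup (Bits k₁) ℂ)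
    (hU₂ : ∀ s, U₂ s ∈ Matrix.unitaryGroup (Bits k₂) ℂ) (N : ℕ) (g : OGate) (ψ : Bits N → ℂ) :
    ∑ s, nsq (g.op N (U₁ s) (U₂ s) *ᵥ ψ - g.op N (1 : Op k₁) (1 : Op k₂) *ᵥ ψ) ≤ c * nsq ψ := by
  cases g with
  | gate g =>
    simp only [OGate.op, sub_self, nsq_zero, Finset.sum_const_zero]
    exact mul_nonneg hc (nsq_nonneg ψ)
  | query second inverse ctrl w =>
    cases second <;> simp only [OGate.op, reduceCtorEq, if_true, if_false, queryOp_one,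
      Matrix.one_mulVec]
    · exact h₁.queryOp hc hU₁ N inverse ctrl w ψ
    · exact h₂.queryOp hc hU₂ N inverse ctrl w ψ

/- The hybrid argument: the errors of the successive queries add up in the `ℓ²` norm over `s`. -/
lemma sqrt_sum_nsq_ogatesOp_sub_le (hc : 0 ≤ c) (h₁ : Spread U₁ c) (h₂ : Spread U₂ c)
    (hU₁ : ∀ s, U₁ s ∈ Matrix.unitaryGroup (Bits k₁) ℂ)
    (hU₂ : ∀ s, U₂ s ∈ Matrix.unitaryGroup (Bits k₂) ℂ) (N : ℕ) (l : List OGate)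
    (ψ : Bits N → ℂ) :
    √(∑ s, nsq (ogatesOp N (U₁ s) (U₂ s) l *ᵥ ψ - ogatesOp N (1 : Op k₁) (1 : Op k₂) l *ᵥ ψ)) ≤
      l.length * √(c * nsq ψ) := by
  induction l generalizing ψ with
  | nil => simp [ogatesOp, nsq_zero]
  | cons g l ih =>
    set φ := g.op N (1 : Op k₁) (1 : Op k₂) *ᵥ ψ with hφ
    have nsq_φ : nsq φ = nsq ψ :=
      nsq_mulVec_of_mem_unitaryGroup (g.op_mem_unitaryGroup (one_mem _) (one_mem _) N) ψ
    have telescope (s : ι) : ogatesOp N (U₁ s) (U₂ s) (g :: l) *ᵥ ψ -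
        ogatesOp N (1 : Op k₁) (1 : Op k₂) (g :: l) *ᵥ ψ =
        ogatesOp N (U₁ s) (U₂ s) l *ᵥ (g.op N (U₁ s) (U₂ s) *ᵥ ψ - φ) +
          (ogatesOp N (U₁ s) (U₂ s) l *ᵥ φ - ogatesOp N (1 : Op k₁) (1 : Op k₂) l *ᵥ φ) := by
      rw [ogatesOp, ogatesOp, ← Matrix.mulVec_mulVec, ← Matrix.mulVec_mulVec, ← hφ,
        Matrix.mulVec_sub]
      abel
    simp only [telescope, List.length_cons, Nat.cast_add_one, add_one_mul]
    refine (sqrt_sum_nsq_add_le _ _).trans ((add_le_add ?_ (nsq_φ ▸ ih φ)).trans_eq (add_comm _ _))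
    refine Real.sqrt_le_sqrt (le_trans (le_of_eq (Finset.sum_congr rfl fun s _ => ?_))
      (sum_nsq_ogateOp_sub_le hc h₁ h₂ hU₁ hU₂ N g ψ))
    exact nsq_mulVec_of_mem_unitaryGroup (ogatesOp_mem_unitaryGroup (hU₁ s) (hU₂ s) N l) _

lemma sum_nsq_ogatesOp_sub_le (hc : 0 ≤ c) (h₁ : Spread U₁ c) (h₂ : Spread U₂ c)
    (hU₁ : ∀ s, U₁ s ∈ Matrix.unitaryGroup (Bits k₁) ℂ)
    (hU₂ : ∀ s, U₂ s ∈ Matrix.unitaryGroup (Bits k₂) ℂ) (N : ℕ) (l : List OGate)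
    (ψ : Bits N → ℂ) :
    ∑ s, nsq (ogatesOp N (U₁ s) (U₂ s) l *ᵥ ψ - ogatesOp N (1 : Op k₁) (1 : Op k₂) l *ᵥ ψ) ≤
      (l.length : ℝ) ^ 2 * (c * nsq ψ) := by
  refine (Real.sqrt_le_sqrt_iff (mul_nonneg (sq_nonneg _) (mul_nonneg hc (nsq_nonneg ψ)))).1 ?_
  rw [Real.sqrt_mul (sq_nonneg _), Real.sqrt_sq l.length.cast_nonneg]
  exact sqrt_sum_nsq_ogatesOp_sub_le hc h₁ h₂ hU₁ hU₂ N l ψ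

end Hybrid

lemma prOne_eq_prob {N : ℕ} (ρ : Op N) : prOne ρ = prob (fun x => zeroExtend x 0 = true) ρ := by
  rw [prOne, prob]
  refine Finset.sum_congr rfl fun x _ => ?_
  congr 1
  rw [eq_iff_iff]
  by_cases hN : 0 < N
  · simp only [zeroExtend_of_lt x hN, hN, exists_true_left]
  · simp [zeroExtend_of_le x (Nat.le_of_not_lt hN), hN]

open Classical in
lemma prob_conj_single {N : ℕ} (S : Bits N → Prop) (V : Op N) (α : Bits N) :
    prob S (V * Matrix.single α α 1 * Vᴴ) =
      ∑ x, if S x then ‖(V *ᵥ Pi.single α 1) x‖ ^ 2 else 0 := by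
  have diagonal_entry (x : Bits N) :
      (V * Matrix.single α α 1 * Vᴴ : Op N) x x = ((‖V x α‖ ^ 2 : ℝ) : ℂ) := by
    rw [Matrix.mul_apply, Finset.sum_eq_single α (fun y _ hy => by
      rw [Matrix.mul_single_apply_of_ne _ _ _ _ _ hy, zero_mul]) (by simp),
      Matrix.mul_single_apply_same, mul_one, Matrix.conjTranspose_apply]
    push_cast
    exact Complex.mul_conj' _
  simp only [prob, diagonal_entry, Complex.ofReal_re, Matrix.mulVec_single_one, Matrix.col_apply]

lemma sq_le_of_le_add {x y z : ℝ} (hx : 0 ≤ x) (h : x ≤ y + z) {t : ℝ} (ht : 0 < t) :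
    x ^ 2 ≤ (1 + t) * y ^ 2 + (1 + t⁻¹) * z ^ 2 := by
  have expand : (1 + t) * y ^ 2 + (1 + t⁻¹) * z ^ 2 - (y + z) ^ 2 = t⁻¹ * (t * y - z) ^ 2 := by
    field_simp
    ring
  have square_nonneg : 0 ≤ t⁻¹ * (t * y - z) ^ 2 := by positivity
  linarith [pow_le_pow_left₀ hx h 2]

lemma prob_conj_single_le {N : ℕ} (S : Bits N → Prop) (V : Op N) {W : Op N}
    (hW : W ∈ Matrix.unitaryGroup (Bits N) ℂ) (α : Bits N) {t : ℝ} (ht : 0 < t) :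
    prob S (V * Matrix.single α α 1 * Vᴴ) ≤ prob S (W * Matrix.single α α 1 * Wᴴ) + t +
      (1 + t⁻¹) * nsq (V *ᵥ Pi.single α 1 - W *ᵥ Pi.single α 1) := by
  classical
  rw [prob_conj_single, prob_conj_single]
  set v := V *ᵥ Pi.single α 1
  set w := W *ᵥ Pi.single α 1
  have nsq_w : t * nsq w = t := by
    rw [nsq_mulVec_of_mem_unitaryGroup hW, nsq_single, mul_one]
  nth_rw 1 [← nsq_w]
  rw [nsq, nsq, Finset.mul_sum, Finset.mul_sum, ← Finset.sum_add_distrib,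
    ← Finset.sum_add_distrib]
  refine Finset.sum_le_sum fun x _ => ?_
  have triangle : ‖v x‖ ≤ ‖w x‖ + ‖(v - w) x‖ := norm_le_norm_add_norm_sub' _ _
  split_ifs
  · linarith [sq_le_of_le_add (norm_nonneg _) triangle ht]
  · positivity

lemma OAlg.exists_prAccept_near {ι : Type*} [Fintype ι] [Nonempty ι] {k₁ k₂ : ℕ}
    {U₁ U₁' : ι → Op k₁} {U₂ : ι → Op k₂} {c : ℝ} (hc : 0 ≤ c) (h₁ : Spread U₁ c)
    (h₁' : Spread U₁' c) (h₂ : Spread U₂ c)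
    (hU₁ : ∀ s, U₁ s ∈ Matrix.unitaryGroup (Bits k₁) ℂ)
    (hU₁' : ∀ s, U₁' s ∈ Matrix.unitaryGroup (Bits k₁) ℂ)
    (hU₂ : ∀ s, U₂ s ∈ Matrix.unitaryGroup (Bits k₂) ℂ) (S : OAlg)
    (hS : 2000 * (S.gates.length : ℝ) ^ 2 * c ≤ Fintype.card ι) :
    ∃ s, S.prAccept (U₁ s) (U₂ s) ≤ S.prAccept (U₁' s) (U₂ s) + 1 / 4 := by
  let e₀ : Bits S.qubits → ℂ := Pi.single (fun _ => false) 1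
  let V (s : ι) := ogatesOp S.qubits (U₁ s) (U₂ s) S.gates
  let V' (s : ι) := ogatesOp S.qubits (U₁' s) (U₂ s) S.gates
  let W := ogatesOp S.qubits (1 : Op k₁) (1 : Op k₂) S.gates
  have nsq_e₀ : nsq e₀ = 1 := nsq_single _
  have sum_V := sum_nsq_ogatesOp_sub_le hc h₁ h₂ hU₁ hU₂ S.qubits S.gates e₀
  have sum_V' := sum_nsq_ogatesOp_sub_le hc h₁' h₂ hU₁' hU₂ S.qubits S.gates e₀
  obtain ⟨s, -, hs⟩ : ∃ s ∈ (Finset.univ : Finset ι),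
      nsq (V s *ᵥ e₀ - W *ᵥ e₀) + nsq (V' s *ᵥ e₀ - W *ᵥ e₀) ≤ 1 / 1000 := by
    refine Finset.exists_le_of_sum_le Finset.univ_nonempty ?_
    rw [nsq_e₀, mul_one] at sum_V sum_V'
    rw [Finset.sum_add_distrib, Finset.sum_const, Finset.card_univ, nsmul_eq_mul]
    linarith
  have V_le_W := prob_conj_single_le (fun x => zeroExtend x 0 = true) (V s)
    (ogatesOp_mem_unitaryGroup (one_mem _) (one_mem _) S.qubits S.gates : W ∈ _)
    (fun _ => false) (t := 1 / 10) (by norm_num)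
  have W_le_V' := prob_conj_single_le (fun x => zeroExtend x 0 = true) W
    (ogatesOp_mem_unitaryGroup (hU₁' s) (hU₂ s) S.qubits S.gates : V' s ∈ _)
    (fun _ => false) (t := 1 / 10) (by norm_num)
  rw [nsq_sub_comm] at W_le_V'
  refine ⟨s, ?_⟩
  rw [OAlg.prAccept, OAlg.prAccept, prOne_eq_prob, prOne_eq_prob]
  change prob _ (V s * Matrix.single _ _ 1 * (V s)ᴴ) ≤
    prob _ (V' s * Matrix.single _ _ 1 * (V' s)ᴴ) + _
  linarith [nsq_nonneg (V s *ᵥ e₀ - W *ᵥ e₀), nsq_nonneg (V' s *ᵥ e₀ - W *ᵥ e₀)]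

lemma nsq_permMat_mulVec_sub_le {N : ℕ} {f : Bits N → Bits N} (hf : Function.Involutive f)
    (ψ : Bits N → ℂ) : nsq (permMat f *ᵥ ψ - ψ) ≤ 4 * ∑ y with f y ≠ y, ‖ψ y‖ ^ 2 := by
  have reindex : ∑ y with f y ≠ y, ‖ψ (f y)‖ ^ 2 = ∑ y with f y ≠ y, ‖ψ y‖ ^ 2 :=
    Finset.sum_equiv hf.toPerm (fun y => by simp [hf y, eq_comm]) fun _ _ => rfl
  calc nsq (permMat f *ᵥ ψ - ψ)
      = ∑ y with f y ≠ y, ‖ψ (f y) - ψ y‖ ^ 2 := by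
        simp only [nsq, Pi.sub_apply, permMat_mulVec hf]
        refine (Finset.sum_filter_of_ne fun y _ hy => ?_).symm
        contrapose! hy
        simp [hy]
    _ ≤ ∑ y with f y ≠ y, (2 * ‖ψ (f y)‖ ^ 2 + 2 * ‖ψ y‖ ^ 2) := by
        refine Finset.sum_le_sum fun y _ => ?_
        have triangle := norm_sub_le (ψ (f y)) (ψ y)
        exact (sq_le_of_le_add (norm_nonneg _) triangle one_pos).trans_eq (by norm_num)
    _ = 4 * ∑ y with f y ≠ y, ‖ψ y‖ ^ 2 := by
        rw [Finset.sum_add_distrib, ← Finset.mul_sum, ← Finset.mul_sum, reindex]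
        ring

lemma Spread.permMat {ι : Type*} [Fintype ι] {N : ℕ} {F : ι → Bits N → Bits N}
    (hF : ∀ s, Function.Involutive (F s)) {c : ℕ} (hc : ∀ y, {s | F s y ≠ y}.ncard ≤ c) :
    Spread (fun s => permMat (F s)) (4 * c) := fun ψ => by
  refine (Finset.sum_le_sum fun s _ => nsq_permMat_mulVec_sub_le (hF s) ψ).trans ?_
  simp only [Finset.sum_filter]
  rw [← Finset.mul_sum, Finset.sum_comm, mul_assoc]
  refine mul_le_mul_of_nonneg_left ?_ (by norm_num : (0 : ℝ) ≤ 4)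
  rw [nsq, Finset.mul_sum]
  refine Finset.sum_le_sum fun y _ => ?_
  rw [← Finset.sum_filter, Finset.sum_const, nsmul_eq_mul]
  refine mul_le_mul_of_nonneg_right (Nat.cast_le.2 ?_) (sq_nonneg _)
  simpa [Set.ncard_eq_toFinset_card'] using hc y

/-! ### Rules for measurement probabilities -/

lemma prob_interpret (J : QAlg) {m n : ℕ} (ρ : Op (m + n)) (S : Bits n → Prop)
    (T : Bits (m + n + J.ancillas) → Prop)
    (h : ∀ u x z, T (Fin.append (Fin.append u x) z) ↔ S x) :
    prob S (J.interpret ρ) = prob T (J.run ρ) := by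
  rw [prob, prob, sum_bits_append, sum_bits_append, Finset.sum_comm]
  refine Finset.sum_congr rfl fun x _ => ?_
  by_cases hx : S x
  · simp [h, hx, QAlg.interpret, Complex.re_sum]
  · simp [h, hx]

open Classical in
lemma prob_eq_re_trace {N : ℕ} (S : Bits N → Prop) (ρ : Op N) :
    prob S ρ = ((Matrix.diagonal (fun x => if S x then (1 : ℂ) else 0) * ρ).trace).re := by
  rw [prob, Matrix.trace, Complex.re_sum]
  refine Finset.sum_congr rfl fun x _ => ?_
  rw [Matrix.diag_apply, Matrix.diagonal_mul]
  split_ifs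
  · rw [one_mul]
  · rw [zero_mul, Complex.zero_re]

lemma prob_tensor_one_conj {m n : ℕ} {W : Op m} (hW : W ∈ Matrix.unitaryGroup (Bits m) ℂ)
    {S : Bits (m + n) → Prop} {T : Bits n → Prop} (h : ∀ u v, S (Fin.append u v) ↔ T v)
    (ρ : Op (m + n)) : prob S (tensor W 1 * ρ * (tensor W 1)ᴴ) = prob S ρ := by
  classical
  have event_eq : Matrix.diagonal (fun x => if S x then (1 : ℂ) else 0) =
      tensor (1 : Op m) (Matrix.diagonal fun v => if T v then (1 : ℂ) else 0) := by
    refine op_ext_append fun u v u' v' => ?_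
    rw [tensor_append, Matrix.diagonal_apply, Matrix.diagonal_apply, Matrix.one_apply]
    simp only [append_inj_iff, h, ite_and, ite_mul, one_mul, zero_mul]
  have hW' : Wᴴ * W = 1 := Matrix.mem_unitaryGroup_iff'.1 hW
  rw [prob_eq_re_trace, prob_eq_re_trace, event_eq, ← Matrix.mul_assoc, ← Matrix.mul_assoc,
    tensor_mul_tensor, Matrix.trace_mul_comm, ← Matrix.mul_assoc, conjTranspose_tensor,
    tensor_mul_tensor, one_mul, mul_one, hW', Matrix.conjTranspose_one, one_mul]

lemma zeroState_apply {n : ℕ} (x y : Bits n) :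
    zeroState n x y = if x = (fun _ => false) ∧ y = (fun _ => false) then 1 else 0 := by
  rw [zeroState, Matrix.single_apply]
  simp only [eq_comm]

lemma prob_tensor_zeroState {m n : ℕ} (S : Bits (m + n) → Prop) (ρ : Op m) :
    prob S (tensor ρ (zeroState n)) = prob (fun u => S (Fin.append u fun _ => false)) ρ := by
  rw [prob, prob, sum_bits_append]
  refine Finset.sum_congr rfl fun u _ => ?_
  rw [Finset.sum_eq_single (fun _ => false)]
  · simp [tensor_append, zeroState_apply]
  · intro v _ hv
    simp [tensor_append, zeroState_apply, hv]
  · exact fun h => absurd (Finset.mem_univ _) h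

lemma Computes.prob_conj {N : ℕ} {l : List Gate} {F : (ℕ → Bool) → ℕ → Bool} (h : Computes N l F)
    (S : Bits N → Prop) (ρ : Op N) :
    prob S (gatesOp N l * ρ * (gatesOp N l)ᴴ) =
      prob (fun y => S (truncate N (F (zeroExtend y)))) ρ := by
  have unitary := gatesOp_mem_unitaryGroup N l
  rw [h.gatesOp_eq] at unitary ⊢
  exact prob_permMat_conj (injective_of_permMat_mem_unitaryGroup unitary) S ρ

open Classical in
/-- The state `σ` on the first `q` of `N` qubits, with the others in state `0`. Unlike a tensor
product with `zeroState`, it does not tie the type to the form of the number of qubits. -/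
def padded (N : ℕ) {q : ℕ} (σ : Op q) : Op N :=
  Matrix.of fun x y => if ZeroFrom q (zeroExtend x) ∧ ZeroFrom q (zeroExtend y) then
    σ (truncate q (zeroExtend x)) (truncate q (zeroExtend y)) else 0

lemma tensor_zeroState {q : ℕ} (σ : Op q) (n : ℕ) :
    tensor σ (zeroState n) = padded (q + n) σ := by
  refine op_ext_append fun u v u' v' => ?_
  rw [tensor_append, zeroState_apply, padded, Matrix.of_apply]
  simp only [zeroFrom_zeroExtend_append, truncate_zeroExtend_append, mul_ite, mul_one, mul_zero]

lemma padded_padded {q K : ℕ} (hq : q ≤ K) (N : ℕ) (σ : Op q) :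
    padded N (padded K σ) = padded N σ := by
  ext x y
  simp only [padded, Matrix.of_apply]
  by_cases h : ZeroFrom K (zeroExtend x) ∧ ZeroFrom K (zeroExtend y)
  · rw [if_pos h, zeroExtend_truncate h.1, zeroExtend_truncate h.2]
  · rw [if_neg h, if_neg fun h' => h ⟨h'.1.mono hq, h'.2.mono hq⟩]

lemma tensor_padded {p K q : ℕ} (ρ : Op p) (σ : Op q) :
    tensor ρ (padded K σ) = padded (p + K) (tensor ρ σ) := by
  classical
  refine op_ext_append fun u v u' v' => ?_
  rw [tensor_append, padded, padded, Matrix.of_apply, Matrix.of_apply, mul_ite, mul_zero,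
    truncate_add_zeroExtend_append, truncate_add_zeroExtend_append, tensor_append]
  exact if_congr (and_congr (zeroFrom_zeroExtend_append_add u v).symm
    (zeroFrom_zeroExtend_append_add u' v').symm) rfl rfl

/-! ### The attack -/

/-- Runs the interpreter on the first state, with the second state (continued by zeros) as input,
and outputs the last qubit of the result, number `n`. -/
def attack (J : QAlg) (n q₁ q₂ : ℕ) : QAlg where
  ancillas := (n + 1 - q₂) + J.ancillas
  gates := J.gates ++ [.cx 0 (q₁ + n), .cx (q₁ + n) 0]

/- The two CNOTs copy the flag to the output qubit: `(x, y) ↦ (x, x + y) ↦ (y, x + y)`. -/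
lemma prOne_attack (J : QAlg) {n q₁ q₂ : ℕ} (hn : 0 < n) (hq : q₂ ≤ n + 1) (σ₁ : Op q₁)
    (σ₂ : Op q₂) : prOne ((attack J n q₁ q₂).run (tensor σ₁ σ₂)) =
      prob (fun x => zeroExtend x n = true) (J.interpret (tensor σ₁ (padded (n + 1) σ₂))) := by
  set copyFlag : List Gate := [.cx 0 (q₁ + n), .cx (q₁ + n) 0]
  set acceptance : ℕ → ℝ := fun N => prOne (gatesOp N (J.gates ++ copyFlag) *
    padded N (tensor σ₁ σ₂) * (gatesOp N (J.gates ++ copyFlag))ᴴ) with acceptance_def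
  have width_eq : q₁ + q₂ + (n + 1 - q₂ + J.ancillas) = q₁ + (n + 1) + J.ancillas := by omega
  have run_eq : prOne ((attack J n q₁ q₂).run (tensor σ₁ σ₂)) =
      acceptance (q₁ + q₂ + (n + 1 - q₂ + J.ancillas)) := by
    rw [QAlg.run, tensor_zeroState]
    rfl
  have computes_copyFlag : Computes (q₁ + (n + 1) + J.ancillas) copyFlag _ :=
    (Computes.cx (i := 0) (j := q₁ + n) (by omega) (by omega) (by omega)).append
      (Computes.cx (i := q₁ + n) (j := 0) (by omega) (by omega) (by omega))
  rw [run_eq, width_eq, acceptance_def]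
  dsimp only
  rw [prOne_eq_prob, gatesOp_append, Matrix.conjTranspose_mul, ← Matrix.mul_assoc,
    Matrix.mul_assoc (gatesOp _ copyFlag), Matrix.mul_assoc (gatesOp _ copyFlag),
    computes_copyFlag.prob_conj]
  rw [prob_interpret J _ _ fun x => zeroExtend x (q₁ + n) = true]
  · rw [QAlg.run, tensor_zeroState, tensor_padded, padded_padded (by omega)]
    refine prob_congr (fun y => ?_) _
    rw [zeroExtend_truncate (computes_copyFlag.zeroFrom _ (zeroFrom_zeroExtend y)),
      Function.comp, Function.update_self, Function.update_self,
      Function.update_of_ne (by omega : 0 ≠ q₁ + n)]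
    cases zeroExtend y 0 <;> cases zeroExtend y (q₁ + n) <;> decide
  · intro u x z
    rw [zeroExtend_append_left _ _ (by omega), zeroExtend_append_right]

/-! ### The circuits of the pair -/

/-- The circuit that adds `b` to its last register if the content of the first is `a`. -/
def pointCircuit (j : ℕ) (a b : Bits (j + 2)) : Circuit where
  qubits := 3 * (j + 2)
  gates := pointGates j (zeroExtend a) (zeroExtend b)

/-- The basis state with `a` in the first of three registers of `j + 2` qubits. -/
def pointInput (j : ℕ) (a : Bits (j + 2)) : Bits (3 * (j + 2)) := truncate _ (zeroExtend a)

/-- The content of the last of three registers of `j + 2` qubits is `b`. -/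
def OutputIs (j : ℕ) (b : Bits (j + 2)) (x : Bits (3 * (j + 2))) : Prop :=
  Matches (2 * j + 4) (zeroExtend b) (j + 2) (zeroExtend x)

lemma zeroExtend_pointInput (j : ℕ) (a : Bits (j + 2)) :
    zeroExtend (pointInput j a) = zeroExtend a :=
  zeroExtend_truncate ((zeroFrom_zeroExtend a).mono (by omega))

lemma matches_zeroExtend_iff {x m : ℕ} {a : Bits m} {σ : ℕ → Bool} :
    Matches x (zeroExtend a) m σ ↔ a = fun i : Fin m => σ (x + i) := by
  constructor
  · intro h
    funext i
    rw [h i i.2, zeroExtend_val]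
  · rintro rfl i hi
    rw [zeroExtend_of_lt _ hi]

lemma outputIs_pointFun_iff (j : ℕ) (a b b' : Bits (j + 2)) :
    OutputIs j b' (truncate (3 * (j + 2))
      (pointFun j (zeroExtend a) (zeroExtend b) (zeroExtend (pointInput j a)))) ↔ b = b' := by
  classical
  have input_matches : Matches 0 (zeroExtend a) (j + 2) (zeroExtend a) := fun i _ => by
    rw [zero_add]
  rw [OutputIs, zeroExtend_truncate
    ((Computes.point j _ _).zeroFrom _ (zeroFrom_zeroExtend _)), zeroExtend_pointInput,
    matches_zeroExtend_iff, eq_comm]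
  refine Eq.congr_left (funext fun i => ?_)
  rw [pointFun, xorRange_of_mem i.2, zeroExtend_of_le a (by omega), decide_eq_true input_matches,
    Bool.and_true, Bool.xor_false, zeroExtend_val]

lemma prob_pointCircuit (j : ℕ) (a b b' : Bits (j + 2)) :
    prob (OutputIs j b') (gatesOp (3 * (j + 2)) (pointCircuit j a b).gates *
      (Matrix.single (pointInput j a) (pointInput j a) 1 : Op (3 * (j + 2))) *
        (gatesOp (3 * (j + 2)) (pointCircuit j a b).gates)ᴴ) =
    if b = b' then 1 else 0 := by
  classical
  refine ((Computes.point j (zeroExtend a) (zeroExtend b)).prob_conj _ _).trans ?_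
  rw [prob_single]
  exact if_congr (outputIs_pointFun_iff j a b b') rfl rfl

/-- Writes `a` to the first register of the input of the interpreter `J`, which has `q` qubits of
advice, and runs `J`. Ill-formed gates of `J`, which act as the identity, are dropped: on the wider
circuit below they might be well-formed. -/
def loadGates (J : QAlg) (j q : ℕ) (a : Bits (j + 2)) : List Gate :=
  flips q (zeroExtend a) (j + 2) ++ filterBelow (q + 3 * (j + 2) + J.ancillas) J.gates

/-- The gates of the circuit that tests whether its first `q` qubits are advice with which the
interpreter `J` maps `a` to `b`; the result is added to the last qubit, number `n`. -/
def testGates (J : QAlg) (j q n : ℕ) (a b : Bits (j + 2)) : List Gate :=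
  loadGates J j q a ++ matchFlip (q + (2 * j + 4)) (n - (j + 1)) (zeroExtend b) j ++
    invGates (loadGates J j q a)

/-- The test, with ignored instructions up to a total of `n`, so that the numbers of qubits and of
gates, which the simulator sees, depend on `n` only. -/
def testCircuit (J : QAlg) (j q n : ℕ) (a b : Bits (j + 2)) : Circuit where
  qubits := n + 1
  gates := testGates J j q n a b ++ nops (n - (testGates J j q n a b).length)

lemma below_loadGates (J : QAlg) (j q : ℕ) (a : Bits (j + 2)) :
    ∀ g ∈ loadGates J j q a, g.Below (q + 3 * (j + 2) + J.ancillas) :=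
  List.forall_mem_append.2 ⟨below_flips _ (by omega), below_filterBelow⟩

lemma length_loadGates_le (J : QAlg) (j q : ℕ) (a : Bits (j + 2)) :
    (loadGates J j q a).length ≤ 6 * (j + 2) + J.gates.length := by
  rw [loadGates, List.length_append, length_flips]
  exact Nat.add_le_add_left (List.length_filter_le _ _) _

lemma length_testGates_le (J : QAlg) (j q n : ℕ) (a b : Bits (j + 2)) :
    (testGates J j q n a b).length ≤ 8 * (6 * (j + 2) + J.gates.length) + 16 * j + 28 := by
  rw [testGates, List.length_append, List.length_append, length_matchFlip]
  have load_le := length_loadGates_le J j q a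
  have inv_le := length_invGates_le (loadGates J j q a)
  omega

lemma below_testCircuit (J : QAlg) {j q n : ℕ} (a b : Bits (j + 2))
    (hn : q + 3 * (j + 2) + J.ancillas + (j + 1) ≤ n) :
    ∀ g ∈ (testCircuit J j q n a b).gates, g.Below (n + 1) := by
  have load : ∀ g ∈ loadGates J j q a, g.Below (n + 1) := fun g hg =>
    (below_loadGates J j q a g hg).mono (by omega)
  simp only [testCircuit, testGates, List.forall_mem_append]
  exact ⟨⟨⟨load, below_matchFlip _ (by omega) (by omega)⟩, below_invGates load⟩,
    below_nops (by omega) _⟩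

lemma gatesOp_testCircuit (J : QAlg) (j q n : ℕ) (a b : Bits (j + 2)) :
    gatesOp (n + 1) (testCircuit J j q n a b).gates = (gatesOp (n + 1) (loadGates J j q a))ᴴ *
      (gatesOp (n + 1) (matchFlip (q + (2 * j + 4)) (n - (j + 1)) (zeroExtend b) j) *
        gatesOp (n + 1) (loadGates J j q a)) := by
  have gatesOp_nops_eq (k : ℕ) : gatesOp (n + 1) (nops k) = 1 := by
    rw [(Computes.nops (n + 1) k).gatesOp_eq, ← permMat_id]
    exact congrArg permMat (funext truncate_zeroExtend)
  rw [testCircuit, gatesOp_append, gatesOp_nops_eq, one_mul, testGates, gatesOp_append,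
    gatesOp_append, gatesOp_invGates]

lemma truncate_xorRange_append {q m r : ℕ} (hm : m ≤ r) (s : ℕ) (c : ℕ → Bool) (u : Bits q)
    (x : Bits r) (z : Bits s) :
    truncate (q + r + s) (xorRange q m c (zeroExtend (Fin.append (Fin.append u x) z))) =
      Fin.append (Fin.append u (truncate r (xorRange 0 m c (zeroExtend x)))) z := by
  funext i
  induction i using Fin.addCases with
  | left i =>
    induction i using Fin.addCases with
    | left i =>
      simp only [truncate, Fin.append_left, Fin.val_castAdd]
      rw [xorRange_of_notMem (by omega), zeroExtend_append_left _ _ (by omega),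
        zeroExtend_append_left _ _ i.2, zeroExtend_val]
    | right i =>
      simp only [truncate, Fin.append_left, Fin.append_right, Fin.val_castAdd, Fin.val_natAdd]
      rw [xorRange, xorRange, zeroExtend_append_left _ _ (by omega), zeroExtend_append_right,
        Nat.add_sub_cancel_left, Nat.sub_zero]
      exact if_congr (by omega) rfl rfl
  | right i =>
    simp only [truncate, Fin.append_right, Fin.val_natAdd]
    rw [xorRange_of_notMem (by omega), zeroExtend_append_right, zeroExtend_val]

lemma xorRange_involutive {N y m : ℕ} (hN : y + m ≤ N) (c : ℕ → Bool) :
    Function.Involutive fun x : Bits N => truncate N (xorRange y m c (zeroExtend x)) := fun x => by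
  dsimp only
  rw [zeroExtend_truncate ((Computes.flips c hN).zeroFrom _ (zeroFrom_zeroExtend x)),
    xorRange_xorRange_self, truncate_zeroExtend]

lemma truncate_xorRange_eq_zero_iff {m r : ℕ} (a : Bits m) (x : Bits r) :
    truncate r (xorRange 0 m (zeroExtend a) (zeroExtend x)) = (fun _ => false) ↔
      truncate r (zeroExtend a) = x := by
  rw [funext_iff, funext_iff]
  refine forall_congr' fun i => ?_
  have xor_eq : xorRange 0 m (zeroExtend a) (zeroExtend x) i = xor (zeroExtend a i) (x i) := by
    rw [xorRange, Nat.sub_zero, zeroExtend_val]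
    split_ifs with hi
    · rfl
    · rw [zeroExtend_of_le a (by omega), Bool.false_xor]
  rw [truncate, truncate, xor_eq]
  cases zeroExtend a i <;> cases x i <;> decide

lemma loadGates_conj (J : QAlg) (j q : ℕ) (a : Bits (j + 2)) (σ : Op q) :
    gatesOp (q + 3 * (j + 2) + J.ancillas) (loadGates J j q a) *
      tensor (tensor σ (zeroState (3 * (j + 2)))) (zeroState J.ancillas) *
      (gatesOp (q + 3 * (j + 2) + J.ancillas) (loadGates J j q a))ᴴ =
    J.run (tensor σ (Matrix.single (pointInput j a) (pointInput j a) 1)) := by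
  rw [loadGates, gatesOp_append, gatesOp_filterBelow, Matrix.conjTranspose_mul, ← Matrix.mul_assoc,
    Matrix.mul_assoc (gatesOp _ J.gates), Matrix.mul_assoc (gatesOp _ J.gates), QAlg.run]
  congr 2
  have hN : q + (j + 2) ≤ q + 3 * (j + 2) + J.ancillas := by omega
  rw [(Computes.flips (zeroExtend a) hN).gatesOp_eq]
  refine op_ext_append fun u z u' z' => ?_
  obtain ⟨u, x, rfl⟩ := exists_eq_append u
  obtain ⟨u', x', rfl⟩ := exists_eq_append u'
  rw [permMat_conj_apply (xorRange_involutive hN (zeroExtend a)),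
    truncate_xorRange_append (by omega), truncate_xorRange_append (by omega)]
  rw [tensor_append, tensor_append, tensor_append, tensor_append, zeroState_apply,
    Matrix.single_apply]
  congr 2
  exact if_congr (and_congr (truncate_xorRange_eq_zero_iff a x)
    (truncate_xorRange_eq_zero_iff a x')) rfl rfl

lemma prob_matchFlip_conj {N M x d j : ℕ} (b : Bits (j + 2)) (hxN : x + (j + 2) ≤ N)
    (hxd : x + (j + 1) < d) (hd : d + (j + 1) = N + M) (ρ : Op N) :
    prob (fun y => zeroExtend y (N + M) = true)
      (gatesOp (N + (M + 1)) (matchFlip x d (zeroExtend b) j) * tensor ρ (zeroState (M + 1)) *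
        (gatesOp (N + (M + 1)) (matchFlip x d (zeroExtend b) j))ᴴ) =
      prob (fun y => Matches x (zeroExtend b) (j + 2) (zeroExtend y)) ρ := by
  classical
  have flip : Computes (N + (M + 1)) (matchFlip x d (zeroExtend b) j) _ :=
    Computes.matchFlip (zeroExtend b) hxd (by omega)
  rw [flip.prob_conj, prob_tensor_zeroState]
  refine prob_congr (fun y => ?_) ρ
  rw [zeroExtend_truncate (flip.zeroFrom _ (zeroFrom_zeroExtend _)), matchFlipFun, hd,
    Function.update_self, zeroExtend_append_right, zeroExtend_of_lt _ M.lt_succ_self,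
    Bool.xor_false, decide_eq_true_iff]
  exact matches_congr fun i hi => zeroExtend_append_left _ _ (by omega)

lemma testCircuit_conj (J : QAlg) (j q M : ℕ) (a b : Bits (j + 2)) (σ : Op q) :
    let N := q + 3 * (j + 2) + J.ancillas
    let W := gatesOp N (loadGates J j q a)
    let P := gatesOp (N + M + 1) (matchFlip (q + (2 * j + 4)) (N + M - (j + 1)) (zeroExtend b) j)
    let T := gatesOp (N + M + 1) (testCircuit J j q (N + M) a b).gates
    T * padded (N + M + 1) σ * Tᴴ = tensor Wᴴ (1 : Op (M + 1)) *
      (P * tensor (J.run (tensor σ (Matrix.single (pointInput j a) (pointInput j a) 1)))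
        (zeroState (M + 1)) * Pᴴ) * (tensor Wᴴ (1 : Op (M + 1)))ᴴ := by
  intro N W P T
  have load_eq : gatesOp (N + M + 1) (loadGates J j q a) = tensor W (1 : Op (M + 1)) :=
    gatesOp_add (M + 1) (below_loadGates J j q a)
  have padded_eq : padded (N + M + 1) σ =
      tensor (tensor (tensor σ (zeroState (3 * (j + 2)))) (zeroState J.ancillas))
        (zeroState (M + 1)) := by
    rw [tensor_zeroState, tensor_zeroState, tensor_zeroState, padded_padded (by omega),
      padded_padded (by omega)]
    rfl
  have run_eq : tensor (J.run (tensor σ (Matrix.single (pointInput j a) (pointInput j a) 1)))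
        (zeroState (M + 1)) = tensor W (1 : Op (M + 1)) *
        tensor (tensor (tensor σ (zeroState (3 * (j + 2)))) (zeroState J.ancillas))
          (zeroState (M + 1)) * tensor Wᴴ 1 := by
    rw [tensor_mul_tensor, tensor_mul_tensor, one_mul, mul_one, ← loadGates_conj]
  have test_eq : T = tensor Wᴴ (1 : Op (M + 1)) * (P * tensor W (1 : Op (M + 1))) := by
    refine (gatesOp_testCircuit J j q (N + M) a b).trans ?_
    rw [load_eq, conjTranspose_tensor, Matrix.conjTranspose_one]
  rw [test_eq, padded_eq, run_eq]
  simp only [Matrix.conjTranspose_mul, conjTranspose_tensor, Matrix.conjTranspose_one,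
    Matrix.conjTranspose_conjTranspose, Matrix.mul_assoc]

lemma prob_testCircuit (J : QAlg) {j q n : ℕ}
    (hn : q + 3 * (j + 2) + J.ancillas + (j + 1) ≤ n) (a b : Bits (j + 2)) (σ : Op q) :
    prob (fun x => zeroExtend x n = true)
      (gatesOp (n + 1) (testCircuit J j q n a b).gates * padded (n + 1) σ *
        (gatesOp (n + 1) (testCircuit J j q n a b).gates)ᴴ) =
    prob (OutputIs j b)
      (J.interpret (tensor σ (Matrix.single (pointInput j a) (pointInput j a) 1))) := by
  obtain ⟨M, rfl⟩ := Nat.exists_eq_add_of_le (le_of_add_le_left hn)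
  have uncompute := prob_tensor_one_conj (T := fun v : Bits (M + 1) => zeroExtend v M = true)
    (S := fun y : Bits (q + 3 * (j + 2) + J.ancillas + (M + 1)) =>
      zeroExtend y (q + 3 * (j + 2) + J.ancillas + M) = true)
    (Unitary.star_mem (gatesOp_mem_unitaryGroup (q + 3 * (j + 2) + J.ancillas)
      (loadGates J j q a))) (fun u v => by rw [zeroExtend_append_right])
  refine (congrArg _ (testCircuit_conj J j q M a b σ)).trans ((uncompute _).trans ?_)
  refine (prob_matchFlip_conj b (by omega) (by omega) (by omega) _).trans
    (prob_interpret J _ _ _ fun u x z => ?_).symm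
  refine forall₂_congr fun i hi => ?_
  rw [zeroExtend_append_left _ _ (by omega), add_assoc, zeroExtend_append_right]

/-! ### The circuits of the pair are close to the identity -/

lemma Computes.spread {ι : Type*} [Fintype ι] {N : ℕ} {l : ι → List Gate}
    {F : ι → (ℕ → Bool) → ℕ → Bool} (h : ∀ s, Computes N (l s) (F s))
    (hF : ∀ s, Function.Involutive (F s)) {c : ℕ} (hc : ∀ σ, {s | F s σ ≠ σ}.ncard ≤ c) :
    Spread (fun s => gatesOp N (l s)) (4 * c) := by
  have zeroExtend_image (s : ι) (y : Bits N) :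
      zeroExtend (truncate N (F s (zeroExtend y))) = F s (zeroExtend y) :=
    zeroExtend_truncate ((h s).zeroFrom _ (zeroFrom_zeroExtend y))
  simp only [(h _).gatesOp_eq]
  refine Spread.permMat (fun s y => ?_) fun y => ?_
  · rw [zeroExtend_image, hF s, truncate_zeroExtend]
  · have moved_subset : {s | truncate N (F s (zeroExtend y)) ≠ y} ⊆
        {s | F s (zeroExtend y) ≠ zeroExtend y} := fun s moved fixed =>
      moved (by rw [fixed, truncate_zeroExtend])
    exact (Set.ncard_le_ncard moved_subset (Set.toFinite _)).trans (hc (zeroExtend y))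

lemma pointFun_involutive (j : ℕ) (a b : ℕ → Bool) : Function.Involutive (pointFun j a b) :=
  fun σ => by
    classical
    simp only [pointFun, matches_xorRange (by omega : 0 + (j + 2) ≤ 2 * j + 4)]
    exact xorRange_xorRange_self _ _ _ σ

lemma matchFlipFun_involutive {x d j : ℕ} (hx : x + (j + 1) < d) (a : ℕ → Bool) :
    Function.Involutive (matchFlipFun x d a j) := fun σ => by
  classical
  simp only [matchFlipFun, matches_update (by omega : x + (j + 2) ≤ d + (j + 1)),
    Function.update_self, Function.update_idem, ← Bool.xor_assoc, Bool.xor_self, Bool.false_xor,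
    Function.update_eq_self]

lemma matches_of_pointFun_ne {j : ℕ} {a b σ : ℕ → Bool} (h : pointFun j a b σ ≠ σ) :
    Matches 0 a (j + 2) σ := by
  classical
  by_contra hm
  exact h (by simp [pointFun, hm, xorRange, funext_iff])

lemma matches_of_matchFlipFun_ne {x d j : ℕ} {a σ : ℕ → Bool} (h : matchFlipFun x d a j σ ≠ σ) :
    Matches x a (j + 2) σ := by
  classical
  by_contra hm
  exact h (by simp [matchFlipFun, hm])

lemma spread_pointCircuit (j : ℕ) : Spread (fun s : Bits (j + 2) × Bits (j + 2) =>
    gatesOp (3 * (j + 2)) (pointCircuit j s.1 s.2).gates) (4 * (2 ^ (j + 2) : ℕ)) := by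
  have computes (s : Bits (j + 2) × Bits (j + 2)) : Computes (3 * (j + 2))
      (pointCircuit j s.1 s.2).gates (pointFun j (zeroExtend s.1) (zeroExtend s.2)) :=
    Computes.point j _ _
  refine Computes.spread computes (fun s => pointFun_involutive j _ _) fun σ => ?_
  have moved_subset : {s : Bits (j + 2) × Bits (j + 2) |
      pointFun j (zeroExtend s.1) (zeroExtend s.2) σ ≠ σ} ⊆
      {fun i : Fin (j + 2) => σ (0 + i)} ×ˢ Set.univ := fun s hs =>
    ⟨matches_zeroExtend_iff.1 (matches_of_pointFun_ne hs), Set.mem_univ _⟩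
  refine (Set.ncard_le_ncard moved_subset (Set.toFinite _)).trans_eq ?_
  simp [Set.ncard_prod, Set.ncard_univ]

lemma spread_matchFlip {N x d j : ℕ} (hx : x + (j + 1) < d) (hd : d + (j + 1) < N) :
    Spread (fun b : Bits (j + 2) => gatesOp N (matchFlip x d (zeroExtend b) j)) 4 := by
  have spread := Computes.spread (c := 1)
    (fun b : Bits (j + 2) => Computes.matchFlip (zeroExtend b) hx hd)
    (fun b => matchFlipFun_involutive hx _) fun σ =>
      (Set.ncard_le_one_iff (Set.toFinite _)).2 fun {b b'} hb hb' => by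
        rw [matches_zeroExtend_iff.1 (matches_of_matchFlipFun_ne hb),
          matches_zeroExtend_iff.1 (matches_of_matchFlipFun_ne hb')]
  rwa [Nat.cast_one, mul_one] at spread

lemma nsq_testCircuit_mulVec_sub (J : QAlg) (j q n : ℕ) (a b : Bits (j + 2))
    (ψ : Bits (n + 1) → ℂ) :
    nsq (gatesOp (n + 1) (testCircuit J j q n a b).gates *ᵥ ψ - ψ) =
      nsq (gatesOp (n + 1) (matchFlip (q + (2 * j + 4)) (n - (j + 1)) (zeroExtend b) j) *ᵥ
        (gatesOp (n + 1) (loadGates J j q a) *ᵥ ψ) - gatesOp (n + 1) (loadGates J j q a) *ᵥ ψ) := by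
  have unitary := gatesOp_mem_unitaryGroup (n + 1) (loadGates J j q a)
  rw [← nsq_mulVec_of_mem_unitaryGroup unitary, gatesOp_testCircuit, Matrix.mulVec_sub,
    Matrix.mulVec_mulVec, ← Matrix.mul_assoc, ← Matrix.star_eq_conjTranspose,
    Matrix.mem_unitaryGroup_iff.1 unitary, one_mul, ← Matrix.mulVec_mulVec]

lemma sum_nsq_testCircuit_mulVec_sub_le (J : QAlg) {j q n : ℕ}
    (hn : q + 3 * (j + 2) + J.ancillas + (j + 1) ≤ n) (a : Bits (j + 2)) (ψ : Bits (n + 1) → ℂ) :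
    ∑ b, nsq (gatesOp (n + 1) (testCircuit J j q n a b).gates *ᵥ ψ - ψ) ≤ 4 * nsq ψ := by
  simp only [nsq_testCircuit_mulVec_sub]
  refine (spread_matchFlip (by omega) (by omega) _).trans_eq ?_
  rw [nsq_mulVec_of_mem_unitaryGroup (gatesOp_mem_unitaryGroup _ _)]

/- The number `q s` of advice qubits of the obfuscation may depend on the secret `s` in an arbitrary
way, hence the sum over all its possible values, which costs the factor `Q + 1`. -/
lemma spread_testCircuit {j n Q : ℕ} (J : ℕ → QAlg)
    (hn : ∀ q ≤ Q, q + 3 * (j + 2) + (J q).ancillas + (j + 1) ≤ n)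
    (β : Equiv.Perm (Bits (j + 2))) {q : Bits (j + 2) × Bits (j + 2) → ℕ} (hq : ∀ s, q s ≤ Q) :
    Spread (fun s => gatesOp (n + 1) (testCircuit (J (q s)) j (q s) n s.1 (β s.2)).gates)
      (4 * (2 ^ (j + 2) : ℕ) * (Q + 1)) := by
  intro ψ
  set displacement : Bits (j + 2) → Bits (j + 2) → ℕ → ℝ := fun a b q =>
    nsq (gatesOp (n + 1) (testCircuit (J q) j q n a b).gates *ᵥ ψ - ψ)
  calc ∑ s : Bits (j + 2) × Bits (j + 2), displacement s.1 (β s.2) (q s)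
      ≤ ∑ s : Bits (j + 2) × Bits (j + 2), ∑ q ∈ Finset.range (Q + 1),
          displacement s.1 (β s.2) q :=
        Finset.sum_le_sum fun s _ => Finset.single_le_sum
          (f := fun q => displacement s.1 (β s.2) q) (fun q _ => nsq_nonneg _)
          (Finset.mem_range_succ_iff.2 (hq s))
    _ = ∑ a, ∑ q ∈ Finset.range (Q + 1), ∑ b, displacement a b q := by
        rw [Fintype.sum_prod_type]
        refine Finset.sum_congr rfl fun a _ => ?_
        rw [Finset.sum_comm]
        exact Finset.sum_congr rfl fun q _ => Equiv.sum_comp β fun b => displacement a b q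
    _ ≤ ∑ _a : Bits (j + 2), ∑ _q ∈ Finset.range (Q + 1), 4 * nsq ψ :=
        Finset.sum_le_sum fun a _ => Finset.sum_le_sum fun q hq =>
          sum_nsq_testCircuit_mulVec_sub_le (J q) (hn q (Finset.mem_range_succ_iff.1 hq)) a ψ
    _ = 4 * (2 ^ (j + 2) : ℕ) * (Q + 1) * nsq ψ := by
        simp only [Finset.sum_const, Finset.card_univ, Finset.card_range, nsmul_eq_mul,
          Fintype.card_fun, Fintype.card_bool, Fintype.card_fin]
        push_cast
        ring

/-! ### Running programs -/

/-- The program `c`, started on `s`, halts in `s'` after at most `T` steps. -/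
def Runs (c : Prog) (s : Store) (T : ℕ) (s' : Store) : Prop := ∃ t ≤ T, Exec c s t s'

lemma Exec.runs {c : Prog} {s s' : Store} {t : ℕ} (h : Exec c s t s') : Runs c s t s' :=
  ⟨t, le_rfl, h⟩

lemma Runs.mono {c : Prog} {s s' : Store} {T T' : ℕ} (h : Runs c s T s') (hT : T ≤ T') :
    Runs c s T' s' := by
  obtain ⟨t, ht, h⟩ := h
  exact ⟨t, ht.trans hT, h⟩

lemma Runs.congr {c : Prog} {s s' s'' : Store} {T : ℕ} (h : Runs c s T s') (hs : s' = s'') :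
    Runs c s T s'' := hs ▸ h

lemma Runs.seq {c d : Prog} {s s' s'' : Store} {T T' : ℕ} (h : Runs c s T s')
    (h' : Runs d s' T' s'') : Runs (c.seq d) s (T + T') s'' := by
  obtain ⟨t, ht, h⟩ := h
  obtain ⟨t', ht', h'⟩ := h'
  exact ⟨t + t', add_le_add ht ht', h.seq h'⟩

lemma Runs.ifTop {r : ℕ} {c d : Prog} {s s' : Store} {T : ℕ} {b : Bool}
    (hb : (s r).headD false = b) (h : Runs (cond b c d) s T s') :
    Runs (.ifTop r c d) s (T + 1) s' := by
  obtain ⟨t, ht, h⟩ := h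
  have head_eq : (s r).head? = some true ↔ b = true := by
    rw [← hb]
    cases s r <;> simp
  cases b
  · exact ⟨t + 1, by omega, h.ifFalse (by simp [head_eq])⟩
  · exact ⟨t + 1, by omega, h.ifTrue (by simp [head_eq])⟩

lemma Runs.loopStep {r : ℕ} {c : Prog} {s s' s'' : Store} {T T' : ℕ} (hr : s r ≠ [])
    (h : Runs c s T s') (h' : Runs (c.loop r) s' T' s'') :
    Runs (c.loop r) s (T + T' + 1) s'' := by
  obtain ⟨t, ht, h⟩ := h
  obtain ⟨t', ht', h'⟩ := h'
  exact ⟨t + t' + 1, by omega, .loopStep hr h h'⟩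

lemma Runs.loop {r : ℕ} {c : Prog} {T : ℕ} (σ : ℕ → Store) {m : ℕ} (hm : σ m r = [])
    (h : ∀ i < m, σ i r ≠ [] ∧ Runs c (σ i) T (σ (i + 1))) :
    Runs (c.loop r) (σ 0) (m * (T + 1) + 1) (σ m) := by
  induction m generalizing σ with
  | zero => exact (Exec.loopDone hm).runs.mono (by omega)
  | succ m ih =>
    have first := h 0 m.succ_pos
    refine (Runs.loopStep first.1 first.2 (ih (fun i => σ (i + 1)) hm fun i hi =>
      h (i + 1) (by omega))).mono (le_of_eq ?_)
    ring

lemma Exec.length_le {c : Prog} {s s' : Store} {t : ℕ} (h : Exec c s t s') (r : ℕ) :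
    (s' r).length ≤ (s r).length + t := by
  induction h with
  | nop s => omega
  | push s r' b =>
    rcases eq_or_ne r r' with rfl | hr
    · rw [Function.update_self, List.length_cons]
    · rw [Function.update_of_ne hr]
      omega
  | pop s r' =>
    rcases eq_or_ne r r' with rfl | hr
    · rw [Function.update_self, List.length_tail]
      omega
    · rw [Function.update_of_ne hr]
      omega
  | seq _ _ ih ih' => omega
  | ifTrue _ _ ih => omega
  | ifFalse _ _ ih => omega
  | loopDone _ => omega
  | loopStep _ _ _ ih ih' => omega

lemma Runs.length_le {c : Prog} {s s' : Store} {T : ℕ} (h : Runs c s T s') (r : ℕ) :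
    (s' r).length ≤ (s r).length + T := by
  obtain ⟨t, ht, h⟩ := h
  exact (h.length_le r).trans (by omega)

/-- All the stacks of the program have numbers smaller than `R`. -/
def Prog.Below (R : ℕ) : Prog → Prop
  | .nop => True
  | .push r _ => r < R
  | .pop r => r < R
  | .seq c d => c.Below R ∧ d.Below R
  | .ifTop r c d => r < R ∧ c.Below R ∧ d.Below R
  | .loop r c => r < R ∧ c.Below R

lemma Prog.eventually_below (c : Prog) : ∀ᶠ R in Filter.atTop, c.Below R := by
  induction c with
  | nop => exact Filter.Eventually.of_forall fun _ => trivial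
  | push r _ => exact Filter.eventually_gt_atTop r
  | pop r => exact Filter.eventually_gt_atTop r
  | seq c d ih ih' => exact ih.and ih'
  | ifTop r c d ih ih' => exact (Filter.eventually_gt_atTop r).and (ih.and ih')
  | loop r c ih => exact (Filter.eventually_gt_atTop r).and ih

/-- The first `R` stacks of `s` and the other stacks of `u`. -/
def merge (R : ℕ) (s u : Store) : Store := fun r => if r < R then s r else u r

lemma merge_of_lt {R r : ℕ} (h : r < R) (s u : Store) : merge R s u r = s r := if_pos h

lemma merge_of_le {R r : ℕ} (h : R ≤ r) (s u : Store) : merge R s u r = u r := if_neg (by omega)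

lemma merge_eq_right {R : ℕ} {s u : Store} (h : ∀ r < R, u r = s r) : merge R s u = u := by
  funext r
  rcases lt_or_ge r R with hr | hr
  · rw [merge_of_lt hr, h r hr]
  · exact merge_of_le hr s u

lemma merge_update {R r : ℕ} (h : r < R) (s u : Store) (l : List Bool) :
    merge R (Function.update s r l) u = Function.update (merge R s u) r l := by
  funext x
  rcases eq_or_ne x r with rfl | hx
  · rw [merge_of_lt h, Function.update_self, Function.update_self]
  · rw [Function.update_of_ne hx, merge, merge, Function.update_of_ne hx]

lemma Exec.merge {R : ℕ} {c : Prog} {s s' : Store} {t : ℕ} (h : Exec c s t s') (hc : c.Below R)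
    (u : Store) : Exec c (merge R s u) t (merge R s' u) := by
  induction h with
  | nop s => exact Exec.nop _
  | push s r b =>
    rw [merge_update hc, ← merge_of_lt hc s u]
    exact Exec.push _ r b
  | pop s r =>
    rw [merge_update hc, ← merge_of_lt hc s u]
    exact Exec.pop _ r
  | seq _ _ ih ih' => exact Exec.seq (ih hc.1) (ih' hc.2)
  | ifTrue h _ ih => exact Exec.ifTrue (by rwa [merge_of_lt hc.1]) (ih hc.2.1)
  | ifFalse h _ ih => exact Exec.ifFalse (by rwa [merge_of_lt hc.1]) (ih hc.2.2)
  | loopDone h => exact Exec.loopDone (by rwa [merge_of_lt hc.1])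
  | loopStep h _ _ ih ih' => exact Exec.loopStep (by rwa [merge_of_lt hc.1]) (ih hc.2) (ih' hc)

/-- Pushes the listed bits on stack `r`, the last one first. -/
def emit (r : ℕ) : List Bool → Prog
  | [] => .nop
  | b :: l => .seq (emit r l) (.push r b)

lemma runs_emit (r : ℕ) (l : List Bool) (s : Store) :
    Runs (emit r l) s (l.length + 1) (Function.update s r (l ++ s r)) := by
  induction l with
  | nil =>
    rw [List.nil_append, Function.update_eq_self]
    exact (Exec.nop s).runs
  | cons b l ih =>
    refine (ih.seq (Exec.push _ r b).runs).congr ?_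
    rw [Function.update_idem, Function.update_self, List.cons_append]

/-- Pushes `true` on each of the listed stacks. -/
def pushEach : List ℕ → Prog
  | [] => .nop
  | r :: l => .seq (.push r true) (pushEach l)

lemma runs_pushEach {l : List ℕ} (hl : l.Nodup) (s : Store) :
    Runs (pushEach l) s (l.length + 1) fun x => if x ∈ l then true :: s x else s x := by
  induction l generalizing s with
  | nil => simpa [pushEach] using (Exec.nop s).runs
  | cons r l ih =>
    refine (((Exec.push s r true).runs.seq (ih hl.of_cons _)).mono (by grind)).congr ?_
    have hr : r ∉ l := (List.nodup_cons.1 hl).1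
    funext x
    rcases eq_or_ne x r with rfl | hx
    · simp [hr]
    · simp [hx]

/-- Empties stack `r` and pushes as many `true` on each of the listed stacks. -/
def drain (r : ℕ) (l : List ℕ) : Prog := .loop r (.seq (.pop r) (pushEach l))

/-- The store after `drain r l` is run on `s`. -/
def drained (r : ℕ) (l : List ℕ) (s : Store) : Store := fun x =>
  if x = r then [] else if x ∈ l then List.replicate (s r).length true ++ s x else s x

lemma runs_drain {r : ℕ} {l : List ℕ} (hl : l.Nodup) (hr : r ∉ l) (s : Store) :
    Runs (drain r l) s ((s r).length * (l.length + 3) + 1) (drained r l s) := by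
  set afterRounds : ℕ → Store := fun i x =>
    if x = r then (s r).drop i else if x ∈ l then List.replicate i true ++ s x else s x
    with afterRounds_def
  have start : afterRounds 0 = s := by
    funext x
    by_cases hx : x = r <;> simp [afterRounds, hx]
  have finish : afterRounds (s r).length = drained r l s := by
    funext x
    simp only [afterRounds, drained, List.drop_length]
  have run := Runs.loop (r := r) (c := .seq (.pop r) (pushEach l)) (T := l.length + 2) afterRounds
    (m := (s r).length) (by simp [afterRounds]) fun i hi => ?_
  · rwa [start, finish] at run
  · refine ⟨by simp [afterRounds, hi], ?_⟩
    refine (((Exec.pop _ r).runs.seq (runs_pushEach hl _)).mono (by omega)).congr ?_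
    funext x
    rcases eq_or_ne x r with rfl | hx
    · simp [afterRounds, hr]
    · by_cases hxl : x ∈ l <;> simp [afterRounds, hx, hxl, List.replicate_succ]

/-- Empties stack `r` and pops as many elements from stack `r'`. -/
def cancel (r r' : ℕ) : Prog := .loop r (.seq (.pop r) (.pop r'))

lemma runs_cancel {r r' : ℕ} (hr : r ≠ r') (s : Store) :
    Runs (cancel r r') s ((s r).length * 3 + 1)
      (Function.update (Function.update s r []) r' ((s r').drop (s r).length)) := by
  have run := Runs.loop (r := r) (c := .seq (.pop r) (.pop r')) (T := 2)
    (fun i => Function.update (Function.update s r ((s r).drop i)) r' ((s r').drop i))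
    (m := (s r).length) (by simp [hr]) fun i hi => ?_
  · simpa [cancel] using run
  · refine ⟨by simp [hr, hi], ((Exec.pop _ r).runs.seq (Exec.pop _ r').runs).congr ?_⟩
    rw [Function.update_comm hr.symm]
    simp [hr, Function.update_comm hr]

/-- Pops from stack `r` and pushes `b` on stack `r'`. -/
def popPush (r r' : ℕ) (b : Bool) : Prog := .seq (.pop r) (.push r' b)

lemma runs_popPush {r r' : ℕ} (hr : r ≠ r') (b : Bool) (s : Store) :
    Runs (popPush r r' b) s 2
      (Function.update (Function.update s r (s r).tail) r' (b :: s r')) := by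
  refine ((Exec.pop s r).seq (Exec.push _ r' b)).runs.congr ?_
  rw [Function.update_of_ne hr.symm]

/-- Moves the content of stack `r` to stack `r'`, in reverse order. -/
def reverseTo (r r' : ℕ) : Prog := .loop r (.ifTop r (popPush r r' true) (popPush r r' false))

lemma runs_reverseTo {r r' : ℕ} (hr : r ≠ r') (s : Store) :
    Runs (reverseTo r r') s ((s r).length * 4 + 1)
      (Function.update (Function.update s r []) r' ((s r).reverse ++ s r')) := by
  have run := Runs.loop (r := r) (c := .ifTop r (popPush r r' true) (popPush r r' false)) (T := 3)
    (fun i => Function.update (Function.update s r ((s r).drop i)) r'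
      (((s r).take i).reverse ++ s r'))
    (m := (s r).length) (by simp [hr]) fun i hi => ⟨by simp [hr, hi], ?_⟩
  · simpa [reverseTo] using run
  · refine Runs.ifTop (b := (s r)[i]) ?_ ?_
    · rw [Function.update_of_ne hr, Function.update_self, List.drop_eq_getElem_cons hi,
        List.headD_cons]
    · rw [← Bool.apply_cond (popPush r r'), show (bif (s r)[i] then true else false) = (s r)[i] by
        cases (s r)[i] <;> rfl]
      refine (runs_popPush hr _ _).congr ?_
      rw [Function.update_comm hr.symm, Function.update_idem, Function.update_idem,
        Function.update_of_ne hr, Function.update_self, Function.update_self, List.tail_drop,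
        List.take_succ_eq_append_getElem hi, List.reverse_append]
      rfl

/-! ### Decoding random bits -/

/-- Decodes a unary number and returns it with the rest of the input. Missing bits count as zeros,
here and in the other decoders, so that every input is a valid code. -/
def decNat : List Bool → ℕ × List Bool
  | true :: l => ((decNat l).1 + 1, (decNat l).2)
  | false :: l => (0, l)
  | [] => (0, [])

/-- Decodes a gate: two bits for its type, then the qubits it acts on. -/
def decGate (l : List Bool) : Gate × List Bool :=
  let i := decNat l.tail.tail
  let j := decNat i.2
  let k := decNat j.2
  match l.headD false, l.tail.headD false with
  | false, false => (.h i.1, i.2)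
  | false, true => (.t i.1, i.2)
  | true, false => (.cx i.1 j.1, j.2)
  | true, true => (.ccx i.1 j.1 k.1, k.2)

lemma length_decNat_le (l : List Bool) : (decNat l).1 + (decNat l).2.length ≤ l.length := by
  induction l with
  | nil => rfl
  | cons b l ih => cases b <;> simp only [decNat, List.length_cons] <;> omega

lemma length_decGate_le (l : List Bool) : (decGate l).2.length ≤ l.length := by
  have bound_i := length_decNat_le l.tail.tail
  have bound_j := length_decNat_le (decNat l.tail.tail).2
  have bound_k := length_decNat_le (decNat (decNat l.tail.tail).2).2
  simp only [List.length_tail] at bound_i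
  unfold decGate
  split <;> dsimp only <;> omega

/-- Decodes a list of gates. -/
def decGates : List Bool → List Gate × List Bool
  | true :: l => ((decGate l).1 :: (decGates (decGate l).2).1, (decGates (decGate l).2).2)
  | false :: l => ([], l)
  | [] => ([], [])
termination_by l => l.length
decreasing_by all_goals exact Nat.lt_succ_of_le (length_decGate_le l)

lemma length_decGates_le (l : List Bool) :
    (decGates l).1.length + (decGates l).2.length ≤ l.length := by
  induction l using decGates.induct with
  | case1 l ih =>
    have bound_gate := length_decGate_le l
    simp only [decGates, List.length_cons]
    omega
  | case2 l => simp [decGates]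
  | case3 => simp [decGates]

/-- Decodes a circuit. -/
def decCircuit (l : List Bool) : Circuit × List Bool :=
  (⟨(decNat l).1, (decGates (decNat l).2).1⟩, (decGates (decNat l).2).2)

lemma length_decCircuit_le (l : List Bool) :
    (decCircuit l).1.qubits + (decCircuit l).1.size + (decCircuit l).2.length ≤ l.length := by
  have bound_qubits := length_decNat_le l
  have bound_gates := length_decGates_le (decNat l).2
  simp only [decCircuit, Circuit.size]
  omega

/-- Decodes a pair of circuits and ignores the rest of the input. -/
def decPair (l : List Bool) : Circuit × Circuit :=
  ((decCircuit l).1, (decCircuit (decCircuit l).2).1)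

lemma decNat_encNat (n : ℕ) (l : List Bool) : decNat (encNat n ++ l) = (n, l) := by
  induction n with
  | zero => rfl
  | succ n ih =>
    rw [encNat] at ih
    rw [encNat, List.replicate_succ, List.cons_append, List.cons_append, decNat, ih]

lemma decGate_encGate (g : Gate) (l : List Bool) : decGate (encGate g ++ l) = (g, l) := by
  cases g <;> simp only [encGate, List.cons_append, List.append_assoc, decGate, List.tail_cons,
    List.headD_cons, decNat_encNat]

lemma decGates_encList (gs : List Gate) (l : List Bool) :
    decGates (encList encGate gs ++ l) = (gs, l) := by
  induction gs with
  | nil => simp [encList, decGates]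
  | cons g gs ih =>
    simp only [encList, List.cons_append, List.append_assoc, decGates, decGate_encGate, ih]

lemma decCircuit_encCircuit (C : Circuit) (l : List Bool) :
    decCircuit (encCircuit C ++ l) = (C, l) := by
  simp only [encCircuit, List.append_assoc, decCircuit, decNat_encNat, decGates_encList]

lemma decPair_encCircuitPair (P : Circuit × Circuit) (l : List Bool) :
    decPair (encCircuitPair P ++ l) = P := by
  simp only [encCircuitPair, List.append_assoc, decPair, decCircuit_encCircuit]

/-! ### The decoder as a program -/

/-- The store `s` after a program has left `rest` of its input on stack `1` and has written `out`
on stack `2`. The last bit written is on top, hence the reversal. -/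
def afterReading (s : Store) (out rest : List Bool) : Store :=
  Function.update (Function.update s 1 rest) 2 (out.reverse ++ s 2)

lemma afterReading_one (s : Store) (out rest : List Bool) : afterReading s out rest 1 = rest := by
  simp [afterReading]

lemma afterReading_of_ne {i : ℕ} (h₁ : i ≠ 1) (h₂ : i ≠ 2) (s : Store) (out rest : List Bool) :
    afterReading s out rest i = s i := by
  simp [afterReading, h₁, h₂]

lemma afterReading_afterReading (s : Store) (o m o' r : List Bool) :
    afterReading (afterReading s o m) o' r = afterReading s (o ++ o') r := by
  simp [afterReading, Function.update_comm (show (1 : ℕ) ≠ 2 by decide)]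

lemma afterReading_update {w : ℕ} (hw : 2 < w) (s : Store) (l o r : List Bool) :
    afterReading (Function.update s w l) o r = Function.update (afterReading s o r) w l := by
  have hw₁ : w ≠ 1 := by omega
  have hw₂ : w ≠ 2 := by omega
  simp only [afterReading, Function.update_comm hw₁, Function.update_comm hw₂,
    Function.update_of_ne hw₂.symm]

/-- The stacks `3, …, w - 1` are empty. -/
def IsWorkspace (w : ℕ) (s : Store) : Prop := ∀ i, 3 ≤ i → i < w → s i = []

lemma IsWorkspace.afterReading {w : ℕ} {s : Store} (h : IsWorkspace w s) (o r : List Bool) :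
    IsWorkspace w (afterReading s o r) := fun i hi hiw => by
  rw [afterReading_of_ne (by omega) (by omega), h i hi hiw]

/-- Started with `l` on stack `1` and with the stacks `3, …, w - 1` empty, the program leaves `r`
and writes `o`. It may use up to `100` steps for every bit that it reads, and `K` more. -/
def Reads (w : ℕ) (c : Prog) (l o r : List Bool) (K : ℕ) : Prop :=
  ∀ s : Store, s 1 = l → IsWorkspace w s →
    ∃ t, t + 100 * r.length ≤ 100 * l.length + K ∧ Runs c s t (afterReading s o r)

lemma Reads.mono {w w' K K' : ℕ} {c : Prog} {l o r : List Bool} (h : Reads w c l o r K)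
    (hw : w ≤ w') (hK : K ≤ K') : Reads w' c l o r K' := fun s input empty => by
  obtain ⟨t, ht, run⟩ := h s input fun i hi hiw => empty i hi (hiw.trans_le hw)
  exact ⟨t, by omega, run⟩

lemma Reads.seq {w K K' : ℕ} {c d : Prog} {l o m o' r : List Bool} (h : Reads w c l o m K)
    (h' : Reads w d m o' r K') : Reads w (c.seq d) l (o ++ o') r (K + K') := fun s input empty => by
  obtain ⟨t, ht, run⟩ := h s input empty
  obtain ⟨t', ht', run'⟩ := h' _ (afterReading_one s o m) (empty.afterReading o m)
  exact ⟨t + t', by omega, (run.seq run').congr (afterReading_afterReading s o m o' r)⟩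

lemma reads_nop (w : ℕ) (l : List Bool) : Reads w .nop l [] l 1 := by
  rintro s rfl -
  refine ⟨1, by omega, (Exec.nop s).runs.congr ?_⟩
  simp [afterReading]

lemma reads_popPush (w : ℕ) (b : Bool) (l : List Bool) :
    Reads w (popPush 1 2 b) l [b] l.tail 2 := by
  rintro s rfl -
  exact ⟨2, by rw [List.length_tail]; omega, runs_popPush (by decide) b s⟩

/-- Reads a bit, copies it to the output, and continues with `c` if it is `true` and with `d` if it
is `false` or missing. -/
def branch (c d : Prog) : Prog :=
  .ifTop 1 (.seq (popPush 1 2 true) c) (.seq (popPush 1 2 false) d)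

lemma runs_branch {c d : Prog} {s s' : Store} {b : Bool} {T : ℕ} (hb : (s 1).headD false = b)
    (h : Runs (.seq (popPush 1 2 b) (cond b c d)) s T s') : Runs (branch c d) s (T + 1) s' :=
  .ifTop hb (by cases b <;> exact h)

lemma Reads.branch {w K : ℕ} {c d : Prog} {l o r : List Bool} {b : Bool} (hb : l.headD false = b)
    (h : Reads w (cond b c d) l.tail o r K) : Reads w (branch c d) l (b :: o) r (K + 3) :=
  fun s input empty => by
    obtain ⟨t, ht, run⟩ := (reads_popPush w b l).seq h s input empty
    exact ⟨t + 1, by omega, runs_branch (input ▸ hb) run⟩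

/-- Reads a bit; as long as it is `true`, runs `c` and reads another bit. The flag on stack `w`
keeps the loop going. -/
def readRepeat (w : ℕ) (c : Prog) : Prog := .seq (.push w true) (.loop w (branch c (.pop w)))

/-- The loop of `readRepeat w c`, started with `l` on stack `1`, leaves `r` and writes `o`. -/
def LoopReads (w : ℕ) (c : Prog) (l o r : List Bool) : Prop :=
  ∀ s : Store, s 1 = l → IsWorkspace w s → s w = [true] →
    ∃ t, t + 100 * r.length ≤ 100 * l.length + 9 ∧
      Runs (.loop w (branch c (.pop w))) s t (Function.update (afterReading s o r) w [])

lemma LoopReads.halt {w : ℕ} (hw : 2 < w) (c : Prog) {l : List Bool} (hl : l.headD false = false) :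
    LoopReads w c l [false] l.tail := by
  rintro s rfl - flag
  have round : Runs (QObf.branch c (.pop w)) s 4 _ :=
    runs_branch hl ((runs_popPush (by decide) false s).seq (Exec.pop _ w).runs)
  refine ⟨4 + 1 + 1, by rw [List.length_tail]; omega,
    (Runs.loopStep (by simp [flag]) round (Exec.loopDone ?_).runs).congr ?_⟩
  all_goals simp [afterReading, flag, show w ≠ 1 by omega, show w ≠ 2 by omega]

lemma LoopReads.step {w K : ℕ} (hw : 2 < w) (hK : K ≤ 96) {c : Prog} {l o m o' r : List Bool}
    (h : Reads w c l o m K) (h' : LoopReads w c m o' r) :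
    LoopReads w c (true :: l) (true :: (o ++ o')) r := fun s input empty flag => by
  have copy : Runs (popPush 1 2 true) s 2 (afterReading s [true] l) := by
    rw [show l = (s 1).tail by rw [input, List.tail_cons]]
    exact runs_popPush (by decide) true s
  obtain ⟨t, ht, run⟩ := h _ (afterReading_one s [true] l) (empty.afterReading [true] l)
  rw [afterReading_afterReading] at run
  obtain ⟨t', ht', run'⟩ := h' _ (afterReading_one s ([true] ++ o) m) (empty.afterReading _ m)
    (by rw [afterReading_of_ne (by omega) (by omega), flag])
  have round : Runs (QObf.branch c (.pop w)) s (2 + t + 1) _ :=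
    runs_branch (b := true) (by rw [input, List.headD_cons]) (copy.seq run)
  refine ⟨2 + t + 1 + t' + 1, ?_, (Runs.loopStep (by simp [flag]) round run').congr ?_⟩
  · rw [List.length_cons]
    omega
  · rw [afterReading_afterReading, List.append_assoc, List.singleton_append]

lemma LoopReads.reads {w : ℕ} (hw : 2 < w) {c : Prog} {l o r : List Bool}
    (h : LoopReads w c l o r) : Reads (w + 1) (readRepeat w c) l o r 10 := fun s input empty => by
  have flag_empty : s w = [] := empty w hw w.lt_succ_self
  obtain ⟨t, ht, run⟩ := h (Function.update s w (true :: s w))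
    (by rw [Function.update_of_ne (by omega), input])
    (fun i hi hiw => by rw [Function.update_of_ne (by omega), empty i hi (by omega)])
    (by rw [Function.update_self, flag_empty])
  refine ⟨1 + t, by omega, ((Exec.push s w true).runs.seq run).congr ?_⟩
  rw [afterReading_update hw, Function.update_idem, Function.update_eq_self_iff,
    afterReading_of_ne (by omega) (by omega), flag_empty]

/-- Reads a number. -/
def readNat : Prog := readRepeat 3 .nop

lemma reads_readNat (l : List Bool) : Reads 4 readNat l (encNat (decNat l).1) (decNat l).2 10 := by
  refine LoopReads.reads (by decide) ?_
  induction l with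
  | nil => exact .halt (by decide) _ rfl
  | cons b l ih =>
    cases b
    · exact .halt (by decide) _ rfl
    · exact .step (by decide) (by decide) (o := []) (reads_nop 3 l) ih

/-- Reads a gate. -/
def readGate : Prog :=
  branch (branch (.seq readNat (.seq readNat readNat)) (.seq readNat readNat))
    (branch readNat readNat)

lemma reads_readGate (l : List Bool) :
    Reads 4 readGate l (encGate (decGate l).1) (decGate l).2 50 := by
  have read_i := reads_readNat l.tail.tail
  have read_j := reads_readNat (decNat l.tail.tail).2
  have read_k := reads_readNat (decNat (decNat l.tail.tail).2).2
  unfold decGate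
  split
  next type₁ type₂ => exact (Reads.branch type₁ (Reads.branch type₂ read_i)).mono le_rfl (by decide)
  next type₁ type₂ => exact (Reads.branch type₁ (Reads.branch type₂ read_i)).mono le_rfl (by decide)
  next type₁ type₂ =>
    exact (Reads.branch type₁ (Reads.branch type₂ (read_i.seq read_j))).mono le_rfl (by decide)
  next type₁ type₂ =>
    dsimp only [encGate]
    rw [List.append_assoc]
    exact (Reads.branch type₁ (Reads.branch type₂ (read_i.seq (read_j.seq read_k)))).mono le_rfl
      (by decide)

/-- Reads a circuit. -/
def readCircuit : Prog := .seq readNat (readRepeat 4 readGate)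

lemma loopReads_readGate (l : List Bool) :
    LoopReads 4 readGate l (encList encGate (decGates l).1) (decGates l).2 := by
  induction l using decGates.induct with
  | case1 l ih =>
    simp only [decGates]
    exact .step (by decide) (by decide) (reads_readGate l) ih
  | case2 l =>
    simp only [decGates]
    exact .halt (by decide) _ rfl
  | case3 =>
    simp only [decGates]
    exact .halt (by decide) _ rfl

lemma reads_readCircuit (l : List Bool) :
    Reads 5 readCircuit l (encCircuit (decCircuit l).1) (decCircuit l).2 20 :=
  ((reads_readNat l).mono (by decide) le_rfl).seq
    ((loopReads_readGate (decNat l).2).reads (by decide))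

/-- Writes the code of the pair of circuits that the random bits on stack `1` describe. -/
def sampler : Prog := .seq (drain 0 []) (.seq (.seq readCircuit readCircuit) (reverseTo 2 0))

lemma runs_sampler (n : ℕ) (l : List Bool) : ∃ s, s 0 = encCircuitPair (decPair l) ∧
    Runs sampler (fun i => if i = 0 then List.replicate n true else if i = 1 then l else [])
      (3 * n + 1 + (5 * (100 * l.length + 40) + 1)) s := by
  set initial : Store := fun i => if i = 0 then List.replicate n true else if i = 1 then l else []
  have clear := runs_drain (r := 0) List.nodup_nil List.not_mem_nil initial
  have clear_of_ne (i : ℕ) (hi : i ≠ 0) (hi' : i ≠ 1) : drained 0 [] initial i = [] := by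
    simp [drained, initial, hi, hi']
  obtain ⟨t, ht, read⟩ := (reads_readCircuit l).seq (reads_readCircuit (decCircuit l).2)
    (drained 0 [] initial) (by simp [drained, initial])
    fun i hi _ => clear_of_ne i (by omega) (by omega)
  set final := afterReading (drained 0 [] initial) _ _
  have output_length := read.length_le 2
  rw [clear_of_ne 2 (by decide) (by decide), List.length_nil] at output_length
  refine ⟨_, ?_, (clear.seq (read.seq (runs_reverseTo (by decide) _))).mono ?_⟩
  · simp [final, afterReading, drained, initial, encCircuitPair, decPair]
  · simp only [List.length_nil, show (initial 0).length = n from List.length_replicate]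
    omega

/-! ### The family of all pairs of circuits -/

/-- The number of random bits that `randomPairs` decodes, as a function of `n`. -/
def coins : Polynomial ℕ := 20 * (Polynomial.X + 2) ^ 2

lemma eval_coins (n : ℕ) : coins.eval n = 20 * (n + 2) ^ 2 := by simp [coins]

/-- The circuit-pair family of the theorem: the pairs of circuits that random bits describe. The
support contains all pairs of circuits of at most linear size, see
`mem_support_randomPairs_of_isSmall`. -/
def randomPairs : CircuitPairFamily where
  dist n := (PMF.uniformOfFintype (Bits (coins.eval n))).map fun r => decPair (List.ofFn r)
  poly_size := by
    refine ⟨coins, fun n P hP => ?_⟩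
    rw [PMF.mem_support_map_iff] at hP
    obtain ⟨r, -, rfl⟩ := hP
    have bound₁ := length_decCircuit_le (List.ofFn r)
    have bound₂ := length_decCircuit_le (decCircuit (List.ofFn r)).2
    rw [List.length_ofFn] at bound₁
    constructor <;> simp only [decPair] <;> omega

lemma randomPairs_isPolyTime : randomPairs.IsPolyTime := by
  refine ⟨sampler, 3 * Polynomial.X + 1 + (5 * (100 * coins + 40) + 1), coins,
    fun n r => decPair (List.ofFn r), fun n r => ?_, fun n => rfl⟩
  obtain ⟨s, output, t, ht, run⟩ := runs_sampler n (List.ofFn r)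
  refine ⟨t, s, run, ht.trans (le_of_eq ?_), output⟩
  rw [List.length_ofFn]
  simp

lemma mem_support_randomPairs {n : ℕ} {P : Circuit × Circuit}
    (h : (encCircuitPair P).length ≤ coins.eval n) : P ∈ (randomPairs.dist n).support := by
  rw [randomPairs, PMF.mem_support_map_iff]
  obtain ⟨padding, hpadding⟩ : ∃ k, (encCircuitPair P).length + k = coins.eval n :=
    ⟨_, Nat.add_sub_cancel' h⟩
  set l := encCircuitPair P ++ List.replicate padding false with l_def
  have length_l : l.length = coins.eval n := by
    rw [l_def, List.length_append, List.length_replicate, hpadding]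
  refine ⟨fun i => l.get (i.cast length_l.symm), by simp, ?_⟩
  rw [show List.ofFn (fun i : Fin (coins.eval n) => l.get (i.cast length_l.symm)) = l from
    List.ext_get (by simp [length_l]) fun i _ _ => by simp]
  exact decPair_encCircuitPair P _

lemma length_encNat (n : ℕ) : (encNat n).length = n + 1 := by simp [encNat]

lemma length_encGate_le {N : ℕ} {g : Gate} (h : g.Below N) : (encGate g).length ≤ 3 * N + 2 := by
  cases g <;> simp only [Gate.Below] at h <;>
    simp only [encGate, List.length_cons, List.length_append, length_encNat] <;> omega

lemma length_encList_le {α : Type} {enc : α → List Bool} {K : ℕ} {l : List α}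
    (h : ∀ a ∈ l, (enc a).length ≤ K) : (encList enc l).length ≤ l.length * (K + 1) + 1 := by
  induction l with
  | nil => simp [encList]
  | cons a l ih =>
    have bound_head := h a List.mem_cons_self
    have bound_tail := ih fun a ha => h a (List.mem_cons_of_mem _ ha)
    simp only [encList, List.length_cons, List.length_append, Nat.succ_mul]
    omega

/-- All the indices that occur in `C`, and its number of gates, are at most `n`. -/
def Circuit.IsSmall (C : Circuit) (n : ℕ) : Prop :=
  C.qubits ≤ n + 1 ∧ C.size ≤ n ∧ ∀ g ∈ C.gates, g.Below (n + 1)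

lemma Circuit.IsSmall.length_encCircuit_le {n : ℕ} {C : Circuit} (h : C.IsSmall n) :
    (encCircuit C).length ≤ 10 * (n + 2) ^ 2 := by
  obtain ⟨qubits_le, size_le, below⟩ := h
  have bound_gates := length_encList_le fun g hg => length_encGate_le (below g hg)
  rw [encCircuit, List.length_append, length_encNat]
  have : C.gates.length * (3 * (n + 1) + 2 + 1) ≤ n * (3 * (n + 1) + 2 + 1) :=
    Nat.mul_le_mul_right _ size_le
  nlinarith

lemma mem_support_randomPairs_of_isSmall {n : ℕ} {P : Circuit × Circuit} (h₁ : P.1.IsSmall n)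
    (h₂ : P.2.IsSmall n) : P ∈ (randomPairs.dist n).support := by
  have bound₁ := h₁.length_encCircuit_le
  have bound₂ := h₂.length_encCircuit_le
  refine mem_support_randomPairs ?_
  rw [eval_coins, encCircuitPair, List.length_append]
  omega

/-! ### The attack is efficient -/

lemma encList_append {α : Type} (enc : α → List Bool) (l : List α) :
    ∃ e, encList enc l = e ++ [false] ∧ ∀ l', encList enc (l ++ l') = e ++ encList enc l' := by
  induction l with
  | nil => exact ⟨[], rfl, fun _ => rfl⟩
  | cons a l ih =>
    obtain ⟨e, encList_eq, encList_append_eq⟩ := ih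
    exact ⟨true :: (enc a ++ e), by simp [encList, encList_eq],
      fun l' => by simp [encList, encList_append_eq]⟩

/-- The code of the attack with `k` padding qubits and flag qubit `f`, where `e` is the code of the
interpreter without its terminating bit. -/
def attackCode (e : List Bool) (k f : ℕ) : List Bool :=
  List.replicate k true ++ (e ++ ([true, true, false, false] ++ (List.replicate f true ++
    ([false, true, true, false] ++ (List.replicate f true ++ [false, false, false])))))

lemma encQAlg_attack (J : QAlg) (n q₁ q₂ : ℕ) : ∃ e, encQAlg J = e ++ [false] ∧
    encQAlg (attack J n q₁ q₂) = attackCode e (n + 1 - q₂) (q₁ + n) := by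
  obtain ⟨e, encList_eq, encList_append_eq⟩ := encList_append encGate J.gates
  refine ⟨encNat J.ancillas ++ e, by simp [encQAlg, encList_eq], ?_⟩
  rw [encQAlg, attack, encList_append_eq, attackCode]
  simp only [encList, encGate, encNat, List.replicate_zero, List.nil_append, List.append_assoc,
    List.cons_append, List.replicate_add]

/-- Replaces the parameters of the attack by those of the interpreter, whose program uses stacks
smaller than `R`, and saves on stacks from `R` on what `attackFinish` needs. -/
def attackPrepare (R : ℕ) : Prog :=
  .seq (drain 0 [R, R + 1, R + 2, R + 3]) (.seq (drain 1 [0, R + 1, R + 3])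
    (.seq (drain (R + 2) [1]) (.seq (.push 1 true) (.seq (.push R true) (cancel 2 R)))))

/-- The store after `attackPrepare`. -/
def attackPrepared (R n q₁ q₂ : ℕ) : Store := fun r =>
  if r = R then List.replicate (n + 1 - q₂) true
  else if r = R + 1 ∨ r = R + 3 then List.replicate (q₁ + n) true
  else unaryStore ![q₁, n + 1] r

/-- Turns the description of the interpreter into that of the attack. -/
def attackFinish (R : ℕ) : Prog :=
  .seq (reverseTo 0 (R + 2)) (.seq (.pop (R + 2))
    (.seq (emit 0 [false, false, false]) (.seq (drain (R + 1) [0])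
      (.seq (emit 0 [false, true, true, false]) (.seq (drain (R + 3) [0])
        (.seq (emit 0 [true, true, false, false]) (.seq (reverseTo (R + 2) 0) (drain R [0]))))))))

lemma runs_attackPrepare {R : ℕ} (hR : 3 ≤ R) (n q₁ q₂ : ℕ) :
    Runs (attackPrepare R) (unaryStore ![n, q₁, q₂]) (11 * (n + q₁ + q₂) + 6)
      (attackPrepared R n q₁ q₂) := by
  obtain ⟨R₀, R₁, R₂, R₀', R₁', R₂'⟩ : R ≠ 0 ∧ R ≠ 1 ∧ R ≠ 2 ∧ 0 ≠ R ∧ 1 ≠ R ∧ 2 ≠ R := by omega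
  have input : unaryStore ![n, q₁, q₂] 0 = List.replicate n true ∧
    unaryStore ![n, q₁, q₂] 1 = List.replicate q₁ true ∧
    unaryStore ![n, q₁, q₂] 2 = List.replicate q₂ true := ⟨rfl, rfl, rfl⟩
  have input_high (r : ℕ) (hr : 3 ≤ r) : unaryStore ![n, q₁, q₂] r = [] := dif_neg (by omega)
  have output : unaryStore ![q₁, n + 1] 0 = List.replicate q₁ true ∧
    unaryStore ![q₁, n + 1] 1 = List.replicate (n + 1) true := ⟨rfl, rfl⟩
  have output_high (r : ℕ) (hr : 2 ≤ r) : unaryStore ![q₁, n + 1] r = [] := dif_neg (by omega)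
  have input_R := input_high R hR
  have input_succ (i : ℕ) := input_high (R + (i + 1)) (by omega)
  have output_succ := output_high (R + 2) (by omega)
  refine (((runs_drain (by simp) (by simp [*]) _).seq ((runs_drain (by simp)
    (by simp [*]) _).seq ((runs_drain (by simp) (by simp) _).seq ((Exec.push _ _ _).runs.seq
      ((Exec.push _ _ _).runs.seq (runs_cancel R₂' _)))))).mono ?_).congr ?_
  · simp [drained, *]
    omega
  · funext r
    obtain rfl | rfl | rfl | rfl | rfl | rfl | rfl | hr : r = 0 ∨ r = 1 ∨ r = 2 ∨ r = R ∨
      r = R + 1 ∨ r = R + 2 ∨ r = R + 3 ∨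
      (3 ≤ r ∧ r ≠ R ∧ r ≠ R + 1 ∧ r ≠ R + 2 ∧ r ≠ R + 3) := by omega
    case inr.inr.inr.inr.inr.inr.inr =>
      obtain ⟨r_high, hr⟩ := hr
      simp [drained, attackPrepared, show r ≠ 0 by omega, show r ≠ 1 by omega,
        show r ≠ 2 by omega, input_high r r_high, output_high r (by omega), *]
    all_goals simp [drained, attackPrepared, ← List.replicate_succ, *]

lemma runs_attackFinish {R : ℕ} (hR : R ≠ 0) {s : Store} {e : List Bool} {k f : ℕ}
    (code : s 0 = e ++ [false]) (padding : s R = List.replicate k true)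
    (flag : s (R + 1) = List.replicate f true) (empty : s (R + 2) = [])
    (flag' : s (R + 3) = List.replicate f true) :
    ∃ s', Runs (attackFinish R) s (8 * (e.length + f) + 4 * k + 24) s' ∧
      s' 0 = attackCode e k f := by
  have hR' := hR.symm
  refine ⟨_, ((runs_reverseTo (by omega) s).seq ((Exec.pop _ _).runs.seq ((runs_emit _ _ _).seq
    ((runs_drain (by simp) (by simp) _).seq ((runs_emit _ _ _).seq
      ((runs_drain (by simp) (by simp) _).seq ((runs_emit _ _ _).seq
        ((runs_reverseTo (by omega) _).seq (runs_drain (by simp) (by simpa) _))))))))).mono ?_, ?_⟩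
  · simp [drained, *]
    omega
  · simp [drained, attackCode, *]

lemma eval_le_eval (p : Polynomial ℕ) {a b : ℕ} (h : a ≤ b) : p.eval a ≤ p.eval b := by
  rw [Polynomial.eval_eq_sum, Polynomial.eval_eq_sum]
  exact Finset.sum_le_sum fun i _ => Nat.mul_le_mul_left _ (Nat.pow_le_pow_left h i)

lemma isQPT_attack {J : (Fin 2 → ℕ) → QAlg} (hJ : IsQPT J) :
    IsQPT fun v : Fin 3 → ℕ => attack (J ![v 1, v 0 + 1]) (v 0) (v 1) (v 2) := by
  obtain ⟨c, p, hc⟩ := hJ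
  obtain ⟨R, below, hR⟩ := (c.eventually_below.and (Filter.eventually_ge_atTop 3)).exists
  refine ⟨.seq (attackPrepare R) (.seq c (attackFinish R)),
    50 * (Polynomial.X + 10) + 20 * p.comp (Polynomial.X + 1), fun v => ?_⟩
  obtain ⟨n, q₁, q₂, rfl⟩ : ∃ n q₁ q₂, v = ![n, q₁, q₂] :=
    ⟨v 0, v 1, v 2, by funext i; fin_cases i <;> rfl⟩
  obtain ⟨t, s, exec, ht, output⟩ := hc ![q₁, n + 1]
  have exec_merge := exec.merge below (attackPrepared R n q₁ q₂)
  rw [merge_eq_right fun r hr => by simp [attackPrepared, show r ≠ R by omega,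
    show r ≠ R + 1 by omega, show r ≠ R + 3 by omega]] at exec_merge
  obtain ⟨e, code, attack_code⟩ := encQAlg_attack (J ![q₁, n + 1]) n q₁ q₂
  obtain ⟨s', finish, output'⟩ := runs_attackFinish (R := R) (k := n + 1 - q₂) (f := q₁ + n)
    (by omega) (s := merge R s (attackPrepared R n q₁ q₂)) (e := e)
    (by rw [merge_of_lt (by omega), output, code])
    (by simp [merge, attackPrepared]) (by simp [merge, attackPrepared])
    (by simp [merge, attackPrepared, unaryStore]) (by simp [merge, attackPrepared])
  obtain ⟨t', ht', run⟩ := (runs_attackPrepare hR n q₁ q₂).seq (exec_merge.runs.seq finish)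
  refine ⟨t', s', run, ht'.trans ?_, output'.trans attack_code.symm⟩
  have code_length : e.length + 1 ≤ q₁ + t := by
    simpa [output, code, unaryStore] using exec.length_le 0
  have time_le : p.eval (q₁ + (n + 1)) ≤ p.eval (n + q₁ + q₂ + 1) := eval_le_eval p (by omega)
  simp only [Fin.sum_univ_three, Fin.sum_univ_two, Matrix.cons_val_zero, Matrix.cons_val_one,
    Matrix.cons_val, Polynomial.eval_add, Polynomial.eval_mul, Polynomial.eval_X,
    Polynomial.eval_comp, Polynomial.eval_ofNat, Polynomial.eval_one] at ht ⊢
  omega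

/-! ### Asymptotics -/

lemma eventually_mul_eval_le_two_pow (p : Polynomial ℕ) (c : ℕ) :
    ∀ᶠ k : ℕ in Filter.atTop, c * p.eval k ≤ 2 ^ k := by
  induction p using Polynomial.induction_on' generalizing c with
  | add p q hp hq =>
    filter_upwards [hp (2 * c), hq (2 * c)] with k hpk hqk
    rw [Polynomial.eval_add]
    linarith
  | monomial d a =>
    have ratio_tendsto := tendsto_pow_const_div_const_pow_of_one_lt d (one_lt_two (α := ℝ))
    filter_upwards [(ratio_tendsto.const_mul (c * a : ℝ)).eventually_le_const
      (by simp : (c * a : ℝ) * 0 < 1)] with k hk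
    rw [← mul_div_assoc, div_le_one (by positivity), mul_assoc] at hk
    rw [Polynomial.eval_monomial]
    exact_mod_cast hk

lemma Negligible.eventually_le {ε : ℕ → ℝ} (h : Negligible ε) {δ : ℝ} (hδ : 0 < δ) :
    ∀ᶠ m in Filter.atTop, ε m ≤ δ := by
  have tendsto_zero := h 0
  simp only [pow_zero, one_mul] at tendsto_zero
  exact tendsto_zero.eventually_le_const hδ

lemma IsUniform.exists_length_le {α : Type} {d : ℕ} {enc : α → List Bool} {F : (Fin d → ℕ) → α}
    (h : IsUniform enc F) : ∃ p : Polynomial ℕ, ∀ v, (enc (F v)).length ≤ p.eval (∑ i, v i) := by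
  obtain ⟨c, p, hc⟩ := h
  refine ⟨Polynomial.X + p, fun v => ?_⟩
  obtain ⟨t, s, exec, ht, output⟩ := hc v
  have output_length := exec.length_le 0
  have input_length : (unaryStore v 0).length ≤ ∑ i, v i := by
    unfold unaryStore
    split_ifs
    · rw [List.length_replicate]
      exact Finset.single_le_sum (fun _ _ => Nat.zero_le _) (Finset.mem_univ _)
    · exact Nat.zero_le _
  rw [output] at output_length
  rw [Polynomial.eval_add, Polynomial.eval_X]
  omega

lemma length_le_length_encList {α : Type} (enc : α → List Bool) (l : List α) :
    l.length ≤ (encList enc l).length := by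
  induction l with
  | nil => exact Nat.zero_le _
  | cons a l ih =>
    simp only [encList, List.length_cons, List.length_append]
    omega

lemma OAlg.length_gates_le (S : OAlg) : S.gates.length ≤ (encOAlg S).length := by
  have := length_le_length_encList encOGate S.gates
  rw [encOAlg, List.length_append]
  omega

lemma QAlg.ancillas_add_length_gates_le (A : QAlg) :
    A.ancillas + A.gates.length ≤ (encQAlg A).length := by
  have := length_le_length_encList encGate A.gates
  rw [encQAlg, List.length_append, length_encNat]
  omega

/-- A crude bound on the length of the interpreter `A` which ensures that `testCircuit A j q n` has
enough qubits, and that it can be made to consist of `n` gates. -/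
def QAlg.TestFits (A : QAlg) (j q n : ℕ) : Prop := q + 9 * (encQAlg A).length + 200 * (j + 1) ≤ n

lemma QAlg.TestFits.qubits_le {A : QAlg} {j q n : ℕ} (h : A.TestFits j q n) :
    q + 3 * (j + 2) + A.ancillas + (j + 1) ≤ n := by
  have := A.ancillas_add_length_gates_le
  unfold TestFits at h
  omega

lemma size_pointCircuit (j : ℕ) (a b : Bits (j + 2)) : (pointCircuit j a b).size = 34 * j + 60 :=
  length_pointGates j _ _

lemma isSmall_pointCircuit {j n : ℕ} (h : 34 * j + 60 ≤ n) (a b : Bits (j + 2)) :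
    (pointCircuit j a b).IsSmall n := by
  have qubits_le : 3 * (j + 2) ≤ n + 1 := by omega
  exact ⟨qubits_le, (size_pointCircuit j a b).trans_le h,
    fun g hg => (below_pointGates j _ _ g hg).mono qubits_le⟩

lemma QAlg.TestFits.size_testCircuit {A : QAlg} {j q n : ℕ} (h : A.TestFits j q n)
    (a b : Bits (j + 2)) : (testCircuit A j q n a b).size = n := by
  have := length_testGates_le A j q n a b
  have := A.ancillas_add_length_gates_le
  unfold TestFits at h
  simp only [Circuit.size, testCircuit, List.length_append, nops, List.length_replicate]
  omega

lemma QAlg.TestFits.isSmall_testCircuit {A : QAlg} {j q n : ℕ} (h : A.TestFits j q n)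
    (a b : Bits (j + 2)) : (testCircuit A j q n a b).IsSmall n :=
  ⟨le_rfl, (h.size_testCircuit a b).le, below_testCircuit A a b h.qubits_le⟩

lemma mem_randomPairs_of_isSmall {n : ℕ} {D : Circuit} (h : D.IsSmall n) : randomPairs.Mem D :=
  ⟨n, (D, D), mem_support_randomPairs_of_isSmall h h, Or.inl rfl⟩

/-! ### The success of the attack -/

lemma posSemidef_padded {q N : ℕ} (h : q ≤ N) {σ : Op q} (hσ : σ.PosSemidef) :
    (padded N σ).PosSemidef := by
  obtain ⟨r, rfl⟩ := Nat.exists_eq_add_of_le h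
  rw [← tensor_zeroState]
  exact posSemidef_tensor hσ (posSemidef_single _)

lemma trace_padded {q N : ℕ} (h : q ≤ N) (σ : Op q) : (padded N σ).trace = σ.trace := by
  obtain ⟨r, rfl⟩ := Nat.exists_eq_add_of_le h
  rw [← tensor_zeroState, trace_tensor, zeroState, Matrix.trace_single_eq_same, mul_one]

/-- With the advice `σ`, the interpreter `J` computes the circuit `D` up to an error `δ`. -/
def Evaluates (J : (Fin 2 → ℕ) → QAlg) (σ : QState) (D : Circuit) (δ : ℝ) : Prop :=
  ∀ ρ : Op D.qubits, ρ.PosSemidef → ρ.trace = 1 →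
    traceNorm ((J ![σ.qubits, D.qubits]).interpret (tensor σ.op ρ) -
      D.unitary * ρ * D.unitaryᴴ) ≤ δ

lemma Evaluates.abs_prob_sub_le {J : (Fin 2 → ℕ) → QAlg} {σ : QState} {D : Circuit} {δ : ℝ}
    (h : Evaluates J σ D δ) {ρ : Op D.qubits} (hρ : ρ.PosSemidef) (trace_ρ : ρ.trace = 1)
    (S : Bits D.qubits → Prop) :
    |prob S ((J ![σ.qubits, D.qubits]).interpret (tensor σ.op ρ)) -
      prob S (D.unitary * ρ * D.unitaryᴴ)| ≤ δ :=
  (abs_prob_sub_le_traceNorm S _ _).trans (h ρ hρ trace_ρ)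

lemma Evaluates.abs_prob_outputIs_sub_le {J : (Fin 2 → ℕ) → QAlg} {σ : QState} {j : ℕ}
    {a b : Bits (j + 2)} {δ : ℝ} (h : Evaluates J σ (pointCircuit j a b) δ) (b' : Bits (j + 2)) :
    |prob (OutputIs j b') ((J ![σ.qubits, 3 * (j + 2)]).interpret
      (tensor σ.op (Matrix.single (pointInput j a) (pointInput j a) 1))) -
        if b = b' then 1 else 0| ≤ δ := by
  rw [← prob_pointCircuit j a b b']
  exact h.abs_prob_sub_le (posSemidef_single _) (Matrix.trace_single_eq_same _ _) _

lemma Evaluates.abs_prOne_attack_sub_le {J : (Fin 2 → ℕ) → QAlg} {τ σ : QState} {A : QAlg}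
    {j n : ℕ} {a b' : Bits (j + 2)} {δ : ℝ}
    (hn : σ.qubits + 3 * (j + 2) + A.ancillas + (j + 1) ≤ n)
    (h : Evaluates J τ (testCircuit A j σ.qubits n a b') δ) :
    |prOne ((attack (J ![τ.qubits, n + 1]) n τ.qubits σ.qubits).run (tensor τ.op σ.op)) -
      prob (OutputIs j b') (A.interpret
        (tensor σ.op (Matrix.single (pointInput j a) (pointInput j a) 1)))| ≤ δ := by
  have qubits_le : σ.qubits ≤ n + 1 := by omega
  rw [prOne_attack _ (by omega) qubits_le, ← prob_testCircuit A hn]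
  exact h.abs_prob_sub_le (posSemidef_padded qubits_le σ.posSemidef)
    ((trace_padded qubits_le _).trans σ.trace_eq_one) _

/-! ### The impossibility of obfuscation -/

section
variable (O : Circuit → QState) (J : (Fin 2 → ℕ) → QAlg) (j n : ℕ)

/-- The number of qubits of the obfuscated point circuit of the pair `s`. -/
def adviceQubits (s : Bits (j + 2) × Bits (j + 2)) : ℕ := (O (pointCircuit j s.1 s.2)).qubits

/-- The circuit which tests whether the function computed by its advice, such as the obfuscated
point circuit of the pair `s`, maps the first component of `s` to `b'`. -/
def secretTest (s : Bits (j + 2) × Bits (j + 2)) (b' : Bits (j + 2)) : Circuit :=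
  testCircuit (J ![adviceQubits O j s, 3 * (j + 2)]) j (adviceQubits O j s) n s.1 b'

/-- The probability that the attack accepts the obfuscations of `D₁` and `D₂`. -/
def attackPr (D₁ D₂ : Circuit) : ℝ :=
  prOne ((attack (J ![(O D₁).qubits, n + 1]) n (O D₁).qubits (O D₂).qubits).run
    (tensor (O D₁).op (O D₂).op))

end

variable {O : Circuit → QState} {J : (Fin 2 → ℕ) → QAlg} {j n Q : ℕ}

lemma abs_attackPr_sub_le {s : Bits (j + 2) × Bits (j + 2)} {b' : Bits (j + 2)} {δ₁ δ₂ : ℝ}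
    (fits : (J ![adviceQubits O j s, 3 * (j + 2)]).TestFits j (adviceQubits O j s) n)
    (test : Evaluates J (O (secretTest O J j n s b')) (secretTest O J j n s b') δ₁)
    (point : Evaluates J (O (pointCircuit j s.1 s.2)) (pointCircuit j s.1 s.2) δ₂) :
    |attackPr O J n (secretTest O J j n s b') (pointCircuit j s.1 s.2) -
      if s.2 = b' then 1 else 0| ≤ δ₁ + δ₂ :=
  (abs_sub_le _ _ _).trans (add_le_add (test.abs_prOne_attack_sub_le fits.qubits_le)
    (point.abs_prob_outputIs_sub_le b'))

lemma exists_prAccept_secretTest_le (fits : ∀ q ≤ Q, (J ![q, 3 * (j + 2)]).TestFits j q n)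
    (advice_le : ∀ s, adviceQubits O j s ≤ Q) (S : OAlg)
    (hS : 8000 * S.gates.length ^ 2 * (Q + 1) ≤ 2 ^ (j + 2)) :
    ∃ s, S.prAccept (secretTest O J j n s s.2).unitary (pointCircuit j s.1 s.2).unitary ≤
      S.prAccept (secretTest O J j n s s.2ᶜ).unitary (pointCircuit j s.1 s.2).unitary + 1 / 4 := by
  have qubits_le (q) (hq : q ≤ Q) := (fits q hq).qubits_le
  have unitary := gatesOp_mem_unitaryGroup
  refine OAlg.exists_prAccept_near (c := 4 * (2 ^ (j + 2) : ℕ) * (Q + 1)) (by positivity)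
    (spread_testCircuit (fun q => J ![q, 3 * (j + 2)]) qubits_le (Equiv.refl _) advice_le)
    (spread_testCircuit (fun q => J ![q, 3 * (j + 2)]) qubits_le compl_involutive.toPerm advice_le)
    ((spread_pointCircuit j).mono (le_mul_of_one_le_right (by positivity) (by simp)))
    (fun _ => unitary _ _) (fun _ => unitary _ _) (fun _ => unitary _ _) S ?_
  have hS' : (8000 : ℝ) * S.gates.length ^ 2 * (Q + 1) ≤ 2 ^ (j + 2) := by exact_mod_cast hS
  calc 2000 * (S.gates.length : ℝ) ^ 2 * (4 * (2 ^ (j + 2) : ℕ) * (Q + 1))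
      = 8000 * S.gates.length ^ 2 * (Q + 1) * 2 ^ (j + 2) := by push_cast; ring
    _ ≤ 2 ^ (j + 2) * 2 ^ (j + 2) := by gcongr
    _ = Fintype.card (Bits (j + 2) × Bits (j + 2)) := by simp

lemma exists_lt_abs_attackPr_sub_prAccept (fits : ∀ q ≤ Q, (J ![q, 3 * (j + 2)]).TestFits j q n)
    (advice_le : ∀ s, adviceQubits O j s ≤ Q)
    (point : ∀ s : Bits (j + 2) × Bits (j + 2),
      Evaluates J (O (pointCircuit j s.1 s.2)) (pointCircuit j s.1 s.2) (1 / 20))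
    (test : ∀ s b, Evaluates J (O (secretTest O J j n s b)) (secretTest O J j n s b) (1 / 20))
    (S : OAlg) (hS : 8000 * S.gates.length ^ 2 * (Q + 1) ≤ 2 ^ (j + 2)) :
    ∃ s b, 1 / 20 < |attackPr O J n (secretTest O J j n s b) (pointCircuit j s.1 s.2) -
      S.prAccept (secretTest O J j n s b).unitary (pointCircuit j s.1 s.2).unitary| := by
  by_contra! simulated
  obtain ⟨s, near⟩ := exists_prAccept_secretTest_le fits advice_le S hS
  have attack_secret := abs_attackPr_sub_le (fits _ (advice_le s)) (test s s.2) (point s)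
  have attack_compl := abs_attackPr_sub_le (fits _ (advice_le s)) (test s s.2ᶜ) (point s)
  rw [if_pos rfl] at attack_secret
  rw [if_neg ne_compl_self] at attack_compl
  linarith [abs_le.1 attack_secret, abs_le.1 attack_compl, abs_le.1 (simulated s s.2),
    abs_le.1 (simulated s s.2ᶜ)]

lemma exists_parameters (p pJ pS : Polynomial ℕ) (j₀ : ℕ) :
    ∃ j ≥ j₀, ∃ Q n, Q = p.eval (37 * j + 66) ∧
      n = Q + 9 * pJ.eval (Q + 3 * (j + 2)) + 200 * (j + 1) ∧
      8000 * pS.eval (3 * n + 37 * j + 67) ^ 2 * (Q + 1) ≤ 2 ^ (j + 2) := by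
  let rQ : Polynomial ℕ := p.comp (37 * Polynomial.X + 66)
  let rn : Polynomial ℕ :=
    rQ + 9 * pJ.comp (rQ + 3 * (Polynomial.X + 2)) + 200 * (Polynomial.X + 1)
  let rT : Polynomial ℕ := pS.comp (3 * rn + 37 * Polynomial.X + 67)
  obtain ⟨j, growth, hj⟩ := ((eventually_mul_eval_le_two_pow (rT ^ 2 * (rQ + 1)) 8000).and
    (Filter.eventually_ge_atTop j₀)).exists
  refine ⟨j, hj, rQ.eval j, rn.eval j, by simp [rQ], by simp [rn], ?_⟩
  calc 8000 * pS.eval (3 * rn.eval j + 37 * j + 67) ^ 2 * (rQ.eval j + 1)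
      = 8000 * (rT ^ 2 * (rQ + 1)).eval j := by simp [rT, mul_assoc]
    _ ≤ 2 ^ (j + 2) := growth.trans (Nat.pow_le_pow_right two_pos (by omega))

lemma testFits_of_length_le {pJ : Polynomial ℕ}
    (length_J : ∀ v, (encQAlg (J v)).length ≤ pJ.eval (∑ i, v i))
    (hn : Q + 9 * pJ.eval (Q + 3 * (j + 2)) + 200 * (j + 1) ≤ n) {q : ℕ} (hq : q ≤ Q) :
    (J ![q, 3 * (j + 2)]).TestFits j q n := by
  have length_le : (encQAlg (J ![q, 3 * (j + 2)])).length ≤ pJ.eval (Q + 3 * (j + 2)) :=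
    (length_J _).trans (eval_le_eval pJ (by simpa using hq))
  unfold QAlg.TestFits
  omega

lemma adviceQubits_le {p : Polynomial ℕ}
    (expansion : ∀ D, randomPairs.Mem D → (O D).qubits ≤ p.eval (D.qubits + D.size))
    (s : Bits (j + 2) × Bits (j + 2)) : adviceQubits O j s ≤ p.eval (37 * j + 66) := by
  refine (expansion _ (mem_randomPairs_of_isSmall (isSmall_pointCircuit le_rfl _ _))).trans_eq
    (congrArg (p.eval ·) ?_)
  rw [size_pointCircuit]
  simp only [pointCircuit]
  omega

lemma not_exists_obfuscator (hJ : IsQPT J) (expansion : PolyExpansion randomPairs O)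
    (equivalence : FunctionalEquivalence randomPairs O J) (vbb : TwoCircuitVBB randomPairs O) :
    False := by
  obtain ⟨S, hS, ε, negligible_ε, simulated⟩ := vbb _ (isQPT_attack hJ)
  obtain ⟨p, expansion⟩ := expansion
  obtain ⟨η, negligible_η, evaluates⟩ := equivalence
  obtain ⟨pJ, length_J⟩ := hJ.exists_length_le
  obtain ⟨pS, length_S⟩ := hS.exists_length_le
  have small : (0 : ℝ) < 1 / 20 := by norm_num
  obtain ⟨j₀, errors_le⟩ := Filter.eventually_atTop.1
    ((negligible_ε.eventually_le small).and (negligible_η.eventually_le small))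
  obtain ⟨j, hj, Q, n, hQ, hn, hT⟩ := exists_parameters p pJ pS j₀
  have fits (q) (hq : q ≤ Q) : (J ![q, 3 * (j + 2)]).TestFits j q n :=
    testFits_of_length_le length_J hn.ge hq
  have advice_le (s) : adviceQubits O j s ≤ Q := (adviceQubits_le expansion s).trans_eq hQ.symm
  have small_point (s : Bits (j + 2) × Bits (j + 2)) : (pointCircuit j s.1 s.2).IsSmall n :=
    isSmall_pointCircuit (by omega) _ _
  have small_test (s b) : (secretTest O J j n s b).IsSmall n :=
    (fits _ (advice_le s)).isSmall_testCircuit _ _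
  have size_test (s b) : (secretTest O J j n s b).size = n :=
    (fits _ (advice_le s)).size_testCircuit _ _
  have evaluates_small {D : Circuit} (small_D : D.IsSmall n) (hD : j ≤ D.qubits) :
      Evaluates J (O D) D (1 / 20) := fun ρ hρ trace_ρ =>
    (evaluates D (mem_randomPairs_of_isSmall small_D) ρ hρ trace_ρ).trans
      (errors_le _ (hj.trans hD)).2
  let S₀ := S ![n, n + 1, 3 * (j + 2), n, 34 * j + 60]
  have length_S₀ : S₀.gates.length ≤ pS.eval (3 * n + 37 * j + 67) := by
    refine S₀.length_gates_le.trans ((length_S _).trans_eq (congrArg (pS.eval ·) ?_))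
    simp [Fin.sum_univ_five]
    omega
  obtain ⟨s, b, far⟩ := exists_lt_abs_attackPr_sub_prAccept fits advice_le
    (fun s => evaluates_small (small_point s) (by simp only [pointCircuit]; omega))
    (fun s b => evaluates_small (small_test s b) (by
      simp only [secretTest, testCircuit]; omega)) S₀ ((by gcongr : _ ≤ _).trans hT)
  have near := simulated n (secretTest O J j n s b, pointCircuit j s.1 s.2)
    (mem_support_randomPairs_of_isSmall (small_test s b) (small_point s))
  simp only [size_test, size_pointCircuit] at near
  exact far.not_ge (near.trans (errors_le _ (by omega)).1)

end QObf

end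

theorem mainTheorem3 :
    ∃ C : QObf.CircuitPairFamily, C.IsPolyTime ∧
      ∀ C' : QObf.StatePairFamily, ¬ C'.IsObfuscationOf C := by
  refine ⟨QObf.randomPairs, QObf.randomPairs_isPolyTime, ?_⟩
  rintro C' ⟨O, J, -, hJ, expansion, equivalence, vbb⟩
  exact QObf.not_exists_obfuscator hJ expansion equivalence vbb
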